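/- **Setting.** Let $T$ be a finite rooted tree all of whose leaves have the same depth $d\ge 1$. Let $L$ be its set of leaves, $I$ its set of inner nodes and $C_v$ the set of children of $v$. For each inner node $v$ of depth $d-1$ let a partial order $P_v$ on $C_v$ (a leaf poset) be given; for the other $v\in I$ let $P_v$ be the antichain on $C_v$. Let $\mathcal L(P_v)$ be the set of linear extensions of $P_v$, written as words $\pi_1\cdots\pi_n$, and let $\mathcal L(T)=\prod_{v\in I}\mathcal L(P_v)$. Let $\mathcal A(L)$ be the set of all $E\subseteq L$ containing no two siblings, and for $E\in\mathcal A(L)$ let $C_v^E$ be the set of $w\in C_v$ such that $w$ or a descendant of $w$ lies in $E$. The move $\widehat\partial_E$ acts on $(\pi_v)_{v\in I}\in\mathcal L(T)$ componentwise. If $v$ has depth $d-1$, then $C^E_v=E\cap C_v$ has at most one element; if it is $\{k\}$ and $k$ is in position $i$ of $\pi_v$, then $\pi_v$ is replaced by $\tau_{n-1}\cdots\tau_{i+1}\tau_i\pi_v$ ($\tau_i$ is applied first), where $n=|C_v|$ and $\tau_j$ exchanges the letters in positions $j,j+1$ if they are incomparable in $P_v$ and does nothing otherwise; if it is empty, $\pi_v$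 is unchanged. At all other $v\in I$ the elements of $C_v^E$ are moved to the end of $\pi_v$, both they and the remaining elements keeping their relative order. Let $M^{T}$ be the matrix with rows and columns indexed by $\mathcal L(T)$ and entries $M^{T}(\pi,\pi')=\sum_{E:\widehat\partial_E\pi=\pi'}x_E$. Below, $\oplus$ is the ordinal sum and $+$ the direct sum of posets. A rooted forest is a finite poset in which every element is covered by at most one element. A ladder is an ordinal sum of antichains of size $1$ or $2$. **Procedure.** It produces a multiset of linear forms $\sum_E c_Ex_E$. (1) *Start*, when all leaf posets are rooted forests: take the forms $\lambda_{(S,\alpha)}$, each $m_{(S,\alpha)}$ times. Here $S$ runs over the sets of leaves such that $S_v=S\cap C_v$ is an upset of $P_v$ for each $v$ of depth $d-1$, and $\alpha=(\alpha_v)$ over the families of set partitions of $C_v$, $v\in I$ of depth $\ne d-1$. The form $\lambda_{(S,\alpha)}$ is $\sum x_E$ over the $E\in\mathcal A(L)$ such that $E\subseteq S$ and each block of each $\alpha_v$ is contained in $C_v^E$ or in $C_v\setminus C_v^E$. The multiplicity is $$m_{(S,\alpha)}=\prod_{v:\,\mathrm{depth}(v)=d-1} d_{S_v}\prod_{\substack{v\in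 I\\ \mathrm{depth}(v)\neq d-1}}\ \prod_{B\in\alpha_v}(|B|-1)!,$$ where $d_{S_v}=\sum_{Y\supseteq S_v}\mu(S_v,Y)f([Y,C_v])$ in the lattice of upsets $Y$ of $P_v$ ordered by inclusion, $\mu$ is its Möbius function and $f([Y,C_v])$ is the number of maximal chains in the interval. (2) *Step*: if the multiset $s$ was produced for leaf posets $P$, and $P_v=(Q'\oplus a\oplus b\oplus Q'')+P_2$ for some $v$ of depth $d-1$, where $a,b$ are single elements and $Q',Q'',P_2$ may be empty, let $P'$ be obtained from $P$ by deleting the relation $a\prec b$. For $P'$ take the multiset consisting of $s$ and one further form for each $\sum_E c_Ex_E$ in $s$, namely $$\sum_{\substack{k\in C_v\\ k\not\preceq a,b}}\sum_E c_{E\cup\{k\}}x_{E\cup\{k\}}+\sum_E c_Ex_E-\sum_{\substack{k\in C_v\\ k\prec a}}\sum_E c_{E\cup\{k\}}x_{E\cup\{k\}}\quad\text{if (A) holds,}$$ $$\sum_{\substack{k\in C_v\\ k\not\preceq a,b}}\sum_E c_{E\cup\{k\}}x_{E\cup\{k\}}+\sum_E c_Ex_E+\sum_{E}c_{E\cup\{b\}}x_{E\cup\{a\}}\quad\text{otherwise,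 i.e. if (B) holds.}$$ Here $E$ runs over the elements of $\mathcal A(L)$ with $E\cap C_v=\emptyset$, and $\preceq$ is the order of $P_v$. The conditions are: (A) $c_{E\cup\{a\}}=c_{E\cup\{b\}}$ for all such $E$; (B) $c_{E\cup\{k\}}=0$ for all $k\preceq a$ and all such $E$. **Theorem 4.1.** Suppose that every leaf poset is of the form $F_1\oplus L_1+\cdots+F_k\oplus L_k$ with rooted forests $F_j$ and ladders $L_j$ (where $k$, $F_j$ and $L_j$ may depend on the leaf poset). Then the procedure applies: the given leaf posets can be reached from rooted forests by finitely many steps. Moreover, every multiset $s$ that the procedure produces for them has the following properties. (i) The eigenvalues of $M^T$, with multiplicities, are the elements of $s$: over every commutative ring and for all values of the $x_E$ in it, $\det(X-M^{T})=\prod_{\lambda\in s}(X-\lambda)$. (ii) Every $\lambda\in s$ is of the form $\sum_{E\in\mathcal A(L)}c_Ex_E$ with all $c_E\in\{-1,0,1\}$ not depending on the $x_E$. (iii) Every $\lambda\in s$ satisfies (A) or (B) for each pair $(a,b)$ as in (2), so the case distinction in the procedure is exhaustive. -/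

import Mathlib

universe u w

namespace TreeShuffle

/-! ### Forests, ladders, and sums of posets -/

/-- A finite poset is a rooted forest if every element has at most one successor
(its connected components are then rooted trees, with the roots on top). -/
def IsRootedForest (α : Type u) [PartialOrder α] : Prop :=
  ∀ x y z : α, x ⋖ y → x ⋖ z → y = z

/-- A ladder is an ordinal sum `Q₁ ⊕ ⋯ ⊕ Q_n` of antichains of size `1` or `2`
(`Σₗ` carries the lexicographic order, which is the ordinal sum). -/
def IsLadder (α : Type u) [PartialOrder α] : Prop :=
  ∃ (n : ℕ) (Q : Fin n → Type u) (_ : ∀ i, PartialOrder (Q i)),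
    (∀ i, IsAntichain (· ≤ ·) (Set.univ : Set (Q i)) ∧
      (Nat.card (Q i) = 1 ∨ Nat.card (Q i) = 2)) ∧
    Nonempty (α ≃o Σₗ i, Q i)

/-- The poset is of the form `F₁ ⊕ L₁ + ⋯ + F_k ⊕ L_k` with rooted forests `F_j` and ladders `L_j`
(`⊕ₗ` is the ordinal sum and `Σ` is the direct sum). -/
def IsForestLadderSum (α : Type u) [PartialOrder α] : Prop :=
  ∃ (k : ℕ) (F L : Fin k → Type u) (_ : ∀ j, PartialOrder (F j)) (_ : ∀ j, PartialOrder (L j)),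
    (∀ j, IsRootedForest (F j) ∧ IsLadder (L j)) ∧
    Nonempty (α ≃o Σ j, F j ⊕ₗ L j)

/-- `α = (Q' ⊕ a ⊕ b ⊕ Q'') + P₂`. Here `Q'` is forced to be `{x | x < a}` and `Q''` to be
`{x | b < x}`, so the first direct summand is `{x | x ≤ a ∨ b ≤ x}`, and the condition says that no
element of this summand is comparable to an element outside of it. -/
def IsBreakable {α : Type u} [PartialOrder α] (a b : α) : Prop :=
  a < b ∧ ∀ x y : α, x ≤ y → ((x ≤ a ∨ b ≤ x) ↔ (y ≤ a ∨ b ≤ y))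

/-! ### Linear extensions, extended promotion, and pop shuffles -/

section Words

variable {α : Type u}

/-- The antichain on `α`. -/
abbrev discreteOrder (α : Type u) : PartialOrder α where
  le := Eq
  le_refl _ := rfl
  le_trans _ _ _ := Eq.trans
  le_antisymm _ _ h _ := h

/-- The word `π₁ ⋯ π_n` lists every element exactly once, and `π_i ≺ π_j` implies `i < j`. -/
def IsLinExt (r : PartialOrder α) (l : List α) : Prop :=
  l.Nodup ∧ (∀ a, a ∈ l) ∧ l.Pairwise (fun a b => ¬ r.lt b a)

/-- The linear extensions of a poset, written as words. -/
def LinExt (r : PartialOrder α) : Type u := {l : List α // IsLinExt r l}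

open scoped Classical in
/-- `τ_i` (positions are counted from `0`): exchange the letters at the positions `i` and `i + 1`
if they are incomparable. -/
noncomputable def tau (r : PartialOrder α) : ℕ → List α → List α
  | 0, a :: b :: l => if ¬ r.le a b ∧ ¬ r.le b a then b :: a :: l else a :: b :: l
  | i + 1, a :: l => a :: tau r i l
  | _, l => l

/-- The extended promotion operator `∂_i`: apply `τ_i`, then `τ_{i+1}`, and so on up to the last
pair of adjacent positions. -/
noncomputable def promotion (r : PartialOrder α) (i : ℕ) (l : List α) : List α :=
  (List.range' i (l.length - 1 - i)).foldl (fun w j => tau r j w) l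

open scoped Classical in
/-- The operator `∂̂_k` for an element `k` of the poset: apply `∂_i` where `i` is the position
of `k`. -/
noncomputable def hatPromotion (r : PartialOrder α) (k : α) (l : List α) : List α :=
  promotion r (l.idxOf k) l

open scoped Classical in
/-- The pop shuffle of a word by an ordered set partition: the letters in the first block, then
those in the second block, and so on, each time in their original order. -/
noncomputable def popShuffle (blocks : List (Set α)) (l : List α) : List α :=
  blocks.flatMap (fun B => l.filter (fun a => a ∈ B))

theorem tau_perm (r : PartialOrder α) (i : ℕ) (l : List α) : (tau r i l).Perm l := by
  induction l generalizing i with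
  | nil => cases i <;> simp [tau]
  | cons a l ih =>
    cases i with
    | succ i => simpa [tau] using ih i
    | zero =>
      cases l with
      | nil => simp [tau]
      | cons b l =>
        simp only [tau]
        split_ifs
        · exact List.Perm.swap a b l
        · exact List.Perm.refl _

theorem isLinExt_tau {r : PartialOrder α} {l : List α} (h : IsLinExt r l) (i : ℕ) :
    IsLinExt r (tau r i l) := by
  have hp := tau_perm r i l
  refine ⟨hp.nodup_iff.2 h.1, fun a => hp.mem_iff.2 (h.2.1 a), ?_⟩
  have h3 := h.2.2
  clear h hp
  induction l generalizing i with
  | nil => cases i <;> simp [tau]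
  | cons a l ih =>
    cases i with
    | succ i =>
      simp only [tau, List.pairwise_cons] at h3 ⊢
      exact ⟨fun b hb => h3.1 b ((tau_perm r i l).mem_iff.1 hb), ih i h3.2⟩
    | zero =>
      cases l with
      | nil => simp [tau]
      | cons b l =>
        simp only [tau]
        split_ifs with hab
        · simp only [List.pairwise_cons, List.mem_cons, forall_eq_or_imp] at h3 ⊢
          refine ⟨⟨fun hlt => hab.1 ?_, h3.2.1⟩, h3.1.2, h3.2.2⟩
          exact ((r.lt_iff_le_not_ge a b).1 hlt).1
        · exact h3

theorem isLinExt_hatPromotion {r : PartialOrder α} {l : List α} (h : IsLinExt r l) (k : α) :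
    IsLinExt r (hatPromotion r k l) := by
  unfold hatPromotion promotion
  generalize List.range' _ _ = js
  induction js generalizing l with
  | nil => simpa using h
  | cons j js ih => simpa using ih (isLinExt_tau h j)

theorem isLinExt_popShuffle {r : PartialOrder α} (hr : r = discreteOrder α) {l : List α}
    (h : IsLinExt r l) (B : Set α) : IsLinExt r (popShuffle [Bᶜ, B] l) := by
  subst hr
  refine ⟨?_, ?_, ?_⟩
  · simp only [popShuffle, List.flatMap_cons, List.flatMap_nil, List.append_nil]
    refine List.Nodup.append (h.1.filter _) (h.1.filter _) ?_
    intro a ha hb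
    simp only [List.mem_filter, decide_eq_true_eq] at ha hb
    exact ha.2 hb.2
  · intro a
    have := h.2.1 a
    by_cases ha : a ∈ B <;> simp [popShuffle, this, ha]
  · refine List.pairwise_of_forall fun a b hlt => ?_
    have := ((discreteOrder α).lt_iff_le_not_ge b a).1 hlt
    exact this.2 (Eq.symm this.1)

instance [Finite α] (r : PartialOrder α) : Finite (LinExt r) := by
  classical
  have := Fintype.ofFinite α
  exact Finite.of_injective (β := {l : List α // l.Nodup}) (fun l => ⟨l.1, l.2.1⟩)
    (fun l m h => Subtype.ext (Subtype.mk.inj h))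

end Words

/-! ### Derangement numbers -/

open scoped Classical in
/-- The derangement number `d_x = ∑_{y ⪰ x} μ(x, y) f([y, 1̂])` of an element of a finite poset
with maximum `1̂`, where `f([y, 1̂])` is the number of maximal chains of the interval. -/
noncomputable def derangementNumber {Λ : Type u} [PartialOrder Λ] [OrderTop Λ] [Finite Λ]
    (x : Λ) : ℤ :=
  letI : Fintype Λ := Fintype.ofFinite Λ
  letI : LocallyFiniteOrder Λ := Fintype.toLocallyFiniteOrder
  ∑ y : Λ with x ≤ y, IncidenceAlgebra.mu ℤ x y * (Nat.card (Flag (Set.Icc y (⊤ : Λ))) : ℤ)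

instance {α : Type u} [LE α] [Finite α] : Finite (UpperSet α) :=
  Finite.of_injective (fun S : UpperSet α => (S : Set α)) SetLike.coe_injective

/-- The derangement number of an upset in the lattice of upsets ordered by inclusion. (Mathlib
orders `UpperSet α` by reverse inclusion, so that lattice is the order dual.) -/
noncomputable def upsetDerangement {α : Type u} [PartialOrder α] [Finite α] (S : UpperSet α) : ℤ :=
  derangementNumber (OrderDual.toDual S)

/-! ### The tree and the moves -/

section Tree

variable {T : RootedTree.{u}}

/-- The distance from the root, i.e. the number of proper ancestors (the root is the least
element, and `u ≤ v` means that `u` is an ancestor of `v` or `v` itself). -/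
noncomputable def depth (v : T) : ℕ := (Set.Iio v).ncard

/-- The set `C_v` of the children of `v`. -/
def Child (v : T) : Type u := {w : T // v ⋖ w}

instance [Finite T] (v : T) : Finite (Child v) :=
  inferInstanceAs (Finite {w : T // v ⋖ w})

noncomputable instance [Finite T] (v : T) : Fintype (Child v) := Fintype.ofFinite _

noncomputable instance (v : T) : DecidableEq (Child v) := Classical.decEq _

variable (T) in
/-- The inner nodes, i.e. the nodes which are not leaves. -/
def Inner : Type u := {v : T // ¬ IsMax v}

instance [Finite T] : Finite (Inner T) := inferInstanceAs (Finite {v : T // ¬ IsMax v})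

variable (T) in
/-- The inner nodes of depth `d - 1`. -/
def BottomNode (d : ℕ) : Type u := {v : T // ¬ IsMax v ∧ depth v + 1 = d}

instance [Finite T] (d : ℕ) : Finite (BottomNode T d) :=
  inferInstanceAs (Finite {v : T // ¬ IsMax v ∧ depth v + 1 = d})

noncomputable instance [Finite T] (d : ℕ) : Fintype (BottomNode T d) := Fintype.ofFinite _

variable (T) in
/-- The inner nodes of depth different from `d - 1`. -/
def UpperNode (d : ℕ) : Type u := {v : T // ¬ IsMax v ∧ depth v + 1 ≠ d}

instance [Finite T] (d : ℕ) : Finite (UpperNode T d) :=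
  inferInstanceAs (Finite {v : T // ¬ IsMax v ∧ depth v + 1 ≠ d})

noncomputable instance [Finite T] (d : ℕ) : Fintype (UpperNode T d) := Fintype.ofFinite _

variable (T) in
/-- A choice of leaf posets: a partial order on the children of every inner node of depth
`d - 1`. -/
abbrev LeafPosets (d : ℕ) : Type u := ∀ v : BottomNode T d, PartialOrder (Child v.1)

open scoped Classical in
/-- The order on the children of an inner node: the leaf poset if the node has depth `d - 1`, and
an antichain otherwise. -/
noncomputable abbrev nodeOrder {d : ℕ} (P : LeafPosets T d) (v : Inner T) : PartialOrder (Child v.1) :=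
  if h : depth v.1 + 1 = d then P ⟨v.1, v.2, h⟩ else discreteOrder (Child v.1)

/-- The state space `𝓛(T)`: a linear extension `π_v` at every inner node `v`. -/
def State {d : ℕ} (P : LeafPosets T d) : Type u := ∀ v : Inner T, LinExt (nodeOrder P v)

instance [Finite T] {d : ℕ} (P : LeafPosets T d) : Finite (State P) :=
  inferInstanceAs (Finite (∀ v : Inner T, LinExt (nodeOrder P v)))

noncomputable instance [Finite T] {d : ℕ} (P : LeafPosets T d) : Fintype (State P) :=
  Fintype.ofFinite _

noncomputable instance {d : ℕ} (P : LeafPosets T d) : DecidableEq (State P) := Classical.decEq _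

/-- `E` is a set of leaves no two of which are siblings. -/
def IsMoveSet (E : Finset T) : Prop :=
  (∀ e ∈ E, IsMax e) ∧ ∀ v : T, ∀ e ∈ E, ∀ f ∈ E, v ⋖ e → v ⋖ f → e = f

variable (T) in
/-- The set `𝓐(L)`. -/
def MoveSet : Type u := {E : Finset T // IsMoveSet E}

instance [Finite T] : Finite (MoveSet T) :=
  inferInstanceAs (Finite {E : Finset T // IsMoveSet E})

noncomputable instance [Finite T] : Fintype (MoveSet T) := Fintype.ofFinite _

/-- The node `v` is `E`-related: some descendant of `v` (possibly `v` itself) lies in `E`. -/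
def IsRelated (E : MoveSet T) (v : T) : Prop := ∃ e ∈ E.1, v ≤ e

/-- The set `C_v^E` of the `E`-related children of `v`. -/
def relatedChildren (E : MoveSet T) (v : T) : Set (Child v) := {k | IsRelated E k.1}

open scoped Classical in
/-- The action of `E` at one inner node `v`. At depth `d - 1` the set `C_v^E` has at most one
element; that element is promoted (nothing happens if there is none). At the other inner nodes the
elements of `C_v^E` are moved to the back. -/
noncomputable def localMove {d : ℕ} (P : LeafPosets T d) (E : MoveSet T) (v : Inner T)
    (l : LinExt (nodeOrder P v)) : LinExt (nodeOrder P v) :=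
  if h : depth v.1 + 1 = d then
    if hk : (relatedChildren E v.1).Nonempty then
      ⟨hatPromotion (nodeOrder P v) hk.choose l.1, isLinExt_hatPromotion l.2 _⟩
    else l
  else
    ⟨popShuffle [(relatedChildren E v.1)ᶜ, relatedChildren E v.1] l.1,
      isLinExt_popShuffle (by simp [nodeOrder, h]) l.2 _⟩

/-- The action `∂̂_E` of `E` on the state space. -/
noncomputable def move {d : ℕ} (P : LeafPosets T d) (E : MoveSet T) (π : State P) : State P :=
  fun v => localMove P E v (π v)

open scoped Classical in
/-- The transition matrix, `M(π, π') = ∑_{E : ∂̂_E π = π'} x_E`. -/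
noncomputable def transitionMatrix [Finite T] {d : ℕ} (P : LeafPosets T d) {R : Type w}
    [CommRing R] (x : MoveSet T → R) : Matrix (State P) (State P) R :=
  Matrix.of fun π π' => ∑ E : MoveSet T with move P E π = π', x E

/-! ### Linear forms `∑ c_E x_E`, given by their coefficients -/

/-- The value of the linear form with coefficients `c` at `x`. -/
noncomputable def linearForm [Finite T] {R : Type w} [CommRing R] (c : MoveSet T → ℤ)
    (x : MoveSet T → R) : R :=
  ∑ E : MoveSet T, (c E : R) * x E

/-- The index set of the eigenvalues in the case of forests: an upset of every leaf poset (together,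
an upset `S` of the set of leaves) and a set partition `α_v` of the children of every inner node
`v` of depth different from `d - 1`. -/
abbrev ForestIndex [Finite T] {d : ℕ} (P : LeafPosets T d) : Type u :=
  (∀ v : BottomNode T d, @UpperSet (Child v.1) (P v).toLE) ×
    (∀ v : UpperNode T d, Finpartition (Finset.univ : Finset (Child v.1)))

instance [Finite T] {d : ℕ} (P : LeafPosets T d) : Finite (ForestIndex P) :=
  inferInstanceAs (Finite (_ × _))

noncomputable instance [Finite T] {d : ℕ} (P : LeafPosets T d) : Fintype (ForestIndex P) :=
  Fintype.ofFinite _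

open scoped Classical in
/-- The eigenvalue `λ_(S, α) = ∑ x_E` over all `E ⊆ S` which are `α`-compatible, i.e. every
block of every `α_v` is contained in `C_v^E` or in its complement. -/
noncomputable def forestEigenvalue [Finite T] {d : ℕ} (P : LeafPosets T d) (i : ForestIndex P) :
    MoveSet T → ℤ := fun E =>
  if (∀ (v : BottomNode T d) (k : Child v.1), k.1 ∈ E.1 → k ∈ i.1 v) ∧
      (∀ (v : UpperNode T d), ∀ B ∈ (i.2 v).parts,
        (B : Set (Child v.1)) ⊆ relatedChildren E v.1 ∨
          (B : Set (Child v.1)) ⊆ (relatedChildren E v.1)ᶜ)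
  then 1 else 0

/-- The multiplicity `m_(S, α) = ∏_v d_{S_v} · ∏_v ∏_{B ∈ α_v} (|B| - 1)!`. -/
noncomputable def forestMultiplicity [Finite T] {d : ℕ} (P : LeafPosets T d)
    (i : ForestIndex P) : ℤ :=
  (∏ v : BottomNode T d, @upsetDerangement (Child v.1) (P v) _ (i.1 v)) *
    ∏ v : UpperNode T d, ∏ B ∈ (i.2 v).parts, ((B.card - 1).factorial : ℤ)

/-! ### Breaking a covering relation -/

open scoped Classical in
/-- The coefficient `c_F` of `x_F` in a linear form, for a set of nodes `F`. -/
noncomputable def coeffAt (c : MoveSet T → ℤ) (F : Finset T) : ℤ :=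
  if h : IsMoveSet F then c ⟨F, h⟩ else 0

/-- `E ∩ C_v = ∅`. -/
def Avoids (E : MoveSet T) (v : T) : Prop := ∀ k : Child v, k.1 ∉ E.1

open scoped Classical in
/-- Property (A): `c_{E ∪ {a}} = c_{E ∪ {b}}` for all `E` with `E ∩ C_v = ∅`. -/
def PropertyA {v : T} (a b : Child v) (c : MoveSet T → ℤ) : Prop :=
  ∀ E : MoveSet T, Avoids E v → coeffAt c (insert a.1 E.1) = coeffAt c (insert b.1 E.1)

open scoped Classical in
/-- Property (B): `c_{E ∪ {k}} = 0` for all `k ⪯ a` and all `E` with `E ∩ C_v = ∅`. -/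
def PropertyB {d : ℕ} (P : LeafPosets T d) (v : BottomNode T d) (a : Child v.1)
    (c : MoveSet T → ℤ) : Prop :=
  ∀ k : Child v.1, (P v).le k a → ∀ E : MoveSet T, Avoids E v.1 → coeffAt c (insert k.1 E.1) = 0

open scoped Classical in
/-- The additional eigenvalue that an eigenvalue `c` produces when the relation `a ≺ b` is broken.

If (A) holds it is
`∑_{k ⋠ a, b} ∑_E c_{E ∪ {k}} x_{E ∪ {k}} + ∑_E c_E x_E - ∑_{k ≺ a} ∑_E c_{E ∪ {k}} x_{E ∪ {k}}`,
and otherwise (when (B) holds) it is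
`∑_{k ⋠ a, b} ∑_E c_{E ∪ {k}} x_{E ∪ {k}} + ∑_E c_E x_E + ∑_E c_{E ∪ {b}} x_{E ∪ {a}}`,
where `k` runs over `C_v` and `E` over the sets in `𝓐(L)` with `E ∩ C_v = ∅`. -/
noncomputable def extraEigenvalue {d : ℕ} (P : LeafPosets T d) (v : BottomNode T d)
    (a b : Child v.1) (c : MoveSet T → ℤ) : MoveSet T → ℤ := fun F =>
  if PropertyA a b c then
    if ∃ k : Child v.1, k.1 ∈ F.1 ∧ (P v).lt k a then - c F
    else if a.1 ∈ F.1 ∨ b.1 ∈ F.1 then 0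
    else c F
  else
    if ∃ k : Child v.1, k.1 ∈ F.1 ∧ (P v).lt k a then 0
    else if b.1 ∈ F.1 then 0
    else if a.1 ∈ F.1 then coeffAt c (insert b.1 (F.1.erase a.1))
    else c F

/-- `P' = P \ {(a, b)}`: the relation `a ≺ b` at the node `v` is dropped, and nothing else. -/
def IsRemoval {d : ℕ} (P P' : LeafPosets T d) (v : BottomNode T d) (a b : Child v.1) : Prop :=
  (∀ u : BottomNode T d, u ≠ v → P' u = P u) ∧
    ∀ x y : Child v.1, (P' v).le x y ↔ (P v).le x y ∧ ¬ (x = a ∧ y = b)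

/-- `ComputedSpectrum P s`: the multiset `s` of linear forms results from the following procedure
for the leaf posets `P`. Start with rooted forests, where `s` consists of the `λ_(S, α)` with
multiplicities `m_(S, α)`. Then break covering relations `a ≺ b` one at a time, where the poset is
of the form `(Q' ⊕ a ⊕ b ⊕ Q'') + P₂`; each time every eigenvalue in `s` is kept and contributes
one additional eigenvalue. -/
inductive ComputedSpectrum [Finite T] {d : ℕ} :
    LeafPosets T d → Multiset (MoveSet T → ℤ) → Prop
  | forest (P : LeafPosets T d) (hP : ∀ v, @IsRootedForest (Child v.1) (P v))
      (m : ForestIndex P → ℕ) (hm : ∀ i, (m i : ℤ) = forestMultiplicity P i) :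
      ComputedSpectrum P (∑ i : ForestIndex P, m i • {forestEigenvalue P i})
  | step (P P' : LeafPosets T d) (s : Multiset (MoveSet T → ℤ)) (hs : ComputedSpectrum P s)
      (v : BottomNode T d) (a b : Child v.1) (hab : @IsBreakable (Child v.1) (P v) a b)
      (hP' : IsRemoval P P' v a b) :
      ComputedSpectrum P' (s + s.map (extraEigenvalue P v a b))

end Tree

end TreeShuffle

namespace TreeShuffle

/-! ### Characteristic polynomials from traces of words -/

section Charpoly

open Polynomial

/-! The proof reduces the spectrum to counting fixed points. The trace of a product of matrices of
maps is the number of fixed points of the composed map. Suppose that for every word `W` of moves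
this number is the sum over `c ∈ s` of `∏_{E ∈ W} c_E`. Then every power of the transition matrix
has the trace predicted by `s`, and in characteristic zero power sums determine the eigenvalues.
Doing this for indeterminate `x_E` and specialising gives the result over every commutative ring
(`charpoly_eq_of_card_fixedPoints`). The character formula for words is therefore carried through
the procedure, together with the bound on the coefficients and with (A) or (B), as the invariant
`IsSpectrum`.

Forests. Moves act componentwise, so the count is a product over the inner nodes (`moveFix_eq`). At
an upper node the fixed words correspond to the permutations preserving all the sets `C_v^E`
(`card_fixed_moveBack`); sorting these by their orbits yields the partitions with weights `∏ (|B| -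
1)!`. At a bottom node promotion is contracting: two words agree on more and more pairs of letters.
Hence a word of promotions has exactly one fixed extension for each linear extension of the subposet
of elements that are not above a promoted letter (`promotionFix_forest`). These are maximal chains
of upsets (`card_flag_upsetsAbove`), and Möbius inversion introduces the derangement numbers
(`promotionFix_eq_sum`).

Steps. Once `a ≺ b` is dropped, `a` and `b` are twins: their exchange is an automorphism of `P'`,
and an extension for `P'` is an extension for `P` together with a bit telling whether `a` and `b`
are swapped. Promotion for `P'` is promotion for `P` of a possibly swapped letter, and the bit flips
exactly if that letter is `⪯ a` (`Breaks.hatPromotion_eq`, `Breaks.promote_twist`). So fixed points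
are counted by the runs of a two-state automaton that return to their initial state. Under (A) a
character ignores the swapped letters, and the number of returning states is one plus a product of
signs; under (B) only runs with a constant state contribute, and the two states give `c` and its
swapped copy. In both cases the result is `c` plus the additional form (`sum_runWord_eq`). Later
breakable pairs are disjoint from `a, b`, so (A) or (B) is inherited (`property_of_isRemoval`).

Reachability. In the given posets two covers of one element form a rung. Turning a rung into a chain
undoes a step and preserves this property; repeating it ends with forests
(`exists_computedSpectrum`). -/

theorem det_aeval_eq_prod_roots {n K : Type*} [Fintype n] [DecidableEq n] [Field K]
    [IsAlgClosed K] (A : Matrix n n K) (p : K[X]) :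
    (aeval A p).det = (A.charpoly.roots.map fun μ => p.eval μ).prod := by
  have hA : A.charpoly = (A.charpoly.roots.map fun μ => X - C μ).prod :=
    (IsAlgClosed.splits A.charpoly).eq_prod_roots_of_monic A.charpoly_monic
  have hcard : A.charpoly.roots.card = Fintype.card n := by
    rw [← (IsAlgClosed.splits A.charpoly).natDegree_eq_card_roots, A.charpoly_natDegree_eq_dim]
  -- Both sides are multiplicative in `p`, so constants and linear factors suffice. The sign of `det
  -- (-B)` is distributed over the roots, of which there are as many as rows.
  have hlin (ρ : K) : (aeval A (X - C ρ)).det =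
      (A.charpoly.roots.map fun μ => (X - C ρ).eval μ).prod := by
    have h1 : A.charpoly.eval ρ = (Matrix.scalar n ρ - A).det := Matrix.eval_charpoly A ρ
    have h2 : aeval A (X - C ρ) = -(Matrix.scalar n ρ - A) := by
      simp [Matrix.algebraMap_eq_diagonal, Pi.algebraMap_def]
    rw [h2, Matrix.det_neg, ← h1]
    conv_lhs => rw [hA, eval_multiset_prod, Multiset.map_map]
    rw [← hcard, ← Multiset.card_map (eval ρ ∘ fun μ => X - C μ) A.charpoly.roots,
      ← Multiset.prod_map_neg]
    simp [Multiset.map_map]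
  have hp := (IsAlgClosed.splits p).eq_prod_roots
  rw [hp]
  generalize p.roots = s
  generalize p.leadingCoeff = a
  induction s using Multiset.induction_on with
  | empty =>
    simp [Matrix.algebraMap_eq_diagonal, Pi.algebraMap_def, Matrix.det_diagonal, hcard]
  | cons ρ s ih =>
    have : C a * (Multiset.map (fun x => X - C x) (ρ ::ₘ s)).prod =
        (X - C ρ) * (C a * (Multiset.map (fun x => X - C x) s).prod) := by
      rw [Multiset.map_cons, Multiset.prod_cons]; ring
    rw [this, map_mul, Matrix.det_mul, ih, hlin, ← Multiset.prod_map_mul]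
    simp

/-- The determinant formula for the polynomial `z - X ^ m` evaluates the characteristic polynomial
of `A ^ m` at every point `z`. -/
theorem trace_pow_eq_sum_roots {n K : Type*} [Fintype n] [DecidableEq n] [Field K]
    [IsAlgClosed K] (A : Matrix n n K) (m : ℕ) :
    (A ^ m).trace = (A.charpoly.roots.map (· ^ m)).sum := by
  have h : (A ^ m).charpoly = ((A.charpoly.roots.map (· ^ m)).map fun μ => X - C μ).prod := by
    have := IsAlgClosed.instInfinite (K := K)
    refine Polynomial.funext fun z => ?_
    have h1 := det_aeval_eq_prod_roots A (C z - X ^ m)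
    rw [Matrix.eval_charpoly, eval_multiset_prod, Multiset.map_map, Multiset.map_map]
    have h2 : aeval A (C z - X ^ m) = Matrix.scalar n z - A ^ m := by
      simp [Matrix.algebraMap_eq_diagonal, Pi.algebraMap_def]
    rw [← h2, h1]
    simp
  rw [Matrix.trace_eq_sum_roots_charpoly, h, roots_multiset_prod_X_sub_C]

/-- In characteristic zero, multisets are determined by their power sums. -/
theorem multiset_eq_of_power_sums {K : Type*} [Field K] [CharZero K] {s t : Multiset K}
    (h : ∀ m : ℕ, (s.map (· ^ m)).sum = (t.map (· ^ m)).sum) : s = t := by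
  classical
  -- Equality of power sums extends linearly to sums of values of any polynomial.
  have hp (p : K[X]) : (s.map p.eval).sum = (t.map p.eval).sum := by
    have : ∀ u : Multiset K, (u.map p.eval).sum =
        ∑ i ∈ p.support, p.coeff i * (u.map (· ^ i)).sum := by
      intro u
      induction u using Multiset.induction_on with
      | empty => simp
      | cons a u ih =>
        rw [Multiset.map_cons, Multiset.sum_cons, ih]
        simp only [Multiset.map_cons, Multiset.sum_cons, mul_add, Finset.sum_add_distrib]
        rw [eval_eq_sum, Polynomial.sum]
    rw [this, this]
    simp [h]
  refine Multiset.ext' fun a => ?_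
  -- A Lagrange basis polynomial is the indicator of `a` on the nodes, so summing it counts `a`. The
  -- node `a` is inserted because it need not occur in `s + t`.
  have key : ∀ u : Multiset K, u ⊆ s + t →
      (u.map (Lagrange.basis (insert a (s + t).toFinset) id a).eval).sum = (u.count a : K) := by
    intro u
    induction u using Multiset.induction_on with
    | empty => simp
    | cons b u ih =>
      intro hu
      have hb : b ∈ insert a (s + t).toFinset := by
        simpa using Or.inr (Multiset.mem_add.1 (hu (Multiset.mem_cons_self b u)))
      rw [Multiset.map_cons, Multiset.sum_cons,
        ih fun x hx => hu (Multiset.mem_cons_of_mem hx), Multiset.count_cons]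
      by_cases hab : a = b
      · subst hab
        have := Lagrange.eval_basis_self (v := id) (i := a)
          (s := insert a (s + t).toFinset) (Set.injOn_id _) (Finset.mem_insert_self _ _)
        simp only [id] at this
        rw [this]
        simp [add_comm]
      · have := Lagrange.eval_basis_of_ne (v := id) hab hb
        simp only [id] at this
        rw [this]
        simp [hab]
  have h1 := key s (Multiset.subset_of_le (Multiset.le_add_right s t))
  have h2 := key t (Multiset.subset_of_le (Multiset.le_add_left t s))
  rw [hp, h2] at h1
  exact_mod_cast h1.symm

/-- The power is expanded into words; the induction carries a word `W` in front, to which one letter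
of the power is moved at a time. The weights `e` are arbitrary, so that derangement numbers can be
used before their sign is known. -/
theorem trace_pow_of_trace_words {n ι R : Type*} [Fintype n] [DecidableEq n] [Fintype ι]
    [CommRing R] {J : Type*} [Fintype J] (A : ι → Matrix n n R) (c : J → ι → R) (e : J → R)
    (h : ∀ W : List ι, (W.map A).prod.trace = ∑ j, e j * (W.map (c j)).prod)
    (x : ι → R) (m : ℕ) :
    ((∑ i, x i • A i) ^ m).trace = ∑ j, e j * (∑ i, x i * c j i) ^ m := by
  suffices ∀ W : List ι, ((W.map A).prod * (∑ i, x i • A i) ^ m).trace =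
      ∑ j, e j * ((W.map (c j)).prod * (∑ i, x i * c j i) ^ m) by
    simpa using this []
  induction m with
  | zero => intro W; simpa using h W
  | succ m ih =>
    intro W
    rw [pow_succ', ← mul_assoc, Finset.mul_sum, Finset.sum_mul, Matrix.trace_sum]
    have (i : ι) : ((W.map A).prod * x i • A i * (∑ i, x i • A i) ^ m).trace =
        x i * ∑ j, e j * (((W ++ [i]).map (c j)).prod * (∑ i, x i * c j i) ^ m) := by
      rw [← ih (W ++ [i])]
      simp [mul_assoc]
    simp only [this, Finset.mul_sum]
    rw [Finset.sum_comm]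
    refine Finset.sum_congr rfl fun j _ => ?_
    rw [pow_succ', Finset.sum_mul, Finset.mul_sum, Finset.mul_sum]
    refine Finset.sum_congr rfl fun i _ => ?_
    simp only [List.map_append, List.map_cons, List.map_nil, List.prod_append, List.prod_singleton]
    ring

/-- The matrix of a map of a finite set into itself. -/
def mapMatrix {n : Type*} [DecidableEq n] (R : Type*) [CommRing R] (f : n → n) :
    Matrix n n R := Matrix.of fun a b => if f a = b then 1 else 0

theorem prod_mapMatrix {n ι R : Type*} [Fintype n] [DecidableEq n] [CommRing R]
    (f : ι → n → n) (W : List ι) :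
    (W.map fun i => mapMatrix R (f i)).prod = mapMatrix R fun a => W.foldl (fun a i => f i a) a := by
  induction W with
  | nil => ext a b; rw [List.map_nil, List.prod_nil, Matrix.one_apply]; rfl
  | cons i W ih =>
    rw [List.map_cons, List.prod_cons, ih]
    ext a b
    simp only [mapMatrix, Matrix.mul_apply, Matrix.of_apply, ite_mul, one_mul, zero_mul,
      List.foldl_cons]
    rw [Finset.sum_ite_eq, if_pos (Finset.mem_univ _)]
    rfl

theorem trace_prod_mapMatrix {n ι R : Type*} [Fintype n] [DecidableEq n] [CommRing R]
    (f : ι → n → n) (W : List ι) :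
    (W.map fun i => mapMatrix R (f i)).prod.trace =
      (Nat.card {a : n // W.foldl (fun a i => f i a) a = a} : R) := by
  rw [prod_mapMatrix]
  simp [mapMatrix, Matrix.trace, Nat.card_eq_fintype_card, Fintype.card_subtype]

theorem map_sum_smul_mapMatrix {n ι R S : Type*} [Fintype n] [DecidableEq n] [Fintype ι]
    [CommRing R] [CommRing S] (f : ι → n → n) (x : ι → R) (φ : R →+* S) :
    (∑ i, x i • mapMatrix R (f i)).map φ = ∑ i, φ (x i) • mapMatrix S (f i) := by
  ext a b
  simp only [Matrix.map_apply, Matrix.sum_apply, Matrix.smul_apply, mapMatrix, Matrix.of_apply,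
    smul_eq_mul, map_sum, map_mul]
  refine Finset.sum_congr rfl fun i _ => ?_
  congr 1
  split_ifs <;> simp

/-- If the numbers of fixed points of all words in some maps of a finite set into itself are sums of
characters, then these characters give the eigenvalues of all linear combinations of the maps. -/
theorem charpoly_eq_of_card_fixedPoints {n : Type*} {ι : Type u} [Fintype n] [DecidableEq n]
    [Fintype ι] (f : ι → n → n) (s : Multiset (ι → ℤ))
    (h : ∀ W : List ι, (Nat.card {a : n // W.foldl (fun a i => f i a) a = a} : ℤ) =
      (s.map fun c => (W.map c).prod).sum)
    {R : Type w} [CommRing R] (x : ι → R) :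
    (∑ i, x i • mapMatrix R (f i)).charpoly =
      (s.map fun c => X - C (∑ i, (c i : R) * x i)).prod := by
  classical
  -- For indeterminate coefficients one may pass to an algebraically closed field of characteristic
  -- zero; the general case is a specialisation.
  have generic : (∑ i, (MvPolynomial.X i : MvPolynomial ι ℤ) •
      mapMatrix (MvPolynomial ι ℤ) (f i)).charpoly =
      (s.map fun c => X - C (∑ i, (c i : MvPolynomial ι ℤ) * MvPolynomial.X i)).prod := by
    let K := AlgebraicClosure (FractionRing (MvPolynomial ι ℤ))
    let φ : MvPolynomial ι ℤ →+* K := (algebraMap (FractionRing (MvPolynomial ι ℤ)) K).comp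
      (algebraMap (MvPolynomial ι ℤ) (FractionRing (MvPolynomial ι ℤ)))
    have hφ : Function.Injective φ :=
      (algebraMap (FractionRing (MvPolynomial ι ℤ)) K).injective.comp
        (IsFractionRing.injective _ _)
    have : CharZero K := (RingHom.charZero_iff hφ).1 inferInstance
    apply Polynomial.map_injective φ hφ
    rw [← Matrix.charpoly_map]
    set M := (∑ i, (MvPolynomial.X i : MvPolynomial ι ℤ) •
      mapMatrix (MvPolynomial ι ℤ) (f i)).map φ with hM
    have hroots : M.charpoly.roots =
        s.map fun c => ∑ i, φ (MvPolynomial.X i) * (c i : K) := by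
      refine multiset_eq_of_power_sums fun m => ?_
      -- `s.ToType` indexes the members of `s` with repetition, so all weights are `1`.
      have h1 := trace_pow_of_trace_words (n := n) (R := K) (J := s.ToType)
        (fun i => mapMatrix K (f i)) (fun j i => (j.1 i : K)) (fun _ => 1) (fun W => by
          rw [trace_prod_mapMatrix]
          have := congrArg (Int.cast : ℤ → K) (h W)
          rw [Int.cast_natCast] at this
          rw [this, ← Multiset.map_univ s, ← Finset.sum_eq_multiset_sum, Int.cast_sum]
          refine Finset.sum_congr rfl fun j _ => ?_
          rw [one_mul, Int.cast_list_prod, List.map_map]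
          rfl) (fun i => φ (MvPolynomial.X i)) m
      rw [← trace_pow_eq_sum_roots, hM, map_sum_smul_mapMatrix, h1, Multiset.map_map,
        ← Multiset.map_univ s, ← Finset.sum_eq_multiset_sum]
      simp
    rw [(IsAlgClosed.splits M.charpoly).eq_prod_roots_of_monic M.charpoly_monic, hroots,
      Polynomial.map_multiset_prod, Multiset.map_map, Multiset.map_map]
    congr 1
    refine Multiset.map_congr rfl fun c _ => ?_
    have e : φ (∑ i, (c i : MvPolynomial ι ℤ) * MvPolynomial.X i) =
        ∑ i, φ (MvPolynomial.X i) * (c i : K) := by simp [map_sum, mul_comm]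
    rw [Function.comp_apply, Function.comp_apply, Polynomial.map_sub, map_X, map_C, e]
  have := congrArg (Polynomial.map (MvPolynomial.eval₂Hom (Int.castRingHom R) x)) generic
  rw [← Matrix.charpoly_map, map_sum_smul_mapMatrix, Polynomial.map_multiset_prod,
    Multiset.map_map] at this
  simpa [Polynomial.map_sum] using this

end Charpoly

end TreeShuffle


namespace TreeShuffle

/-! ### Promotion as a slide along a word -/

section Slide

variable {α : Type u}

open scoped Classical in
/-- The letter `k` is moved to the right through a word. Whenever it meets a comparable letter, it
stops in front of it, and that letter is moved on. -/
noncomputable def slide (r : PartialOrder α) : α → List α → List α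
  | k, [] => [k]
  | k, b :: t => if ¬ r.le k b ∧ ¬ r.le b k then b :: slide r k t else k :: slide r b t

theorem slide_cons_congr {r r' : PartialOrder α} {k b k' b' : α} {t' : List α}
    (h : (¬ r'.le k' b' ∧ ¬ r'.le b' k') ↔ (¬ r.le k b ∧ ¬ r.le b k)) :
    slide r' k' (b' :: t') =
      open scoped Classical in
      if ¬ r.le k b ∧ ¬ r.le b k then b' :: slide r' k' t' else k' :: slide r' b' t' := by
  rw [slide]
  by_cases hc : ¬ r.le k b ∧ ¬ r.le b k
  · rw [if_pos (h.2 hc), if_pos hc]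
  · rw [if_neg (fun h' => hc (h.1 h')), if_neg hc]

theorem tau_append (r : PartialOrder α) (p l : List α) (i : ℕ) :
    tau r (p.length + i) (p ++ l) = p ++ tau r i l := by
  induction p with
  | nil => simp
  | cons a p ih => rw [List.length_cons, add_right_comm, List.cons_append, tau, ih]; rfl

/-- If `τ_j` exchanges, the moving letter arrives at position `j + 1`. If it does not, that position
holds the blocking letter, which is then the one that `τ_{j+1}` moves. -/
theorem foldl_tau_append (r : PartialOrder α) (k : α) (p t : List α) :
    (List.range' p.length t.length).foldl (fun w j => tau r j w) (p ++ k :: t) =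
      p ++ slide r k t := by
  induction t generalizing p k with
  | nil => simp [slide]
  | cons b t ih =>
    rw [List.length_cons, List.range'_succ, List.foldl_cons]
    have := tau_append r p (k :: b :: t) 0
    rw [add_zero] at this
    rw [this, tau, slide]
    split_ifs with h
    · have := ih k (p ++ [b])
      simpa using this
    · have := ih b (p ++ [k])
      simpa using this

theorem hatPromotion_append (r : PartialOrder α) {k : α} {p : List α} (hk : k ∉ p) (t : List α) :
    hatPromotion r k (p ++ k :: t) = p ++ slide r k t := by
  classical
  have h1 : (p ++ k :: t).idxOf k = p.length := by
    rw [List.idxOf_append_of_notMem hk, List.idxOf_cons_self, add_zero]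
  have h2 : hatPromotion r k (p ++ k :: t) = promotion r p.length (p ++ k :: t) := by
    unfold hatPromotion
    rw [← h1]
  rw [h2, promotion, ← foldl_tau_append]
  congr 2
  simp

theorem slide_perm (r : PartialOrder α) (k : α) (t : List α) : (slide r k t).Perm (k :: t) := by
  induction t generalizing k with
  | nil => simp [slide]
  | cons b t ih =>
    rw [slide]
    split_ifs
    · exact ((ih k).cons b).trans (List.Perm.swap _ _ _)
    · exact (ih b).cons k

theorem slide_map {r : PartialOrder α} (σ : Equiv.Perm α)
    (hσ : ∀ x y, r.le (σ x) (σ y) ↔ r.le x y) (k : α) (t : List α) :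
    slide r (σ k) (t.map σ) = (slide r k t).map σ := by
  induction t generalizing k with
  | nil => simp [slide]
  | cons b t ih =>
    rw [List.map_cons, slide_cons_congr (r := r) (k' := σ k) (b' := σ b) (k := k) (b := b)
      (by rw [hσ, hσ]), ih, ih, slide]
    split_ifs <;> rfl

theorem hatPromotion_map {r : PartialOrder α} (σ : Equiv.Perm α)
    (hσ : ∀ x y, r.le (σ x) (σ y) ↔ r.le x y) {k : α} {l : List α} (hk : k ∈ l) (hl : l.Nodup) :
    hatPromotion r (σ k) (l.map σ) = (hatPromotion r k l).map σ := by
  obtain ⟨p, t, rfl⟩ := List.append_of_mem hk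
  have hkp : k ∉ p := fun h => (List.nodup_append.1 hl).2.2 k h k (by simp) rfl
  have : σ k ∉ p.map σ := by simpa using hkp
  rw [List.map_append, List.map_cons, hatPromotion_append _ this, hatPromotion_append _ hkp,
    slide_map σ hσ, List.map_append]

/-- Sorting the parts of the data of a linear extension around one of its letters. -/
theorem IsLinExt.exists_append {r : PartialOrder α} {l : List α} (h : IsLinExt r l) (k : α) :
    ∃ p t, l = p ++ k :: t ∧ k ∉ p ∧ k ∉ t := by
  obtain ⟨p, t, rfl⟩ := List.append_of_mem (h.2.1 k)
  have h1 := (List.nodup_append.1 h.1)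
  exact ⟨p, t, rfl, fun h2 => h1.2.2 k h2 k (by simp) rfl, (List.nodup_cons.1 h1.2.1).1⟩

end Slide

/-! ### Breaking a covering relation in one poset -/

section Break

variable {α : Type u}

/-- `r'` arises from `r` by dropping the relation `a ≺ b`, and `r` is of the form
`(Q' ⊕ a ⊕ b ⊕ Q'') + P₂`. -/
structure Breaks (r r' : PartialOrder α) (a b : α) : Prop where
  breakable : @IsBreakable α r a b
  removal : ∀ x y, r'.le x y ↔ r.le x y ∧ ¬ (x = a ∧ y = b)

namespace Breaks

variable {r r' : PartialOrder α} {a b : α}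

theorem lt (h : Breaks r r' a b) : r.lt a b := h.breakable.1

theorem le (h : Breaks r r' a b) : r.le a b := @le_of_lt α r.toPreorder _ _ h.lt

theorem ne (h : Breaks r r' a b) : a ≠ b := @ne_of_lt α r.toPreorder _ _ h.lt

theorem not_ge (h : Breaks r r' a b) : ¬ r.le b a := fun h' => h.ne (r.le_antisymm _ _ h.le h')

theorem le_of_le (h : Breaks r r' a b) {x y : α} (hxy : r'.le x y) : r.le x y :=
  ((h.removal x y).1 hxy).1

/-- An element `x ⪯ b` lies in the direct summand of `b`, so `x ⪯ a` or `b ⪯ x`; the latter forces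
`x = b`. -/
theorem le_left_iff (h : Breaks r r' a b) {x : α} (hxb : x ≠ b) :
    r.le x a ↔ r.le x b := by
  refine ⟨fun h1 => r.le_trans _ _ _ h1 h.le, fun h1 => ?_⟩
  rcases (h.breakable.2 x b h1).2 (Or.inr (r.le_refl b)) with h2 | h2
  · exact h2
  · exact absurd (r.le_antisymm _ _ h1 h2) hxb

theorem le_right_iff (h : Breaks r r' a b) {x : α} (hxa : x ≠ a) :
    r.le a x ↔ r.le b x := by
  refine ⟨fun h1 => ?_, fun h1 => r.le_trans _ _ _ h.le h1⟩
  rcases (h.breakable.2 a x h1).1 (Or.inl (r.le_refl a)) with h2 | h2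
  · exact absurd (r.le_antisymm _ _ h2 h1) hxa
  · exact h2

/-- In `r'` the elements `a` and `b` are incomparable twins with the same elements below and above
them. -/
theorem swap_le_swap [DecidableEq α] (h : Breaks r r' a b) (x y : α) :
    r'.le (Equiv.swap a b x) (Equiv.swap a b y) ↔ r'.le x y := by
  have hba := h.not_ge
  have hab := h.ne
  have e1 : ∀ {x}, x ≠ a → x ≠ b → (r.le x a ↔ r.le x b) := fun _ h2 => h.le_left_iff h2
  have e2 : ∀ {x}, x ≠ a → x ≠ b → (r.le a x ↔ r.le b x) := fun h1 _ => h.le_right_iff h1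
  have ha := r.le_refl a
  have hb := r.le_refl b
  simp only [h.removal]
  rcases eq_or_ne x a with rfl | hxa
  · rcases eq_or_ne y x with rfl | hya
    · simp [ha, hb, hab, hab.symm]
    · rcases eq_or_ne y b with rfl | hyb
      · simp [hba]
      · simp [Equiv.swap_apply_of_ne_of_ne hya hyb, hyb, e2 hya hyb]
  · rcases eq_or_ne x b with rfl | hxb
    · rcases eq_or_ne y a with rfl | hya
      · simp [hba]
      · rcases eq_or_ne y x with rfl | hyb
        · simp [ha, hb, hab, hab.symm]
        · simp [Equiv.swap_apply_of_ne_of_ne hya hyb, hxa, hyb, e2 hya hyb]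
    · rw [Equiv.swap_apply_of_ne_of_ne hxa hxb]
      rcases eq_or_ne y a with rfl | hya
      · simp [hxa, e1 hxa hxb]
      · rcases eq_or_ne y b with rfl | hyb
        · simp [hxa, e1 hxa hxb]
        · simp [Equiv.swap_apply_of_ne_of_ne hya hyb]

theorem comparable_iff (h : Breaks r r' a b) {x y : α} (h1 : ¬ (x = a ∧ y = b))
    (h2 : ¬ (x = b ∧ y = a)) :
    (¬ r'.le x y ∧ ¬ r'.le y x) ↔ (¬ r.le x y ∧ ¬ r.le y x) := by
  have h3 : ¬ (y = a ∧ x = b) := fun h => h2 ⟨h.2, h.1⟩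
  simp [h.removal, h1, h3]

/-- The orders differ only in the comparison of `a` with `b`, which never occurs without `a`. -/
theorem slide_eq_of_notMem (h : Breaks r r' a b) {k : α} {t : List α} (ha : a ∉ k :: t) :
    slide r' k t = slide r k t := by
  induction t generalizing k with
  | nil => simp [slide]
  | cons c t ih =>
    simp only [List.mem_cons, not_or] at ha
    rw [slide_cons_congr (h.comparable_iff (x := k) (y := c) (fun h => ha.1 h.1.symm)
      (fun h => ha.2.1 h.2.symm)), slide, ih (by simp [ha]), ih (by simp [ha])]

/-- The letter `a` passes everything in front of `b`, in both orders. At `b` it stops for `r` and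
`b` moves on, whereas for `r'` it passes `b` and moves on itself. From there on the two slides are
exchanged by the automorphism swapping `a` and `b`. -/
theorem slide_left [DecidableEq α] (h : Breaks r r' a b) {t : List α} (ha : a ∉ t) (hb : b ∈ t)
    (ht : t.Nodup) (hp : (a :: t).Pairwise fun x y => ¬ r.lt y x) :
    slide r' a t = (slide r a t).map (Equiv.swap a b) := by
  induction t with
  | nil => simp at hb
  | cons c t ih =>
    simp only [List.mem_cons, not_or] at ha
    by_cases hcb : c = b
    · subst hcb
      have hbt : c ∉ t := (List.nodup_cons.1 ht).1
      have h1 : slide r c t = slide r' c t := (h.slide_eq_of_notMem (by simp [ha])).symm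
      have h2 : t.map (Equiv.swap a c) = t := by
        conv_rhs => rw [← List.map_id t]
        refine List.map_congr_left fun x hx => Equiv.swap_apply_of_ne_of_ne ?_ ?_
        · rintro rfl; exact ha.2 hx
        · rintro rfl; exact hbt hx
      have h3 := slide_map (Equiv.swap a c) h.swap_le_swap c t
      rw [h2, Equiv.swap_apply_right] at h3
      rw [slide, slide, if_pos, if_neg (by simp [h.le]), h1, List.map_cons,
        Equiv.swap_apply_left, h3]
      simp [h.removal, h.not_ge]
    · have hbt : b ∈ t := by simpa [Ne.symm hcb] using hb
      have hcomp := h.comparable_iff (x := a) (y := c) (fun h => hcb h.2)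
        (fun h => ha.1 h.2.symm)
      have hc : Equiv.swap a b c = c := Equiv.swap_apply_of_ne_of_ne (Ne.symm ha.1) hcb
      simp only [List.pairwise_cons, List.mem_cons, forall_eq_or_imp] at hp
      have hca : ¬ r.le c a := fun h1 => hp.1.1 (@lt_of_le_of_ne α r _ _ h1 (Ne.symm ha.1))
      have hac : ¬ r.le a c := fun h1 => hp.2.1 b hbt
        (@lt_of_le_of_ne α r _ _ ((h.le_right_iff (Ne.symm ha.1)).1 h1) (Ne.symm hcb))
      rw [slide_cons_congr hcomp, slide]
      rw [if_pos ⟨hac, hca⟩, if_pos ⟨hac, hca⟩,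
        ih ha.2 hbt (List.nodup_cons.1 ht).2 (List.pairwise_cons.2 ⟨hp.1.2, hp.2.2⟩),
        List.map_cons, hc]

/-- Whether the moving letter is `⪯ a` does not change when the motion is handed over in front of
`a`. If it is, the motion is handed over to `a` and `slide_left` applies; otherwise the moving
letter passes `a`, and the rest of the word no longer contains `a`. -/
theorem slide_of_mem [DecidableEq α] (h : Breaks r r' a b) {k : α} {t : List α} (hka : k ≠ a)
    (hkb : k ≠ b) (ha : a ∈ t) (hb : b ∈ t) (ht : t.Nodup)
    (hp : (k :: t).Pairwise fun x y => ¬ r.lt y x) :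
    (r.le k a → slide r' k t = (slide r k t).map (Equiv.swap a b)) ∧
      (¬ r.le k a → slide r' k t = slide r k t) := by
  induction t generalizing k with
  | nil => simp at ha
  | cons c t ih =>
    have hcomp := h.comparable_iff (x := k) (y := c) (fun h => hka h.1) (fun h => hkb h.1)
    have hk : Equiv.swap a b k = k := Equiv.swap_apply_of_ne_of_ne hka hkb
    have hp' := hp
    have ht' := ht
    simp only [List.pairwise_cons, List.mem_cons, forall_eq_or_imp] at hp
    rw [List.nodup_cons] at ht
    have hcb : c ≠ b := by
      rintro rfl
      have : a ∈ t := by simpa [h.ne] using ha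
      exact hp.2.1 a this h.lt
    have hbt : b ∈ t := by simpa [Ne.symm hcb] using hb
    by_cases hca : c = a
    · subst hca
      by_cases hkc : r.le k c
      · simp only [hkc, not_true_eq_false, false_implies, and_true, true_implies]
        rw [slide_cons_congr hcomp, slide]
        rw [if_neg (by simp [hkc]), if_neg (by simp [hkc]),
          h.slide_left ht.1 hbt ht.2 (List.pairwise_cons.2 hp.2), List.map_cons, hk]
      · simp only [hkc, not_false_eq_true, false_implies, true_and, true_implies]
        have hck : ¬ r.le c k := fun h1 => hp.1.1 (@lt_of_le_of_ne α r _ _ h1 (Ne.symm hka))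
        rw [slide_cons_congr hcomp, slide]
        rw [if_pos ⟨hkc, hck⟩, if_pos ⟨hkc, hck⟩,
          h.slide_eq_of_notMem (by simp [ht.1, Ne.symm hka])]
    · have hat : a ∈ t := by simpa [Ne.symm hca] using ha
      have hc : Equiv.swap a b c = c := Equiv.swap_apply_of_ne_of_ne hca hcb
      have hck : ¬ r.le c k ∨ c = k := by
        by_contra! h1
        exact hp.1.1 (@lt_of_le_of_ne α r _ _ h1.1 h1.2)
      rw [slide_cons_congr hcomp, slide]
      split_ifs with h1
      · have := ih hka hkb hat hbt ht.2 (List.pairwise_cons.2 ⟨hp.1.2, hp.2.2⟩)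
        refine ⟨fun h2 => ?_, fun h2 => ?_⟩
        · rw [this.1 h2, List.map_cons, hc]
        · rw [this.2 h2]
      · have hkc : r.le k c := by
          rcases hck with h2 | rfl
          · by_contra h3; exact h1 ⟨h3, h2⟩
          · exact r.le_refl _
        -- The summand condition leaves `b ⪯ c` as the only alternative, but `b` stands behind `c`
        -- in the word.
        have hcak : r.le c a ↔ r.le k a := by
          refine ⟨fun h2 => r.le_trans _ _ _ hkc h2, fun h2 => ?_⟩
          rcases (h.breakable.2 k c hkc).1 (Or.inl h2) with h3 | h3
          · exact h3
          · exact absurd (@lt_of_le_of_ne α r _ _ h3 (Ne.symm hcb)) (hp.2.1 b hbt)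
        have := ih hca hcb hat hbt ht.2 (List.pairwise_cons.2 hp.2)
        refine ⟨fun h2 => ?_, fun h2 => ?_⟩
        · rw [this.1 (hcak.2 h2), List.map_cons, hk]
        · rw [this.2 (fun h3 => h2 (hcak.1 h3))]

theorem map_swap_of_notMem [DecidableEq α] {a b : α} {p : List α} (ha : a ∉ p) (hb : b ∉ p) :
    p.map (Equiv.swap a b) = p := by
  conv_rhs => rw [← List.map_id p]
  refine List.map_congr_left fun x hx => Equiv.swap_apply_of_ne_of_ne ?_ ?_
  · rintro rfl; exact ha hx
  · rintro rfl; exact hb hx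

/-- Promotion after breaking `a ≺ b`, for a word in which `a` is in front of `b`. -/
theorem hatPromotion_eq [DecidableEq α] (h : Breaks r r' a b) {l : List α} (hl : IsLinExt r l)
    (k : α) :
    (r.le k a → hatPromotion r' k l = (hatPromotion r k l).map (Equiv.swap a b)) ∧
      (¬ r.le k a → hatPromotion r' k l = hatPromotion r k l) := by
  obtain ⟨p, t, rfl, hkp, hkt⟩ := hl.exists_append k
  have hnd := hl.1
  have hpw := hl.2.2
  rw [List.nodup_append] at hnd
  rw [List.pairwise_append] at hpw
  obtain ⟨-, hndt, hdisj⟩ := hnd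
  rw [List.nodup_cons] at hndt
  have hpt : ∀ x ∈ p, x ∉ k :: t := fun x hx hx' => hdisj x hx x hx' rfl
  have hma := hl.2.1 a
  have hmb := hl.2.1 b
  rw [List.mem_append] at hma hmb
  rw [hatPromotion_append _ hkp, hatPromotion_append _ hkp, List.map_append]
  rcases hma with ha | ha
  -- With `a` in front of `k` the slide does not meet `a`, and `k ⪯ a` is impossible.
  · have h1 := h.slide_eq_of_notMem (k := k) (t := t) (hpt a ha)
    rw [h1]
    refine ⟨fun h2 => ?_, fun _ => rfl⟩
    have : k ≠ a := by rintro rfl; exact hkp ha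
    exact absurd (@lt_of_le_of_ne α r _ _ h2 this) (hpw.2.2 a ha k (by simp))
  · have hap : a ∉ p := fun h1 => hpt a h1 ha
    have hbp : b ∉ p := fun h1 => hpw.2.2 b h1 a ha h.lt
    have hb : b ∈ k :: t := hmb.resolve_left hbp
    rw [map_swap_of_notMem hap hbp]
    by_cases hka : k = a
    · subst hka
      have hbt : b ∈ t := by simpa [h.ne.symm] using hb
      rw [h.slide_left hkt hbt hndt.2 hpw.2.1]
      exact ⟨fun _ => rfl, fun h1 => absurd (r.le_refl _) h1⟩
    · have hat : a ∈ t := by simpa [Ne.symm hka] using ha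
      have hkb : k ≠ b := by
        rintro rfl
        exact (List.pairwise_cons.1 hpw.2.1).1 a hat h.lt
      have hbt : b ∈ t := by simpa [Ne.symm hkb] using hb
      obtain ⟨h1, h2⟩ := h.slide_of_mem hka hkb hat hbt hndt.2 hpw.2.1
      exact ⟨fun h3 => by rw [h1 h3], fun h3 => by rw [h2 h3]⟩

end Breaks

end Break

/-! ### Counting fixed points of words of promotions -/

section FixedPoints

variable {α : Type u}

/-- The promotion of a letter, or nothing. -/
noncomputable def promote (r : PartialOrder α) : Option α → LinExt r → LinExt r
  | none, l => l
  | some k, l => ⟨hatPromotion r k l.1, isLinExt_hatPromotion l.2 k⟩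

/-- The number of linear extensions which are fixed by a word of promotions. -/
noncomputable def promotionFix (r : PartialOrder α) (w : List (Option α)) : ℕ :=
  Nat.card {l : LinExt r // w.foldl (fun l o => promote r o l) l = l}

/-- Run an automaton with states `Bool` along a word, with output word and final state. -/
def runWord {A : Type*} (t : Bool → A → A) (n : Bool → A → Bool) : Bool → List A → List A × Bool
  | ε, [] => ([], ε)
  | ε, x :: w => (t ε x :: (runWord t n (n ε x) w).1, (runWord t n (n ε x) w).2)

theorem runWord_map {A B : Type*} {t : Bool → A → A} {n : Bool → A → Bool} {t' : Bool → B → B}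
    {n' : Bool → B → Bool} (f : A → B) (ht : ∀ ε x, t' ε (f x) = f (t ε x))
    (hn : ∀ ε x, n' ε (f x) = n ε x) (ε : Bool) (w : List A) :
    runWord t' n' ε (w.map f) = ((runWord t n ε w).1.map f, (runWord t n ε w).2) := by
  induction w generalizing ε with
  | nil => rfl
  | cons x w ih => simp [runWord, ht, hn, ih]

open scoped Classical in
/-- The letter that is promoted instead of `o`, if the state says that `a` and `b` are swapped. -/
noncomputable def swapLetter (a b : α) : Bool → Option α → Option α
  | true, o => o.map (Equiv.swap a b)
  | false, o => o

open scoped Classical in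
/-- Whether `a` and `b` are swapped after the promotion of `o`. -/
noncomputable def swapState (r : PartialOrder α) (a b : α) (ε : Bool) (o : Option α) : Bool :=
  xor ε (decide (∃ k ∈ swapLetter a b ε o, r.le k a))

namespace Breaks

variable {r r' : PartialOrder α} {a b : α}

theorem isLinExt_of_isLinExt (h : Breaks r r' a b) {l : List α} (hl : IsLinExt r l) :
    IsLinExt r' l := by
  refine ⟨hl.1, hl.2.1, hl.2.2.imp fun {x y} hxy hlt => hxy ?_⟩
  have h1 := (@lt_iff_le_and_ne α r' _ _).1 hlt
  exact (@lt_iff_le_and_ne α r _ _).2 ⟨h.le_of_le h1.1, h1.2⟩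

theorem isLinExt_map_swap [DecidableEq α] (h : Breaks r r' a b) {l : List α}
    (hl : IsLinExt r' l) : IsLinExt r' (l.map (Equiv.swap a b)) := by
  refine ⟨hl.1.map (Equiv.injective _), fun x => ?_, ?_⟩
  · rw [List.mem_map]
    exact ⟨Equiv.swap a b x, hl.2.1 _, Equiv.swap_apply_self a b x⟩
  · rw [List.pairwise_map]
    refine hl.2.2.imp fun {x y} hxy hlt => hxy ?_
    have h1 := (@lt_iff_le_and_ne α r' _ _).1 hlt
    exact (@lt_iff_le_and_ne α r' _ _).2
      ⟨(h.swap_le_swap _ _).1 h1.1, fun h2 => h1.2 (congrArg _ h2)⟩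

open scoped Classical in
/-- A linear extension for `P'` is one for `P`, up to swapping `a` and `b`. -/
noncomputable def twist (h : Breaks r r' a b) : LinExt r × Bool → LinExt r'
  | (l, true) => ⟨l.1.map (Equiv.swap a b), h.isLinExt_map_swap (h.isLinExt_of_isLinExt l.2)⟩
  | (l, false) => ⟨l.1, h.isLinExt_of_isLinExt l.2⟩

theorem isLinExt_iff (h : Breaks r r' a b) {l : List α} (hl : IsLinExt r' l) :
    IsLinExt r l ↔ l.Pairwise fun x y => ¬ (x = b ∧ y = a) := by
  refine ⟨fun h1 => h1.2.2.imp ?_, fun h1 => ⟨hl.1, hl.2.1, ?_⟩⟩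
  · rintro x y hxy ⟨rfl, rfl⟩
    exact hxy h.lt
  · refine (hl.2.2.and h1).imp ?_
    rintro x y ⟨hxy, h2⟩ hlt
    have h3 := (@lt_iff_le_and_ne α r _ _).1 hlt
    exact hxy ((@lt_iff_le_and_ne α r' _ _).2
      ⟨(h.removal _ _).2 ⟨h3.1, fun h4 => h2 h4.symm⟩, h3.2⟩)

/-- An extension for `r'` is one for `r` exactly if `a` is in front of `b`, and the exchange of the
twins interchanges the two possible orders. -/
theorem twist_bijective (h : Breaks r r' a b) : Function.Bijective h.twist := by
  classical
  have key : ∀ {l : List α}, l.Nodup → a ∈ l → b ∈ l →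
      ((l.Pairwise fun x y => ¬ (x = b ∧ y = a)) ↔
        ¬ l.Pairwise fun x y => ¬ (x = a ∧ y = b)) := by
    intro l hnd ha hb
    induction l with
    | nil => simp at ha
    | cons c l ih =>
      rw [List.nodup_cons] at hnd
      have hab := h.ne
      simp only [List.pairwise_cons]
      by_cases hca : c = a
      · subst hca
        have hbl : b ∈ l := by simpa [hab.symm] using hb
        have h1 : l.Pairwise fun x y => ¬ (x = b ∧ y = c) :=
          List.Pairwise.imp_of_mem (R := fun _ _ => True)
            (fun _ hy _ h2 => hnd.1 (h2.2 ▸ hy)) (List.pairwise_of_forall fun _ _ => trivial)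
        simp only [h1, and_true, hab, false_and, not_false_eq_true, implies_true, true_iff]
        exact fun h2 => h2.1 b hbl (by simp)
      · by_cases hcb : c = b
        · subst hcb
          have hal : a ∈ l := by simpa [hab] using ha
          have h1 : l.Pairwise fun x y => ¬ (x = a ∧ y = c) :=
            List.Pairwise.imp_of_mem (R := fun _ _ => True)
              (fun _ hy _ h2 => hnd.1 (h2.2 ▸ hy)) (List.pairwise_of_forall fun _ _ => trivial)
          simp only [h1, and_true, hab.symm, false_and, not_false_eq_true, implies_true,
            not_true_eq_false, iff_false]
          exact fun h2 => h2.1 a hal (by simp)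
        · have := ih hnd.2 (by simpa [Ne.symm hca] using ha) (by simpa [Ne.symm hcb] using hb)
          simpa only [hca, hcb, false_and, not_false_eq_true, implies_true, true_and] using this
  have hmap : ∀ {l : List α}, ((l.map (Equiv.swap a b)).Pairwise fun x y => ¬ (x = b ∧ y = a)) ↔
      l.Pairwise fun x y => ¬ (x = a ∧ y = b) := by
    intro l
    rw [List.pairwise_map]
    have e (x y : α) : (Equiv.swap a b x = b ∧ Equiv.swap a b y = a) ↔ (x = a ∧ y = b) := by
      rw [Equiv.swap_apply_eq_iff, Equiv.swap_apply_eq_iff, Equiv.swap_apply_left,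
        Equiv.swap_apply_right]
    simp only [e]
  have hnot : ∀ {l : List α}, IsLinExt r l → ¬ IsLinExt r (l.map (Equiv.swap a b)) := by
    intro l hl h1
    have h2 := (h.isLinExt_iff (h.isLinExt_of_isLinExt hl)).1 hl
    have h3 := (h.isLinExt_iff (h.isLinExt_of_isLinExt h1)).1 h1
    exact (key hl.1 (hl.2.1 a) (hl.2.1 b)).1 h2 (hmap.1 h3)
  constructor
  · rintro ⟨⟨l, hl⟩, ε⟩ ⟨⟨m, hm⟩, δ⟩ he
    have he' := congrArg Subtype.val he
    cases ε <;> cases δ <;> simp only [twist] at he'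
    · subst he'; rfl
    · exact absurd (he' ▸ hl) (hnot hm)
    · exact absurd (he' ▸ hm) (hnot hl)
    · have := List.map_injective_iff.2 (Equiv.injective _) he'
      subst this; rfl
  · rintro ⟨l, hl⟩
    by_cases h1 : IsLinExt r l
    · exact ⟨(⟨l, h1⟩, false), rfl⟩
    · have h2 := h.isLinExt_map_swap hl
      have h3 : IsLinExt r (l.map (Equiv.swap a b)) := by
        rw [h.isLinExt_iff h2, hmap]
        by_contra h4
        exact h1 ((h.isLinExt_iff hl).2 ((key hl.1 (hl.2.1 a) (hl.2.1 b)).2 h4))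
      refine ⟨(⟨_, h3⟩, true), Subtype.ext ?_⟩
      simp [twist, Function.comp_def]

/-- In the swapped state, promoting `k` is the swap of promoting the swapped letter in the unswapped
word, because the swap is an automorphism of `r'`. `hatPromotion_eq` then tells whether a further
swap appears, and two swaps cancel. -/
theorem promote_twist (h : Breaks r r' a b) (o : Option α) (l : LinExt r) (ε : Bool) :
    promote r' o (h.twist (l, ε)) =
      h.twist (promote r (swapLetter a b ε o) l, swapState r a b ε o) := by
  classical
  cases o with
  | none => cases ε <;> simp [swapLetter, swapState, promote]
  | some k =>
    have hno : ∀ m : α, hatPromotion r' m l.1 = (if r.le m a then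
        (hatPromotion r m l.1).map (Equiv.swap a b) else hatPromotion r m l.1) := by
      intro m
      split_ifs with hm
      · exact (h.hatPromotion_eq l.2 m).1 hm
      · exact (h.hatPromotion_eq l.2 m).2 hm
    apply Subtype.ext
    cases ε
    · have := hno k
      by_cases hk : r.le k a <;> simpa [promote, twist, swapLetter, swapState, hk] using this
    · have := hno (Equiv.swap a b k)
      have h2 := hatPromotion_map (Equiv.swap a b) h.swap_le_swap (l.2.2.1 (Equiv.swap a b k))
        l.2.1
      rw [Equiv.swap_apply_self, this] at h2
      by_cases hk : r.le (Equiv.swap a b k) a <;>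
        simpa [promote, twist, swapLetter, swapState, hk, List.map_map, Function.comp_def] using h2

/-- A pair (extension for `r`, state) is fixed if and only if the automaton returns to the initial
state and the extension is fixed by the output word. -/
theorem promotionFix_eq (h : Breaks r r' a b) [Finite α] (w : List (Option α)) :
    promotionFix r' w = ∑ ε : Bool,
      if (runWord (swapLetter a b) (swapState r a b) ε w).2 = ε then
        promotionFix r (runWord (swapLetter a b) (swapState r a b) ε w).1 else 0 := by
  classical
  have hfold : ∀ (w : List (Option α)) (l : LinExt r) (ε : Bool),
      w.foldl (fun l o => promote r' o l) (h.twist (l, ε)) =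
      h.twist ((runWord (swapLetter a b) (swapState r a b) ε w).1.foldl
        (fun l o => promote r o l) l, (runWord (swapLetter a b) (swapState r a b) ε w).2) := by
    intro w
    induction w with
    | nil => intro l ε; rfl
    | cons o w ih => intro l ε; rw [List.foldl_cons, h.promote_twist, ih]; rfl
  have e1 : promotionFix r' w = Nat.card {x : Bool × LinExt r //
      (runWord (swapLetter a b) (swapState r a b) x.1 w).2 = x.1 ∧
      (runWord (swapLetter a b) (swapState r a b) x.1 w).1.foldl
        (fun l o => promote r o l) x.2 = x.2} := by
    refine (Nat.card_congr (Equiv.subtypeEquiv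
      ((Equiv.prodComm _ _).trans (Equiv.ofBijective _ h.twist_bijective)) ?_)).symm
    rintro ⟨ε, l⟩
    simp only [Equiv.trans_apply, Equiv.prodComm_apply, Prod.swap_prod_mk,
      Equiv.ofBijective_apply, hfold, h.twist_bijective.1.eq_iff, Prod.mk.injEq]
    tauto
  rw [e1, Nat.card_congr (Equiv.subtypeProdEquivSigmaSubtype fun ε l =>
      (runWord (swapLetter a b) (swapState r a b) ε w).2 = ε ∧
      (runWord (swapLetter a b) (swapState r a b) ε w).1.foldl
        (fun l o => promote r o l) l = l), Nat.card_sigma]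
  refine Finset.sum_congr rfl fun ε _ => ?_
  split_ifs with h1
  · simp only [h1, true_and]; rfl
  · simp [h1]

end Breaks

end FixedPoints

end TreeShuffle


namespace TreeShuffle

/-! ### The relative order of two letters of a word -/

section Before

variable {α : Type u}

/-- The letter `x` occurs in the word in front of some occurrence of `y`. -/
def Before (l : List α) (x y : α) : Prop := [x, y].Sublist l

theorem before_cons {c : α} {l : List α} {x y : α} :
    Before (c :: l) x y ↔ (x = c ∧ y ∈ l) ∨ Before l x y := by
  unfold Before
  constructor
  · intro h
    cases h with
    | cons _ h => exact Or.inr h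
    | cons_cons _ h => exact Or.inl ⟨rfl, by simpa using h⟩
  · rintro (⟨rfl, h⟩ | h)
    · exact List.Sublist.cons_cons _ (by simpa using h)
    · exact List.Sublist.cons _ h

theorem not_before_nil {x y : α} : ¬ Before [] x y := by simp [Before]

theorem before_append {l m : List α} {x y : α} :
    Before (l ++ m) x y ↔ Before l x y ∨ (x ∈ l ∧ y ∈ m) ∨ Before m x y := by
  induction l with
  | nil => simp [not_before_nil]
  | cons c l ih =>
    rw [List.cons_append, before_cons, ih, before_cons, List.mem_append, List.mem_cons]
    tauto

theorem Before.mem_left {l : List α} {x y : α} (h : Before l x y) : x ∈ l :=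
  List.Sublist.subset h (by simp)

theorem Before.mem_right {l : List α} {x y : α} (h : Before l x y) : y ∈ l :=
  List.Sublist.subset h (by simp)

theorem before_filter {l : List α} {p : α → Bool} {x y : α} (hx : p x) (hy : p y) :
    Before (l.filter p) x y ↔ Before l x y := by
  induction l with
  | nil => simp
  | cons c l ih =>
    by_cases hc : p c
    · rw [List.filter_cons_of_pos hc, before_cons, before_cons, ih]
      simp [hy]
    · rw [List.filter_cons_of_neg hc, before_cons, ih]
      have : x ≠ c := by rintro rfl; exact hc hx
      simp [this]

theorem Before.irrefl {l : List α} (hl : l.Nodup) {x : α} : ¬ Before l x x := fun h => by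
  have := hl.sublist h
  simp at this

theorem before_total {l : List α} {x y : α} (hx : x ∈ l) (hy : y ∈ l) (hxy : x ≠ y) :
    Before l x y ∨ Before l y x := by
  induction l with
  | nil => simp at hx
  | cons c l ih =>
    rw [before_cons, before_cons]
    rw [List.mem_cons] at hx hy
    rcases hx with rfl | hx
    · exact Or.inl (Or.inl ⟨rfl, hy.resolve_left (Ne.symm hxy)⟩)
    · rcases hy with rfl | hy
      · exact Or.inr (Or.inl ⟨rfl, hx⟩)
      · exact (ih hx hy).imp Or.inr Or.inr

theorem Before.asymm {l : List α} (hl : l.Nodup) {x y : α} (h : Before l x y) :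
    ¬ Before l y x := by
  induction l with
  | nil => exact absurd h not_before_nil
  | cons c l ih =>
    rw [List.nodup_cons] at hl
    rw [before_cons] at h ⊢
    rintro (⟨rfl, h1⟩ | h1)
    · rcases h with ⟨rfl, -⟩ | h
      · exact hl.1 h1
      · exact hl.1 h.mem_right
    · rcases h with ⟨rfl, -⟩ | h
      · exact hl.1 h1.mem_right
      · exact ih hl.2 h h1

theorem not_before_iff {l : List α} (hl : l.Nodup) {x y : α} (hx : x ∈ l) (hy : y ∈ l)
    (hxy : x ≠ y) : ¬ Before l x y ↔ Before l y x :=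
  ⟨fun h => (before_total hx hy hxy).resolve_left h, fun h => h.asymm hl⟩

theorem pairwise_before (l : List α) : l.Pairwise (Before l) := by
  rw [List.pairwise_iff_forall_sublist]
  exact fun h => h

theorem pairwise_iff_before {l : List α} {R : α → α → Prop} :
    l.Pairwise R ↔ ∀ x y, Before l x y → R x y := by
  rw [List.pairwise_iff_forall_sublist]
  exact ⟨fun h x y hxy => h hxy, fun h x y hxy => h x y hxy⟩

theorem eq_of_before {l m : List α} (hl : l.Nodup) (hm : m.Nodup) (hmem : ∀ x, x ∈ l ↔ x ∈ m)
    (h : ∀ x y, Before l x y ↔ Before m x y) : l = m := by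
  have hp : l.Perm m := (List.perm_ext_iff_of_nodup hl hm).2 hmem
  refine hp.eq_of_pairwise (le := Before l) ?_ (pairwise_before l)
    ((pairwise_before m).imp fun {x y} hxy => (h x y).2 hxy)
  intro x y _ _ hxy hyx
  exact absurd hyx (hxy.asymm hl)

theorem IsLinExt.before_of_lt {r : PartialOrder α} {l : List α} (hl : IsLinExt r l) {x y : α}
    (h : r.lt x y) : Before l x y := by
  have hne : x ≠ y := @ne_of_lt α r.toPreorder _ _ h
  refine (before_total (hl.2.1 x) (hl.2.1 y) hne).resolve_right fun h1 => ?_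
  exact (List.pairwise_iff_forall_sublist.1 hl.2.2) h1 h

end Before

/-! ### Promotion in rooted forests -/

section Forest

variable {α : Type u} [r : PartialOrder α]

/-- All letters that ever move lie above `k`; the others keep their relative order. -/
theorem filter_slide {k : α} {t : List α} {p : α → Bool} (hk : ∀ y, k ≤ y → p y = false)
    (hp : (k :: t).Pairwise fun x y => ¬ y < x) :
    (slide r k t).filter p = t.filter p := by
  induction t generalizing k with
  | nil => simp [slide, hk k le_rfl]
  | cons b t ih =>
    simp only [List.pairwise_cons, List.mem_cons, forall_eq_or_imp] at hp
    rw [slide]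
    split_ifs with h
    · rw [List.filter_cons, List.filter_cons, ih hk (List.pairwise_cons.2 ⟨hp.1.2, hp.2.2⟩)]
    · have hkb : k ≤ b := by
        by_contra h1
        have h2 : b ≤ k := by by_contra h2; exact h ⟨h1, h2⟩
        exact hp.1.1 (lt_of_le_not_ge h2 h1)
      have h1 : p b = false := hk b hkb
      rw [List.filter_cons_of_neg (by simp [hk k le_rfl]), List.filter_cons_of_neg (by simp [h1]),
        ih (fun y hy => hk y (hkb.trans hy)) (List.pairwise_cons.2 hp.2)]

theorem filter_hatPromotion {k : α} {l : List α} {p : α → Bool} (hl : IsLinExt r l)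
    (hk : ∀ y, k ≤ y → p y = false) : (hatPromotion r k l).filter p = l.filter p := by
  obtain ⟨q, t, rfl, hkp, -⟩ := hl.exists_append k
  have hp := (List.pairwise_append.1 hl.2.2).2.1
  rw [hatPromotion_append _ hkp, List.filter_append, List.filter_append, filter_slide hk hp,
    List.filter_cons_of_neg (by simp [hk k le_rfl])]

/-- In a forest the elements above `k` form a chain, and the moving letters run through this chain.
Each of them comes to rest in front of the old place of its successor, and the topmost one at the
end of the word. So its position relative to an unmoved letter is the previous position of its
successor. -/
theorem before_slide [Finite α] (hF : IsRootedForest α) {k y z : α} {t : List α} (hnd : (k :: t).Nodup)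
    (hp : (k :: t).Pairwise fun x y => ¬ y < x) (hup : ∀ x, k < x → x ∈ t)
    (hy : y ∈ t) (hky : ¬ k ≤ y) (hkz : k ≤ z) :
    (IsMax z → Before (slide r k t) y z) ∧
      ∀ z', z ⋖ z' → (Before (slide r k t) y z ↔ Before t y z') := by
  induction t generalizing k with
  | nil => simp at hy
  | cons b t ih =>
    simp only [List.pairwise_cons, List.mem_cons, forall_eq_or_imp] at hp
    simp only [List.nodup_cons, List.mem_cons, not_or] at hnd
    have hzmem : z ∈ k :: b :: t := by
      rcases hkz.eq_or_lt with rfl | h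
      · simp
      · exact List.mem_cons_of_mem _ (hup z h)
    have hz'mem : ∀ z', z ⋖ z' → z' ∈ b :: t := fun z' h => hup z' (hkz.trans_lt h.lt)
    rw [slide]
    split_ifs with h
    · have hzb : z ≠ b := by rintro rfl; exact h.1 hkz
      have hz : z ∈ slide r k t := by
        rw [(slide_perm r k t).mem_iff]
        simpa [hzb] using hzmem
      by_cases hyb : y = b
      · subst hyb
        refine ⟨fun _ => before_cons.2 (Or.inl ⟨rfl, hz⟩), fun z' hz' => ?_⟩
        have hz't : z' ∈ t := by
          rcases List.mem_cons.1 (hz'mem z' hz') with rfl | h'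
          · exact absurd (hkz.trans hz'.le) hky
          · exact h'
        exact iff_of_true (before_cons.2 (Or.inl ⟨rfl, hz⟩)) (before_cons.2 (Or.inl ⟨rfl, hz't⟩))
      · have hyt : y ∈ t := by simpa [hyb] using hy
        have hup' : ∀ x, k < x → x ∈ t := fun x hx => by
          rcases List.mem_cons.1 (hup x hx) with rfl | h'
          · exact absurd hx.le h.1
          · exact h'
        have := ih (List.nodup_cons.2 ⟨hnd.1.2, hnd.2.2⟩)
          (List.pairwise_cons.2 ⟨hp.1.2, hp.2.2⟩) hup' hyt hky hkz
        simpa only [before_cons, hyb, false_and, false_or] using this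
    · have hkb : k < b := by
        refine lt_of_le_of_ne ?_ hnd.1.1
        by_contra h1
        have h2 : b ≤ k := by by_contra h2; exact h ⟨h1, h2⟩
        exact hp.1.1 (lt_of_le_not_ge h2 h1)
      -- An element strictly between `k` and `b` would have to stand behind `b`, against the order
      -- of the word.
      have hcov : k ⋖ b := by
        refine ⟨hkb, fun c hkc hcb => ?_⟩
        rcases List.mem_cons.1 (hup c hkc) with rfl | hct
        · exact lt_irrefl _ hcb
        · exact hp.2.1 c hct hcb
      have hyb : y ≠ b := by rintro rfl; exact hky hkb.le
      have hyk : y ≠ k := by rintro rfl; exact hky le_rfl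
      have hyt : y ∈ t := by simpa [hyb] using hy
      by_cases hzk : z = k
      · subst hzk
        refine ⟨fun hm => absurd hkb (hm.not_lt), fun z' hz' => ?_⟩
        obtain rfl := hF _ _ _ hcov hz'
        refine iff_of_false ?_ ?_
        · rw [before_cons]
          rintro (⟨h1, -⟩ | h1)
          · exact hyk h1
          · have := (slide_perm r b t).mem_iff.1 h1.mem_right
            rcases List.mem_cons.1 this with h2 | h2
            · exact hnd.1.1 h2
            · exact hnd.1.2 h2
        · rw [before_cons]
          rintro (⟨h1, -⟩ | h1)
          · exact hyb h1
          · exact hnd.2.1 h1.mem_right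
      · have hbz : b ≤ z := by
          obtain ⟨c, hkc, hcz⟩ := exists_covBy_le_of_lt (lt_of_le_of_ne hkz (Ne.symm hzk))
          rwa [hF _ _ _ hcov hkc]
        have hup' : ∀ x, b < x → x ∈ t := fun x hx => by
          rcases List.mem_cons.1 (hup x (hkb.trans hx)) with rfl | h'
          · exact absurd hx (lt_irrefl _)
          · exact h'
        have hby : ¬ b ≤ y := fun h1 => hky (hkb.le.trans h1)
        have := ih (List.nodup_cons.2 hnd.2) (List.pairwise_cons.2 hp.2) hup' hyt hby hbz
        simpa only [before_cons, hyk, hyb, false_and, false_or] using this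

theorem before_hatPromotion [Finite α] (hF : IsRootedForest α) {k y z : α} {l : List α}
    (hl : IsLinExt r l) (hky : ¬ k ≤ y) (hkz : k ≤ z) :
    (IsMax z → Before (hatPromotion r k l) y z) ∧
      ∀ z', z ⋖ z' → (Before (hatPromotion r k l) y z ↔ Before l y z') := by
  obtain ⟨p, t, rfl, hkp, hkt⟩ := hl.exists_append k
  have hpw := List.pairwise_append.1 hl.2.2
  have hnd := List.nodup_append.1 hl.1
  have hyk : y ≠ k := by rintro rfl; exact hky le_rfl
  have hup : ∀ x, k < x → x ∈ t := fun x hx => by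
    rcases List.mem_append.1 (hl.2.1 x) with h | h
    · exact absurd hx (hpw.2.2 x h k (by simp))
    · exact (List.mem_cons.1 h).resolve_left hx.ne'
  have hz : z ∈ slide r k t := by
    rw [(slide_perm r k t).mem_iff]
    rcases hkz.eq_or_lt with rfl | h
    · simp
    · exact List.mem_cons_of_mem _ (hup z h)
  rw [hatPromotion_append _ hkp]
  by_cases hyp : y ∈ p
  · have h1 : Before (p ++ slide r k t) y z := before_append.2 (Or.inr (Or.inl ⟨hyp, hz⟩))
    refine ⟨fun _ => h1, fun z' hz' => iff_of_true h1 ?_⟩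
    exact before_append.2 (Or.inr (Or.inl
      ⟨hyp, List.mem_cons_of_mem _ (hup z' (hkz.trans_lt hz'.lt))⟩))
  · have hyt : y ∈ t := by simpa [hyp, hyk] using hl.2.1 y
    have hb : ∀ z, ¬ Before p y z := fun z h => hyp h.mem_left
    have := before_slide hF hnd.2.1 hpw.2.1 hup hyt hky hkz
    simpa only [before_append, before_cons, hb, hyp, hyk, false_and, false_or] using this

theorem IsRootedForest.le_total_of_le [Finite α] (hF : IsRootedForest α) {k y z : α}
    (hy : k ≤ y) (hz : k ≤ z) : y ≤ z ∨ z ≤ y := by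
  induction k using WellFoundedGT.induction with
  | ind k ih =>
    rcases hy.eq_or_lt with rfl | hy'
    · exact Or.inl hz
    rcases hz.eq_or_lt with rfl | hz'
    · exact Or.inr hy
    obtain ⟨c, hkc, hcy⟩ := exists_covBy_le_of_lt hy'
    obtain ⟨d, hkd, hdz⟩ := exists_covBy_le_of_lt hz'
    obtain rfl := hF _ _ _ hkc hkd
    exact ih c hkc.lt hcy hdz

/-- Two words agree on the relative order of two letters. -/
def Agree (l m : List α) (y z : α) : Prop := Before l y z ↔ Before m y z

theorem Agree.symm {l m : List α} (hl : IsLinExt r l) (hm : IsLinExt r m) {y z : α}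
    (h : Agree l m y z) : Agree l m z y := by
  by_cases hyz : y = z
  · subst hyz; exact h
  · unfold Agree at *
    rw [← not_before_iff hl.1 (hl.2.1 y) (hl.2.1 z) hyz,
      ← not_before_iff hm.1 (hm.2.1 y) (hm.2.1 z) hyz, h]

theorem agree_of_le {l m : List α} (hl : IsLinExt r l) (hm : IsLinExt r m) {y z : α}
    (h : y ≤ z) : Agree l m y z := by
  rcases h.eq_or_lt with rfl | h
  · exact iff_of_false (Before.irrefl hl.1) (Before.irrefl hm.1)
  · exact iff_of_true (hl.before_of_lt h) (hm.before_of_lt h)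

/-- After the promotion the order of `y` and `z` is the earlier order of `y` and the successor of
`z`, unless `y` is above `k` too; then `y` and `z` are comparable and their order is forced. -/
theorem agree_hatPromotion [Finite α] (hF : IsRootedForest α) {l m : List α}
    (hl : IsLinExt r l) (hm : IsLinExt r m) {k y z : α} (hkz : k ≤ z)
    (h : ∀ z', z < z' → Agree l m y z') :
    Agree (hatPromotion r k l) (hatPromotion r k m) y z := by
  have hl' := isLinExt_hatPromotion hl k
  have hm' := isLinExt_hatPromotion hm k
  by_cases hky : k ≤ y
  · rcases hF.le_total_of_le hky hkz with h1 | h1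
    · exact agree_of_le hl' hm' h1
    · exact (agree_of_le hl' hm' h1).symm hl' hm'
  · have h1 := before_hatPromotion hF hl hky hkz
    have h2 := before_hatPromotion hF hm hky hkz
    by_cases hz : IsMax z
    · exact iff_of_true (h1.1 hz) (h2.1 hz)
    · obtain ⟨z', hz'⟩ := not_isMax_iff.1 hz
      obtain ⟨c, hzc, -⟩ := exists_covBy_le_of_lt hz'
      exact (h1.2 c hzc).trans ((h c hzc.lt).trans (h2.2 c hzc).symm)

/-- The pairs of letters such that two words agree on all pairs above. -/
def agreeSet (l m : List α) : Set (α × α) := {q | ∀ q', q ≤ q' → Agree l m q'.1 q'.2}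

theorem agreeSet_subset_hatPromotion [Finite α] (hF : IsRootedForest α) {l m : List α}
    (hl : IsLinExt r l) (hm : IsLinExt r m) (k : α) :
    agreeSet l m ⊆ agreeSet (hatPromotion r k l) (hatPromotion r k m) := by
  classical
  rintro q hq ⟨y, z⟩ hqyz
  have hl' := isLinExt_hatPromotion hl k
  have hm' := isLinExt_hatPromotion hm k
  by_cases hkz : k ≤ z
  · exact agree_hatPromotion hF hl hm hkz fun z' hz' =>
      hq (y, z') ⟨hqyz.1, hqyz.2.trans hz'.le⟩
  by_cases hky : k ≤ y
  · exact (agree_hatPromotion hF hl hm hky fun y' hy' =>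
      (hq (y', z) ⟨hqyz.1.trans hy'.le, hqyz.2⟩).symm hl hm).symm hl' hm'
  · have h1 : ∀ x, k ≤ x → decide (¬ k ≤ x) = false := by simp
    have hpy : decide (¬ k ≤ y) = true := by simpa using hky
    have hpz : decide (¬ k ≤ z) = true := by simpa using hkz
    have e0 := fun l : List α => before_filter (l := l) (p := fun x => decide (¬ k ≤ x)) hpy hpz
    have e1 := e0 (hatPromotion r k l)
    have e2 := e0 (hatPromotion r k m)
    rw [filter_hatPromotion hl h1, e0] at e1
    rw [filter_hatPromotion hm h1, e0] at e2
    exact e1.symm.trans ((hq (y, z) hqyz).trans e2)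

theorem isLinExt_foldl {l : List α} (hl : IsLinExt r l) (w : List α) :
    IsLinExt r (w.foldl (fun l k => hatPromotion r k l) l) := by
  induction w generalizing l with
  | nil => exact hl
  | cons k w ih => exact ih (isLinExt_hatPromotion hl k)

theorem agreeSet_subset_foldl [Finite α] (hF : IsRootedForest α) {l m : List α}
    (hl : IsLinExt r l) (hm : IsLinExt r m) (w : List α) :
    agreeSet l m ⊆ agreeSet (w.foldl (fun l k => hatPromotion r k l) l)
      (w.foldl (fun l k => hatPromotion r k l) m) := by
  induction w generalizing l m with
  | nil => exact subset_rfl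
  | cons k w ih =>
    exact (agreeSet_subset_hatPromotion hF hl hm k).trans
      (ih (isLinExt_hatPromotion hl k) (isLinExt_hatPromotion hm k))

/-- Agreement is never lost. At the first occurrence of `k` the agreement on the pairs strictly
above `q` yields agreement on `q`. -/
theorem mem_agreeSet_foldl [Finite α] (hF : IsRootedForest α) {l m : List α}
    (hl : IsLinExt r l) (hm : IsLinExt r m) {w : List α} {k : α} (hk : k ∈ w) {q : α × α}
    (hkq : k ≤ q.2) (hq : ∀ q', q < q' → q' ∈ agreeSet l m) :
    q ∈ agreeSet (w.foldl (fun l k => hatPromotion r k l) l)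
      (w.foldl (fun l k => hatPromotion r k l) m) := by
  induction w generalizing l m with
  | nil => simp at hk
  | cons c w ih =>
    have hl' := isLinExt_hatPromotion hl c
    have hm' := isLinExt_hatPromotion hm c
    have hmono := agreeSet_subset_hatPromotion hF hl hm c
    rcases List.mem_cons.1 hk with rfl | hk
    · refine agreeSet_subset_foldl hF hl' hm' w fun q' hqq' => ?_
      rcases hqq'.eq_or_lt with rfl | h
      · exact agree_hatPromotion hF hl hm hkq fun z' hz' =>
          hq (q.1, z') (Prod.mk_lt_mk_iff_right.2 hz') _ le_rfl
      · exact hmono (hq q' h) q' le_rfl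
    · exact ih hl' hm' hk fun q' h => hmono (hq q' h)

theorem filter_foldl_hatPromotion {l : List α} (hl : IsLinExt r l) (w : List α) {p : α → Bool}
    (hp : ∀ k ∈ w, ∀ y, k ≤ y → p y = false) :
    (w.foldl (fun l k => hatPromotion r k l) l).filter p = l.filter p := by
  induction w generalizing l with
  | nil => rfl
  | cons k w ih =>
    rw [List.foldl_cons, ih (isLinExt_hatPromotion hl k) fun k' hk' => hp k' (by simp [hk']),
      filter_hatPromotion hl (hp k (by simp))]

theorem exists_mem_agreeSet_foldl [Finite α] (hF : IsRootedForest α) {l m : List α}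
    (hl : IsLinExt r l) (hm : IsLinExt r m) {w : List α} {p : α → Bool}
    (hp : ∀ y, p y = false → ∃ k ∈ w, k ≤ y) (hf : l.filter p = m.filter p) (hlm : l ≠ m) :
    ∃ q, q ∉ agreeSet l m ∧ q ∈ agreeSet (w.foldl (fun l k => hatPromotion r k l) l)
      (w.foldl (fun l k => hatPromotion r k l) m) := by
  have hne : (agreeSet l m)ᶜ.Nonempty := by
    by_contra h
    rw [Set.not_nonempty_iff_eq_empty, Set.compl_empty_iff] at h
    refine hlm (eq_of_before hl.1 hm.1 (fun x => iff_of_true (hl.2.1 x) (hm.2.1 x)) fun x y => ?_)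
    exact (h ▸ Set.mem_univ (x, y) : (x, y) ∈ agreeSet l m) _ le_rfl
  -- A maximal pair outside of the set is itself a disagreement. As the filtered words coincide, one
  -- of its letters is above a letter of `w`, and this pair is gained.
  obtain ⟨⟨y, z⟩, hq, hmax⟩ := (Set.toFinite _).exists_maximal hne
  have hq' : ∀ q', (y, z) < q' → q' ∈ agreeSet l m := fun q' h => by
    by_contra h1
    exact h.not_ge (hmax h1 h.le)
  have hnot : ¬ Agree l m y z := fun h => hq fun q' hqq' => by
    rcases hqq'.eq_or_lt with rfl | h1
    · exact h
    · exact hq' q' h1 q' le_rfl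
  have hsymm : ∀ {y z : α}, (y, z) ∈ agreeSet l m → (z, y) ∈ agreeSet l m := by
    rintro y z h ⟨a, b⟩ hab
    exact (h (b, a) ⟨hab.2, hab.1⟩).symm hl hm
  by_cases hz : p z
  · by_cases hy : p y
    · refine absurd ?_ hnot
      unfold Agree
      rw [← before_filter hy hz, ← before_filter (l := m) hy hz, hf]
    · obtain ⟨k, hk, hky⟩ := hp y (by simpa using hy)
      refine ⟨(z, y), fun h => hq (hsymm h), mem_agreeSet_foldl hF hl hm hk hky ?_⟩
      rintro ⟨a, b⟩ hab
      exact hsymm (hq' (b, a) (Prod.swap_lt_swap.1 hab))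
  · obtain ⟨k, hk, hkz⟩ := hp z (by simpa using hz)
    exact ⟨(y, z), hq, mem_agreeSet_foldl hF hl hm hk hkz hq'⟩

/-- A fixed word is determined by its letters that are not above any letter of `w`: for two
different fixed words with the same such letters in the same order, the agreement would have to grow
strictly and yet remain the same. -/
theorem promotionFix_eq_card_filter [Finite α] (hF : IsRootedForest α) (w : List α)
    (p : α → Bool) (hp : ∀ y, p y = false ↔ ∃ k ∈ w, k ≤ y) :
    promotionFix r (w.map some) = Nat.card {u : List α // ∃ l, IsLinExt r l ∧ l.filter p = u} := by
  have hval : ∀ l : LinExt r, ((w.map some).foldl (fun l o => promote r o l) l).1 =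
      w.foldl (fun l k => hatPromotion r k l) l.1 := by
    induction w with
    | nil => intro l; rfl
    | cons k w ih =>
      clear hp
      intro l
      have : ∀ (w : List α) (l : LinExt r), ((w.map some).foldl (fun l o => promote r o l) l).1 =
          w.foldl (fun l k => hatPromotion r k l) l.1 := by
        intro w
        induction w with
        | nil => intro l; rfl
        | cons k w ih => intro l; exact ih _
      exact this _ _
  have hp1 : ∀ k ∈ w, ∀ y, k ≤ y → p y = false := fun k hk y hy => (hp y).2 ⟨k, hk, hy⟩
  have hp2 : ∀ y, p y = false → ∃ k ∈ w, k ≤ y := fun y hy => (hp y).1 hy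
  unfold promotionFix
  refine Nat.card_eq_of_bijective (fun l => ⟨l.1.1.filter p, l.1.1, l.1.2, rfl⟩) ⟨?_, ?_⟩
  · rintro ⟨l, hl⟩ ⟨m, hm⟩ h
    have hf := congrArg Subtype.val h
    by_contra hne
    have hlm : l.1 ≠ m.1 := fun h => hne (Subtype.ext (Subtype.ext h))
    obtain ⟨q, hq1, hq2⟩ := exists_mem_agreeSet_foldl hF l.2 m.2 hp2 hf hlm
    rw [← hval, ← hval, hl, hm] at hq2
    exact hq1 hq2
  · rintro ⟨u, l, hl, rfl⟩
    -- Among the words with the prescribed restriction, take one that agrees best with its own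
    -- image. If it were not fixed, its image would agree even better with the image of that image.
    let X := {m : LinExt r // m.1.filter p = l.filter p}
    have : Nonempty X := ⟨⟨⟨l, hl⟩, rfl⟩⟩
    obtain ⟨m, hm⟩ := Finite.exists_max (fun m : X =>
      (agreeSet m.1.1 (w.foldl (fun l k => hatPromotion r k l) m.1.1)).ncard)
    refine ⟨⟨m.1, ?_⟩, Subtype.ext m.2⟩
    apply Subtype.ext
    rw [hval]
    by_contra hne
    have hw := isLinExt_foldl m.1.2 w
    have hfm := filter_foldl_hatPromotion m.1.2 w hp1
    obtain ⟨q, hq1, hq2⟩ := exists_mem_agreeSet_foldl hF m.1.2 hw hp2 hfm.symm (Ne.symm hne)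
    have hlt := hm ⟨⟨_, hw⟩, hfm.trans m.2⟩
    refine absurd hlt (not_le.2 (Set.ncard_lt_ncard ⟨agreeSet_subset_foldl hF m.1.2 hw w, ?_⟩
      (Set.toFinite _)))
    exact fun h => hq1 (h hq2)

/-- The linear extensions of the subposet on `D`, written as words. -/
def IsLinExtOn (D : Set α) (u : List α) : Prop :=
  u.Nodup ∧ (∀ a, a ∈ u ↔ a ∈ D) ∧ u.Pairwise fun a b => ¬ b < a

variable (r) in
theorem exists_isLinExt [Finite α] : ∃ l, IsLinExt r l := by
  classical
  have : Finite (LinearExtension α) := ‹Finite α›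
  have := Fintype.ofFinite (LinearExtension α)
  obtain ⟨l, hnd, hmem, hp⟩ : ∃ l : List (LinearExtension α),
      l.Nodup ∧ (∀ a, a ∈ l) ∧ l.Pairwise (· ≤ ·) :=
    ⟨Finset.univ.sort, Finset.sort_nodup _ _, fun a => (Finset.mem_sort _).2 (Finset.mem_univ _),
      Finset.pairwise_sort _ _⟩
  refine ⟨l, hnd, hmem, hp.imp ?_⟩
  intro a b hab (hba : @LT.lt α r.toLT b a)
  have h1 : @LE.le (LinearExtension α) _ b a := (toLinearExtension (α := α)).monotone hba.le
  exact hba.ne (le_antisymm (α := LinearExtension α) h1 hab)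

/-- Since `D` is a lower set, a word on `D` can be completed by appending the other letters in the
order of any linear extension. -/
theorem isLinExtOn_iff [Finite α] {D : Set α} (hD : IsLowerSet D) {p : α → Bool}
    (hp : ∀ a, p a = true ↔ a ∈ D) (u : List α) :
    IsLinExtOn D u ↔ ∃ l, IsLinExt r l ∧ l.filter p = u := by
  constructor
  · intro hu
    obtain ⟨m, hm⟩ := exists_isLinExt r
    have hnp : ∀ a ∈ u, p a = true := fun a ha => (hp a).2 ((hu.2.1 a).1 ha)
    refine ⟨u ++ m.filter (fun a => !p a), ⟨?_, fun a => ?_, ?_⟩, ?_⟩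
    · refine hu.1.append (hm.1.filter _) fun a ha hb => ?_
      simp [hnp a ha] at hb
    · rw [List.mem_append, hu.2.1, ← hp]
      by_cases h : p a <;> simp [h, hm.2.1]
    · rw [List.pairwise_append]
      refine ⟨hu.2.2, hm.2.2.filter _, fun a ha b hb hba => ?_⟩
      have := (hp b).2 (hD hba.le ((hu.2.1 a).1 ha))
      simp [this] at hb
    · rw [List.filter_append, List.filter_eq_self.2 hnp, List.filter_filter]
      simp
  · rintro ⟨l, hl, rfl⟩
    exact ⟨hl.1.filter _, fun a => by simp [hl.2.1, hp], hl.2.2.filter _⟩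

theorem promotionFix_forest [Finite α] (hF : IsRootedForest α) (w : List α) :
    promotionFix r (w.map some) = Nat.card {u // IsLinExtOn {y : α | ∀ k ∈ w, ¬ k ≤ y} u} := by
  classical
  have hD : IsLowerSet {y : α | ∀ k ∈ w, ¬ k ≤ y} := fun a b hba ha k hk hkb =>
    ha k hk (hkb.trans hba)
  rw [promotionFix_eq_card_filter hF w (fun y => decide (∀ k ∈ w, ¬ k ≤ y)) (by simp)]
  refine Nat.card_congr (Equiv.subtypeEquivRight fun u => ?_)
  rw [isLinExtOn_iff hD (p := fun y => decide (∀ k ∈ w, ¬ k ≤ y)) (by simp)]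

end Forest

end TreeShuffle


namespace TreeShuffle

/-! ### Maximal chains of upsets and linear extensions -/

section Flags

variable {α : Type u} [PartialOrder α]

theorem Before.trans {α : Type u} {l : List α} (hl : l.Nodup) {x y z : α} (h : Before l x y)
    (h' : Before l y z) : Before l x z := by
  induction l with
  | nil => exact absurd h not_before_nil
  | cons c l ih =>
    rw [List.nodup_cons] at hl
    rw [before_cons] at h h' ⊢
    rcases h' with ⟨rfl, -⟩ | h'
    · rcases h with ⟨-, h⟩ | h
      · exact absurd h hl.1
      · exact absurd h.mem_right hl.1
    · rcases h with ⟨rfl, -⟩ | h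
      · exact Or.inl ⟨rfl, h'.mem_right⟩
      · exact Or.inr (ih hl.2 h h')

theorem IsLinExtOn.before_of_lt {D : Set α} {u : List α} (hu : IsLinExtOn D u) {x y : α}
    (hx : x ∈ D) (hy : y ∈ D) (h : x < y) : Before u x y := by
  refine (before_total ((hu.2.1 x).2 hx) ((hu.2.1 y).2 hy) h.ne).resolve_right fun h1 => ?_
  exact (List.pairwise_iff_forall_sublist.1 hu.2.2) h1 h

variable {Y : UpperSet α}

/-- The interval of all upsets containing `Y`, ordered by inclusion. -/
abbrev UpsetsAbove (Y : UpperSet α) : Type u := Set.Icc (OrderDual.toDual Y) (⊤ : (UpperSet α)ᵒᵈ)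

namespace UpsetsAbove

/-- The elements of an upset. -/
def carrier (x : UpsetsAbove Y) : Set α := (OrderDual.ofDual x.1 : UpperSet α)

theorem le_iff {x y : UpsetsAbove Y} : x ≤ y ↔ x.carrier ⊆ y.carrier := Iff.rfl

theorem base_subset (x : UpsetsAbove Y) : (Y : Set α) ⊆ x.carrier := x.2.1

theorem isUpperSet (x : UpsetsAbove Y) : IsUpperSet x.carrier := UpperSet.upper _

theorem exists_carrier {s : Set α} (hs : IsUpperSet s) (hY : (Y : Set α) ⊆ s) :
    ∃ x : UpsetsAbove Y, x.carrier = s :=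
  ⟨⟨OrderDual.toDual ⟨s, hs⟩, hY, le_top⟩, rfl⟩

end UpsetsAbove

open UpsetsAbove

/-- The witness consists of `Y`, of `b`, and of all letters behind `b`. -/
theorem exists_carrier_of_word {u : List α} (hu : IsLinExtOn (Y : Set α)ᶜ u) {b : α}
    (hb : b ∈ u) : ∃ x : UpsetsAbove Y, (∀ c d, Before u c d → c ∈ x.carrier → d ∈ x.carrier) ∧
      b ∈ x.carrier ∧ ∀ a, Before u a b → a ∉ x.carrier := by
  obtain ⟨x, hx⟩ := exists_carrier (Y := Y) (s := {c | c ∈ Y ∨ c = b ∨ Before u b c}) (by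
    rintro c d hcd hc
    by_cases hdY : d ∈ Y
    · exact Or.inl hdY
    have hcY : c ∉ Y := fun h => hdY (Y.upper hcd h)
    rcases hcd.eq_or_lt with rfl | hlt
    · exact hc
    have h1 : Before u c d := hu.before_of_lt hcY hdY hlt
    rcases hc with hc | rfl | hc
    · exact absurd hc hcY
    · exact Or.inr (Or.inr h1)
    · exact Or.inr (Or.inr (hc.trans hu.1 h1))) (fun c hc => Or.inl hc)
  refine ⟨x, fun c d hcd hc => ?_, ?_, fun a ha h => ?_⟩
  · rw [hx] at hc ⊢
    rcases hc with hc | rfl | hc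
    · exact absurd hc ((hu.2.1 c).1 hcd.mem_left)
    · exact Or.inr (Or.inr hcd)
    · exact Or.inr (Or.inr (hc.trans hu.1 hcd))
  · rw [hx]; exact Or.inr (Or.inl rfl)
  · rw [hx] at h
    rcases h with h | rfl | h
    · exact (hu.2.1 a).1 ha.mem_left h
    · exact Before.irrefl hu.1 ha
    · exact ha.asymm hu.1 h

/-- The maximal chain of all upsets which consist of `Y` and a final segment of the word. -/
def flagOfWord {u : List α} (hu : IsLinExtOn (Y : Set α)ᶜ u) : Flag (UpsetsAbove Y) where
  carrier := {x | ∀ c d, Before u c d → c ∈ x.carrier → d ∈ x.carrier}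
  Chain' := by
    intro x hx x' hx' _
    by_contra! h
    obtain ⟨⟨a, hax, hax'⟩, ⟨b, hbx', hbx⟩⟩ := And.imp Set.not_subset.1 Set.not_subset.1 h
    have ha : a ∈ u := (hu.2.1 a).2 fun h => hax' (x'.base_subset h)
    have hb : b ∈ u := (hu.2.1 b).2 fun h => hbx (x.base_subset h)
    have hab : a ≠ b := by rintro rfl; exact hbx hax
    rcases before_total ha hb hab with h1 | h1
    · exact hbx (hx a b h1 hax)
    · exact hax' (hx' b a h1 hbx')
  max_chain' := by
    intro s hs hsub
    refine hsub.antisymm fun y hy a b hab ha => ?_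
    by_contra hb
    obtain ⟨x, hx, hbx, hax⟩ := exists_carrier_of_word hu hab.mem_right
    rcases hs.total hy (hsub hx) with h | h
    · exact hax a hab (h ha)
    · exact hb (h hbx)

theorem flagOfWord_injective {u v : List α} (hu : IsLinExtOn (Y : Set α)ᶜ u)
    (hv : IsLinExtOn (Y : Set α)ᶜ v) (h : flagOfWord hu = flagOfWord hv) : u = v := by
  have key : ∀ {u v : List α} (hu : IsLinExtOn (Y : Set α)ᶜ u) (hv : IsLinExtOn (Y : Set α)ᶜ v),
      flagOfWord hu = flagOfWord hv → ∀ a b, Before u a b → Before v a b := by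
    intro u v hu hv h a b hab
    have hne : a ≠ b := by rintro rfl; exact Before.irrefl hu.1 hab
    have hmem : ∀ {c}, c ∈ u → c ∈ v := fun {c} hc => (hv.2.1 c).2 ((hu.2.1 c).1 hc)
    refine (before_total (hmem hab.mem_left) (hmem hab.mem_right) hne).resolve_right fun h1 => ?_
    obtain ⟨x, hx, hbx, hax⟩ := exists_carrier_of_word hu hab.mem_right
    have hx' : x ∈ flagOfWord hv := h ▸ (show x ∈ flagOfWord hu from hx)
    exact hax a hab (hx' b a h1 hbx)
  refine eq_of_before hu.1 hv.1 (fun x => by rw [hu.2.1, hv.2.1]) fun a b =>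
    ⟨key hu hv h a b, key hv hu h.symm a b⟩

/-- The steps of a maximal chain of upsets add single elements. Otherwise a maximal element of the
added set could be added first, which would refine the chain. -/
theorem Flag.eq_of_forall_mem_iff [Finite α] (F : Flag (UpsetsAbove Y)) {a b : α} (ha : a ∉ Y)
    (h : ∀ x ∈ F, a ∈ x.carrier ↔ b ∈ x.carrier) (hb : b ∉ Y) : a = b := by
  obtain ⟨m, hmD, hmax⟩ := (Set.toFinite {c : α | ∀ x ∈ F, a ∈ x.carrier ↔ c ∈ x.carrier}).exists_maximal
    ⟨a, fun _ _ => Iff.rfl⟩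
  -- The union of the members of the chain that do not contain `a`, enlarged by `Y` and `m`;
  -- maximality of `m` makes it an upset.
  obtain ⟨z, hz⟩ := exists_carrier (Y := Y)
    (s := {c | c ∈ Y ∨ (∃ x ∈ F, a ∉ x.carrier ∧ c ∈ x.carrier) ∨ c = m}) (by
    rintro c d hcd (hc | ⟨x, hxF, hax, hc⟩ | rfl)
    · exact Or.inl (Y.upper hcd hc)
    · exact Or.inr (Or.inl ⟨x, hxF, hax, x.isUpperSet hcd hc⟩)
    · by_cases hdD : ∀ x ∈ F, a ∈ x.carrier ↔ d ∈ x.carrier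
      · exact Or.inr (Or.inr (le_antisymm (hmax hdD hcd) hcd))
      · push Not at hdD
        obtain ⟨x, hxF, hx | hx⟩ := hdD
        · exact absurd (x.isUpperSet hcd ((hmD x hxF).1 hx.1)) hx.2
        · exact Or.inr (Or.inl ⟨x, hxF, hx⟩)) (fun c hc => Or.inl hc)
  have hzF : z ∈ F := by
    rw [Flag.mem_iff_forall_le_or_ge]
    intro x hxF
    by_cases hax : a ∈ x.carrier
    · left
      rw [le_iff, hz]
      rintro c (hc | ⟨x', hx'F, hax', hc⟩ | rfl)
      · exact x.base_subset hc
      · rcases F.le_or_le hx'F hxF with h1 | h1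
        · exact h1 hc
        · exact absurd (h1 hax) hax'
      · exact (hmD x hxF).1 hax
    · right
      rw [le_iff, hz]
      exact fun c hc => Or.inr (Or.inl ⟨x, hxF, hax, hc⟩)
  have hmz : m ∈ z.carrier := by rw [hz]; exact Or.inr (Or.inr rfl)
  have haz := (hmD z hzF).2 hmz
  have hbz := (h z hzF).1 haz
  have key : ∀ c, c ∉ Y → (∀ x ∈ F, a ∈ x.carrier ↔ c ∈ x.carrier) → c ∈ z.carrier → c = m := by
    intro c hcY hc hcz
    rw [hz] at hcz
    rcases hcz with h1 | ⟨x, hxF, hax, h1⟩ | h1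
    · exact absurd h1 hcY
    · exact absurd ((hc x hxF).2 h1) hax
    · exact h1
  rw [key a ha (fun _ _ => Iff.rfl) haz, key b hb h hbz]

theorem exists_flagOfWord [Finite α] (F : Flag (UpsetsAbove Y)) :
    ∃ (u : List α) (hu : IsLinExtOn (Y : Set α)ᶜ u), flagOfWord hu = F := by
  classical
  have := Fintype.ofFinite α
  -- The word is obtained by sorting: letters which enter the chain later are put in front.
  let R : α → α → Prop := fun a b => ∀ x ∈ F, a ∈ x.carrier → b ∈ x.carrier
  have htrans : IsTrans α R := ⟨fun a b c h1 h2 x hx ha => h2 x hx (h1 x hx ha)⟩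
  have htotal : Std.Total R := ⟨fun a b => by
    by_contra! h
    obtain ⟨h1, h2⟩ := h
    simp only [R, not_forall] at h1 h2
    obtain ⟨x, hx, hax, hbx⟩ := h1
    obtain ⟨y, hy, hby, hay⟩ := h2
    rcases F.le_or_le hx hy with h | h
    · exact hay (h hax)
    · exact hbx (h hby)⟩
  set l := ((Finset.univ : Finset α).filter (fun a => a ∉ Y)).toList with hl
  set u := l.insertionSort R with hu
  have hperm : u.Perm l := List.perm_insertionSort R l
  have hsort : u.Pairwise R := List.pairwise_insertionSort R l
  have hmem : ∀ a, a ∈ u ↔ a ∈ (Y : Set α)ᶜ := fun a => by rw [hperm.mem_iff]; simp [hl]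
  have hnd : u.Nodup := hperm.nodup_iff.2 (Finset.nodup_toList _)
  have hlin : IsLinExtOn (Y : Set α)ᶜ u := by
    refine ⟨hnd, hmem, ?_⟩
    rw [pairwise_iff_before] at hsort ⊢
    intro a b hab hba
    refine hba.ne' (Flag.eq_of_forall_mem_iff F ((hmem a).1 hab.mem_left) (fun x hx =>
      ⟨hsort a b hab x hx, fun h => x.isUpperSet hba.le h⟩) ((hmem b).1 hab.mem_right))
  refine ⟨u, hlin, Flag.ext ?_⟩
  refine (F.max_chain' (flagOfWord hlin).Chain' fun x hx c d hcd hc => ?_).symm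
  exact pairwise_iff_before.1 hsort c d hcd x hx hc

theorem card_flag_upsetsAbove [Finite α] (Y : UpperSet α) :
    Nat.card (Flag (UpsetsAbove Y)) = Nat.card {u // IsLinExtOn (Y : Set α)ᶜ u} := by
  symm
  refine Nat.card_eq_of_bijective (fun u => flagOfWord u.2) ⟨fun u v h => ?_, fun F => ?_⟩
  · exact Subtype.ext (flagOfWord_injective u.2 v.2 h)
  · obtain ⟨u, hu, rfl⟩ := exists_flagOfWord F
    exact ⟨⟨u, hu⟩, rfl⟩

end Flags

/-! ### Derangement numbers -/

section Derangement

open scoped Classical in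
-- Möbius inversion: for fixed `y` the sum of `μ(x, y)` over `z ⪯ x ⪯ y` vanishes unless `y = z`.
theorem sum_derangementNumber {Λ : Type u} [PartialOrder Λ] [OrderTop Λ] [Fintype Λ] (z : Λ) :
    ∑ x : Λ with z ≤ x, derangementNumber x = Nat.card (Flag (Set.Icc z (⊤ : Λ))) := by
  let : LocallyFiniteOrder Λ := Fintype.toLocallyFiniteOrder
  have hd : ∀ x : Λ, derangementNumber x = ∑ y : Λ with x ≤ y,
      IncidenceAlgebra.mu ℤ x y * (Nat.card (Flag (Set.Icc y (⊤ : Λ))) : ℤ) := by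
    intro x
    unfold derangementNumber
    -- Only the chosen finiteness instances differ.
    convert rfl
  simp only [hd, Finset.sum_filter]
  have hswap : ∀ y, (∑ x : Λ, if z ≤ x then (if x ≤ y then
      IncidenceAlgebra.mu ℤ x y * (Nat.card (Flag (Set.Icc y (⊤ : Λ))) : ℤ) else 0) else 0) =
      if z = y then (Nat.card (Flag (Set.Icc y (⊤ : Λ))) : ℤ) else 0 := by
    intro y
    have h1 := IncidenceAlgebra.sum_Icc_mu_left (𝕜 := ℤ) z y
    have h2 : (∑ x : Λ, if z ≤ x then (if x ≤ y then
        IncidenceAlgebra.mu ℤ x y * (Nat.card (Flag (Set.Icc y (⊤ : Λ))) : ℤ) else 0) else 0) =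
        (∑ x ∈ Finset.Icc z y, IncidenceAlgebra.mu ℤ x y) *
          (Nat.card (Flag (Set.Icc y (⊤ : Λ))) : ℤ) := by
      rw [Finset.sum_mul, ← Finset.sum_filter, ← Finset.sum_filter, Finset.filter_filter]
      refine Finset.sum_congr ?_ fun _ _ => rfl
      ext x
      simp
    rw [h2, h1]
    split_ifs <;> simp
  have hpush : ∀ (p : Prop) (g : Λ → ℤ), (if p then ∑ y, g y else 0) =
      ∑ y, if p then g y else 0 := by
    intro p g
    split_ifs <;> simp
  simp only [hpush]
  rw [Finset.sum_comm]
  simp only [hswap]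
  rw [Finset.sum_ite_eq, if_pos (Finset.mem_univ _)]

/-- The product is the indicator of the upsets containing the upset `Y` generated by `w`. Hence the
sum is that of the derangement numbers above `Y`, which counts the linear extensions of the
complement of `Y`. -/
theorem promotionFix_eq_sum {α : Type u} [r : PartialOrder α] [Finite α] [Fintype (UpperSet α)]
    (hF : IsRootedForest α) (w : List α) : open scoped Classical in
    (promotionFix r (w.map some) : ℤ) =
      ∑ S : UpperSet α, upsetDerangement S * (w.map fun k => if k ∈ S then 1 else 0).prod := by
  classical
  let Y : UpperSet α := upperClosure {k | k ∈ w}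
  have hY : {y : α | ∀ k ∈ w, ¬ k ≤ y} = (Y : Set α)ᶜ := by
    ext y
    simp [Y]
  have hprod : ∀ S : UpperSet α, (w.map fun k => if k ∈ S then (1 : ℤ) else 0).prod =
      if OrderDual.toDual Y ≤ OrderDual.toDual S then 1 else 0 := by
    intro S
    have h1 : OrderDual.toDual Y ≤ OrderDual.toDual S ↔ ∀ k ∈ w, k ∈ S := by
      rw [OrderDual.toDual_le_toDual, le_upperClosure]
      rfl
    split_ifs with h
    · refine List.prod_eq_one fun x hx => ?_
      obtain ⟨k, hk, rfl⟩ := List.mem_map.1 hx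
      rw [if_pos (h1.1 h k hk)]
    · rw [h1] at h
      push Not at h
      obtain ⟨k, hk, hkS⟩ := h
      exact List.prod_eq_zero (List.mem_map.2 ⟨k, hk, by rw [if_neg hkS]⟩)
  have hsum := sum_derangementNumber (OrderDual.toDual Y)
  rw [promotionFix_forest hF, hY, ← card_flag_upsetsAbove, ← hsum, Finset.sum_filter]
  refine Fintype.sum_equiv OrderDual.ofDual _ _ fun x => ?_
  rw [hprod, mul_ite, mul_one, mul_zero]
  rfl

/-! ### Nonnegativity of the derangement numbers -/

theorem exists_injective_sums (α : Type u) [Fintype α] [DecidableEq α] :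
    ∃ x : α → ℕ, Function.Injective fun s : Finset α => ∑ a ∈ s, x a := by
  let e := Fintype.equivFin α
  refine ⟨fun a => 2 ^ (e a : ℕ), fun s t h => ?_⟩
  have hinj : Function.Injective fun a : α => (e a : ℕ) :=
    Fin.val_injective.comp e.injective
  have hs : ∀ s : Finset α, ∑ a ∈ s, 2 ^ (e a : ℕ) =
      Finset.equivBitIndices.symm (s.map ⟨fun a : α => (e a : ℕ), hinj⟩) := by
    intro s
    simp [Finset.equivBitIndices]
  simp only [hs] at h
  exact Finset.map_injective _ (Finset.equivBitIndices.symm.injective h)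

/-- For forests these numbers are multiplicities of eigenvalues. With powers of two as weights,
different upsets have different eigenvalues, so no cancellation can occur. -/
theorem upsetDerangement_nonneg {α : Type u} [r : PartialOrder α] [Finite α]
    (hF : IsRootedForest α) (S : UpperSet α) : 0 ≤ upsetDerangement S := by
  classical
  have := Fintype.ofFinite α
  have := Fintype.ofFinite (LinExt r)
  have := Fintype.ofFinite (UpperSet α)
  by_contra! hneg
  obtain ⟨x, hx⟩ := exists_injective_sums α
  let c : UpperSet α → α → ℤ := fun S k => if k ∈ S then 1 else 0
  let ev : UpperSet α → ℂ := fun S => ∑ k, (x k : ℂ) * (c S k : ℂ)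
  have hev : Function.Injective ev := by
    intro S S' h
    have h1 : ∀ S : UpperSet α, ev S = ((∑ k ∈ (Finset.univ.filter fun k => k ∈ S), x k : ℕ) : ℂ) := by
      intro S
      rw [Finset.sum_filter]
      push_cast
      refine Finset.sum_congr rfl fun k _ => ?_
      by_cases hk : k ∈ S <;> simp [c, hk]
    rw [h1, h1, Nat.cast_inj] at h
    have h2 := hx h
    ext k
    simpa using congrArg (k ∈ ·) h2
  let M : Matrix (LinExt r) (LinExt r) ℂ :=
    ∑ k, (x k : ℂ) • mapMatrix ℂ (promote r (some k))
  have htr : ∀ m : ℕ, (M ^ m).trace = ∑ S, (upsetDerangement S : ℂ) * ev S ^ m := by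
    intro m
    refine trace_pow_of_trace_words (fun k => mapMatrix ℂ (promote r (some k)))
      (fun S k => (c S k : ℂ)) (fun S => (upsetDerangement S : ℂ)) (fun W => ?_)
      (fun k => (x k : ℂ)) m
    rw [trace_prod_mapMatrix (fun k => promote r (some k)) W]
    have h1 := promotionFix_eq_sum hF W
    have h2 := congrArg (Int.cast : ℤ → ℂ) h1
    simp only [promotionFix, List.foldl_map] at h2
    rw [Int.cast_natCast] at h2
    rw [h2, Int.cast_sum]
    refine Finset.sum_congr rfl fun S _ => ?_
    rw [Int.cast_mul, Int.cast_list_prod, List.map_map]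
    rfl
  let P : Multiset ℂ := ∑ S, (upsetDerangement S).toNat • {ev S}
  let N : Multiset ℂ := ∑ S, (-upsetDerangement S).toNat • {ev S}
  have hsum : ∀ (g : UpperSet α → ℕ) (m : ℕ),
      ((∑ S, g S • ({ev S} : Multiset ℂ)).map (· ^ m)).sum = ∑ S, (g S : ℂ) * ev S ^ m := by
    intro g m
    rw [← Multiset.coe_mapAddMonoidHom, map_sum, ← Multiset.coe_sumAddMonoidHom, map_sum]
    refine Finset.sum_congr rfl fun S _ => ?_
    simp [Multiset.map_nsmul, Multiset.sum_nsmul]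
  -- Power sums compare honest multisets only, so the negative weights are moved to the other side.
  have hPN : M.charpoly.roots + N = P := by
    refine multiset_eq_of_power_sums fun m => ?_
    rw [Multiset.map_add, Multiset.sum_add, ← trace_pow_eq_sum_roots, htr, hsum, hsum,
      ← Finset.sum_add_distrib]
    refine Finset.sum_congr rfl fun S _ => ?_
    rw [← add_mul]
    congr 1
    have : upsetDerangement S + ((-upsetDerangement S).toNat : ℤ) =
        ((upsetDerangement S).toNat : ℤ) := by omega
    exact_mod_cast congrArg (Int.cast : ℤ → ℂ) this
  have hcount : ∀ g : UpperSet α → ℕ,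
      (∑ S, g S • ({ev S} : Multiset ℂ)).count (ev S) = g S := by
    intro g
    rw [Multiset.count_sum']
    rw [Finset.sum_eq_single S]
    · simp
    · intro S' _ hS'
      have : ev S ≠ ev S' := fun h => hS' (hev h).symm
      simp [this]
    · simp
  have h1 := congrArg (Multiset.count (ev S)) hPN
  rw [Multiset.count_add, hcount, hcount] at h1
  omega

end Derangement

end TreeShuffle


namespace TreeShuffle

/-! ### Permutations with prescribed orbits -/

section Orbits

open Equiv

/-- The transitive cyclic actions are the full cycles. Sets with fewer than two elements are
separate, as fixed points do not appear in cycle types. -/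
theorem card_transitive_perm {β : Type*} [Fintype β] [Nonempty β] :
    Nat.card {τ : Perm β // ∀ x y, τ.SameCycle x y} = (Fintype.card β - 1).factorial := by
  classical
  rcases Nat.lt_or_ge (Fintype.card β) 2 with h | h
  · have : Subsingleton β := Fintype.card_le_one_iff_subsingleton.1 (by omega)
    have h1 : Fintype.card β - 1 = 0 := by omega
    rw [h1, Nat.factorial_zero, Nat.card_eq_one_iff_unique]
    exact ⟨inferInstance, ⟨1, fun x y => by rw [Subsingleton.elim x y]⟩⟩
  · have h1 := Equiv.Perm.card_of_cycleType_singleton h (le_refl (Fintype.card β))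
    rw [Nat.choose_self, mul_one] at h1
    rw [← h1, Nat.card_eq_fintype_card, Fintype.card_subtype]
    congr 1
    ext τ
    simp only [Finset.mem_filter_univ]
    constructor
    · intro hτ
      have hne : ∀ x, τ x ≠ x := by
        intro x hx
        have : Nontrivial β := Fintype.one_lt_card_iff_nontrivial.1 h
        obtain ⟨y, hy⟩ := exists_ne x
        obtain ⟨n, hn⟩ := hτ x y
        rw [Perm.zpow_apply_eq_self_of_apply_eq_self hx] at hn
        exact hy hn.symm
      obtain ⟨x⟩ := ‹Nonempty β›
      have hc : τ.IsCycle := ⟨x, hne x, fun y _ => hτ x y⟩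
      have hs : τ.support = Finset.univ := by ext y; simp [hne y]
      rw [hc.cycleType, hs, Finset.card_univ]
    · intro hτ x y
      have hc : τ.IsCycle := by rw [← Perm.card_cycleType_eq_one, hτ]; simp
      have hs : τ.support = Finset.univ := by
        rw [← Finset.card_eq_iff_eq_univ, ← Perm.sum_cycleType, hτ]; simp
      refine hc.sameCycle ?_ ?_ <;> rw [← Perm.mem_support, hs] <;> exact Finset.mem_univ _

/-- Permutations of the fibres of a map, put together. -/
def fibrePerm {α ι : Type*} (f : α → ι) (τ : ∀ i, Perm {a // f a = i}) : Perm α where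
  toFun x := (τ (f x) ⟨x, rfl⟩).1
  invFun x := ((τ (f x)).symm ⟨x, rfl⟩).1
  left_inv x := by
    have : ∀ i (y : {a // f a = i}), ((τ (f y.1)).symm ⟨y.1, rfl⟩).1 = ((τ i).symm y).1 := by
      rintro i ⟨y, rfl⟩; rfl
    exact (this (f x) _).trans (by rw [Equiv.symm_apply_apply])
  right_inv x := by
    have : ∀ i (y : {a // f a = i}), (τ (f y.1) ⟨y.1, rfl⟩).1 = (τ i y).1 := by
      rintro i ⟨y, rfl⟩; rfl
    exact (this (f x) _).trans (by rw [Equiv.apply_symm_apply])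

theorem fibrePerm_apply {α ι : Type*} (f : α → ι) (τ : ∀ i, Perm {a // f a = i}) {i : ι}
    (y : {a // f a = i}) : fibrePerm f τ y.1 = (τ i y).1 := by
  obtain ⟨y, rfl⟩ := y; rfl

theorem fibrePerm_pow_apply {α ι : Type*} (f : α → ι) (τ : ∀ i, Perm {a // f a = i}) {i : ι}
    (y : {a // f a = i}) (n : ℕ) : (fibrePerm f τ ^ n) y.1 = ((τ i ^ n) y).1 := by
  induction n with
  | zero => rfl
  | succ n ih => rw [pow_succ', Perm.mul_apply, ih, fibrePerm_apply, pow_succ', Perm.mul_apply]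

/-- A permutation whose orbits are the fibres is an independent choice of a full cycle on each
fibre. -/
theorem card_perm_of_orbits {α ι : Type*} [Finite α] [Fintype ι] (f : α → ι)
    (hf : Function.Surjective f) :
    Nat.card {σ : Perm α // ∀ x y, σ.SameCycle x y ↔ f x = f y} =
      ∏ i, (Nat.card {a // f a = i} - 1).factorial := by
  classical
  have := Fintype.ofFinite α
  have h1 : ∀ i, (Nat.card {a // f a = i} - 1).factorial =
      Nat.card {τ : Perm {a // f a = i} // ∀ x y, τ.SameCycle x y} := by
    intro i
    obtain ⟨a, ha⟩ := hf i
    have : Nonempty {a // f a = i} := ⟨⟨a, ha⟩⟩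
    rw [card_transitive_perm, Nat.card_eq_fintype_card]
  simp only [h1]
  rw [← Nat.card_pi]
  symm
  refine Nat.card_eq_of_bijective (fun τ => ⟨fibrePerm f fun i => (τ i).1, fun x y => ?_⟩)
    ⟨fun τ τ' h => ?_, fun σ => ?_⟩
  · constructor
    · intro h
      obtain ⟨n, -, rfl⟩ := h.exists_pow_eq'
      have := fibrePerm_pow_apply f (fun i => (τ i).1) (⟨x, rfl⟩ : {a // f a = f x}) n
      simp only at this
      rw [this]
      exact ((((τ (f x)).1 ^ n) ⟨x, rfl⟩).2).symm
    · intro h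
      obtain ⟨n, -, hn⟩ := ((τ (f x)).2 ⟨x, rfl⟩ ⟨y, h.symm⟩).exists_pow_eq'
      refine ⟨n, ?_⟩
      rw [zpow_natCast]
      have := fibrePerm_pow_apply f (fun i => (τ i).1) (⟨x, rfl⟩ : {a // f a = f x}) n
      simp only at this
      rw [this, hn]
  · funext i
    refine Subtype.ext (Equiv.ext fun y => Subtype.ext ?_)
    have := Equiv.congr_fun (congrArg Subtype.val h) y.1
    simpa only [fibrePerm_apply] using this
  · have hσ : ∀ x, f (σ.1 x) = f x := fun x => ((σ.2 x (σ.1 x)).1 ⟨1, by simp⟩).symm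
    have hpow : ∀ i (x y : {a // f a = i}),
        (σ.1.subtypePerm (p := fun a => f a = i) (fun a => by rw [hσ])).SameCycle x y := by
      intro i x y
      obtain ⟨n, -, hn⟩ := ((σ.2 x.1 y.1).2 (x.2.trans y.2.symm)).exists_pow_eq'
      refine ⟨n, Subtype.ext ?_⟩
      rw [zpow_natCast, Perm.subtypePerm_pow]
      exact hn
    refine ⟨fun i => ⟨σ.1.subtypePerm (p := fun a => f a = i) (fun a => by rw [hσ]), hpow i⟩, ?_⟩
    exact Subtype.ext (Equiv.ext fun x => rfl)

theorem card_perm_of_finpartition {α : Type*} [Fintype α] [DecidableEq α]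
    (p : Finpartition (Finset.univ : Finset α)) :
    Nat.card {σ : Perm α // ∀ x y, σ.SameCycle x y ↔ p.part x = p.part y} =
      ∏ B ∈ p.parts, (B.card - 1).factorial := by
  let f : α → {B // B ∈ p.parts} := fun x => ⟨p.part x, p.part_mem.2 (Finset.mem_univ x)⟩
  have hf : Function.Surjective f := by
    rintro ⟨B, hB⟩
    obtain ⟨x, hx⟩ := p.nonempty_of_mem_parts hB
    exact ⟨x, Subtype.ext (p.part_eq_of_mem hB hx)⟩
  have h := card_perm_of_orbits f hf
  simp only [f, Subtype.mk.injEq] at h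
  rw [h]
  refine Eq.trans ?_ (Finset.prod_coe_sort p.parts fun B => (B.card - 1).factorial)
  refine Finset.prod_congr rfl fun B _ => ?_
  congr 2
  refine Nat.subtype_card B.1 fun x => ?_
  rw [Subtype.ext_iff]
  exact (p.part_eq_iff_mem B.2).symm

open scoped Classical in
/-- The number of permutations which preserve the fibres of a map, by their orbits. -/
theorem sum_finpartition_prod_factorial {α κ : Type*} [Fintype α] [DecidableEq α] (f : α → κ)
    [Fintype (Finpartition (Finset.univ : Finset α))] :
    (∑ p : Finpartition (Finset.univ : Finset α),
      if ∀ x y, p.part x = p.part y → f x = f y then ∏ B ∈ p.parts, (B.card - 1).factorial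
      else 0) = Nat.card {σ : Perm α // ∀ x, f (σ x) = f x} := by
  rw [← Finset.sum_filter]
  simp only [← card_perm_of_finpartition]
  rw [← Finset.sum_coe_sort, ← Nat.card_sigma]
  have hcyc : ∀ σ : Perm α, (∀ x, f (σ x) = f x) → ∀ {x y}, σ.SameCycle x y → f x = f y := by
    intro σ hσ x y h
    obtain ⟨n, -, rfl⟩ := h.exists_pow_eq'
    clear h
    induction n with
    | zero => rfl
    | succ n ih => rw [pow_succ', Perm.mul_apply, hσ]; exact ih
  refine Nat.card_eq_of_bijective (fun q => ⟨q.2.1, fun x => ?_⟩) ⟨?_, fun σ => ?_⟩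
  · exact ((Finset.mem_filter.1 q.1.2).2 x (q.2.1 x) ((q.2.2 x _).1 ⟨1, by simp⟩)).symm
  · rintro ⟨⟨p, hp⟩, σ, hσ⟩ ⟨⟨q, hq⟩, τ, hτ⟩ h
    obtain rfl : σ = τ := congrArg Subtype.val h
    obtain rfl : p = q := by
      have hpart : ∀ x, p.part x = q.part x := by
        intro x
        ext y
        rw [p.mem_part_iff_part_eq_part (Finset.mem_univ y) (Finset.mem_univ x),
          q.mem_part_iff_part_eq_part (Finset.mem_univ y) (Finset.mem_univ x), ← hσ, hτ]
      ext B
      constructor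
      · intro hB
        obtain ⟨x, hx⟩ := p.nonempty_of_mem_parts hB
        rw [← p.part_eq_of_mem hB hx, hpart, q.part_mem]
        exact Finset.mem_univ x
      · intro hB
        obtain ⟨x, hx⟩ := q.nonempty_of_mem_parts hB
        rw [← q.part_eq_of_mem hB hx, ← hpart, p.part_mem]
        exact Finset.mem_univ x
    rfl
  · let p := Finpartition.ofSetoid (Perm.SameCycle.setoid σ.1)
    have hp : ∀ x y, σ.1.SameCycle x y ↔ p.part x = p.part y := by
      intro x y
      rw [← p.mem_part_iff_part_eq_part (Finset.mem_univ x) (Finset.mem_univ y),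
        Finpartition.mem_part_ofSetoid_iff_rel]
      exact ⟨fun h => h.symm, fun h => h.symm⟩
    refine ⟨⟨⟨p, ?_⟩, σ.1, hp⟩, rfl⟩
    rw [Finset.mem_filter]
    exact ⟨Finset.mem_univ _, fun x y h => hcyc σ.1 σ.2 ((hp x y).2 h)⟩

end Orbits

/-! ### Words of pop shuffles -/

section PopShuffle

variable {α : Type u}

/-- The letters in `B` are moved to the end of the word. -/
noncomputable def moveBack {r : PartialOrder α} (hr : r = discreteOrder α) (B : Set α)
    (l : LinExt r) : LinExt r :=
  ⟨popShuffle [Bᶜ, B] l.1, isLinExt_popShuffle hr l.2 B⟩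

theorem before_filter_iff {l : List α} {p : α → Bool} {x y : α} :
    Before (l.filter p) x y ↔ p x ∧ p y ∧ Before l x y := by
  constructor
  · intro h
    have hx := List.of_mem_filter h.mem_left
    have hy := List.of_mem_filter h.mem_right
    exact ⟨hx, hy, (before_filter hx hy).1 h⟩
  · rintro ⟨hx, hy, h⟩
    exact (before_filter hx hy).2 h

theorem before_moveBack {r : PartialOrder α} (hr : r = discreteOrder α) (B : Set α)
    (l : LinExt r) (x y : α) : Before (moveBack hr B l).1 x y ↔
      (x ∉ B ∧ y ∈ B) ∨ ((x ∈ B ↔ y ∈ B) ∧ Before l.1 x y) := by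
  have hx := l.2.2.1 x
  have hy := l.2.2.1 y
  simp only [moveBack, popShuffle, List.flatMap_cons, List.flatMap_nil, List.append_nil,
    before_append, before_filter_iff, List.mem_filter, hx, hy, true_and, decide_eq_true_eq,
    Set.mem_compl_iff]
  tauto

theorem before_moveBack_foldl_of_same {r : PartialOrder α} (hr : r = discreteOrder α)
    (w : List (Set α)) (l : LinExt r) {x y : α} (h : ∀ B ∈ w, x ∈ B ↔ y ∈ B) :
    Before (w.foldl (fun l B => moveBack hr B l) l).1 x y ↔ Before l.1 x y := by
  induction w generalizing l with
  | nil => rfl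
  | cons B w ih =>
    have hB := h B (by simp)
    rw [List.foldl_cons, ih _ fun B' hB' => h B' (by simp [hB']), before_moveBack]
    tauto

/-- The last set separating `x` from `y` decides their order, whatever the initial word was. The
outcome depends only on the sets containing each of the two letters. -/
theorem before_moveBack_foldl_of_not_same {r : PartialOrder α} (hr : r = discreteOrder α)
    (w : List (Set α)) (l m : LinExt r) {x y x' y' : α} (h : ¬ ∀ B ∈ w, x ∈ B ↔ y ∈ B)
    (hx : ∀ B ∈ w, x ∈ B ↔ x' ∈ B) (hy : ∀ B ∈ w, y ∈ B ↔ y' ∈ B) :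
    Before (w.foldl (fun l B => moveBack hr B l) l).1 x y ↔
      Before (w.foldl (fun l B => moveBack hr B l) m).1 x' y' := by
  induction w generalizing l m with
  | nil => simp at h
  | cons B w ih =>
    have hxB := hx B (by simp)
    have hyB := hy B (by simp)
    have hxw : ∀ B ∈ w, x ∈ B ↔ x' ∈ B := fun B' hB' => hx B' (by simp [hB'])
    have hyw : ∀ B ∈ w, y ∈ B ↔ y' ∈ B := fun B' hB' => hy B' (by simp [hB'])
    rw [List.foldl_cons, List.foldl_cons]
    by_cases hw : ∀ B ∈ w, x ∈ B ↔ y ∈ B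
    · have hB : ¬ (x ∈ B ↔ y ∈ B) := fun hB => h fun B' hB' => by
        rcases List.mem_cons.1 hB' with rfl | h'
        · exact hB
        · exact hw B' h'
      have hw' : ∀ B ∈ w, x' ∈ B ↔ y' ∈ B := fun B' hB' => by
        rw [← hxw B' hB', ← hyw B' hB', hw B' hB']
      rw [before_moveBack_foldl_of_same hr w _ hw, before_moveBack_foldl_of_same hr w _ hw',
        before_moveBack, before_moveBack]
      tauto
    · exact ih _ _ hw hxw hyw

theorem before_map {l : List α} (σ : Equiv.Perm α) {x y : α} :
    Before (l.map σ) (σ x) (σ y) ↔ Before l x y := by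
  induction l with
  | nil => simp [not_before_nil]
  | cons c l ih =>
    rw [List.map_cons, before_cons, before_cons, ih, σ.injective.eq_iff, List.mem_map_of_injective
      σ.injective]

theorem isLinExt_map_discrete {r : PartialOrder α} (hr : r = discreteOrder α) {l : List α}
    (hl : IsLinExt r l) (σ : Equiv.Perm α) : IsLinExt r (l.map σ) := by
  subst hr
  refine ⟨hl.1.map σ.injective, fun a => ?_, List.pairwise_of_forall fun a b hlt => ?_⟩
  · rw [List.mem_map]
    exact ⟨σ.symm a, hl.2.1 _, σ.apply_symm_apply a⟩
  · have := ((discreteOrder α).lt_iff_le_not_ge b a).1 hlt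
    exact this.2 (Eq.symm this.1)

theorem exists_perm_map_eq {l m : List α} (hl : l.Nodup) (hm : m.Nodup) (hl' : ∀ a, a ∈ l)
    (hm' : ∀ a, a ∈ m) : ∃ σ : Equiv.Perm α, l.map σ = m := by
  classical
  have hlen : l.length = m.length :=
    ((List.perm_ext_iff_of_nodup hl hm).2 fun a => iff_of_true (hl' a) (hm' a)).length_eq
  refine ⟨(hl.getEquivOfForallMemList l hl').symm.trans
    ((finCongr hlen).trans (hm.getEquivOfForallMemList m hm')), ?_⟩
  refine List.ext_getElem (by simpa using hlen) fun i h1 h2 => ?_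
  have h3 : i < l.length := by simpa using h1
  rw [List.getElem_map]
  have : (hl.getEquivOfForallMemList l hl').symm l[i] = ⟨i, h3⟩ := by
    rw [Equiv.symm_apply_eq]; rfl
  simp only [Equiv.trans_apply, this]
  rfl

/-- The number of words which are fixed by a word of shuffles. -/
theorem card_fixed_moveBack {r : PartialOrder α} (hr : r = discreteOrder α) [Finite α]
    (w : List (Set α)) :
    Nat.card {l : LinExt r // w.foldl (fun l B => moveBack hr B l) l = l} =
      Nat.card {σ : Equiv.Perm α // ∀ x, ∀ B ∈ w, σ x ∈ B ↔ x ∈ B} := by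
  obtain ⟨l₀, hl₀⟩ := exists_isLinExt (r := r)
  -- The image of an arbitrary word has the order of separated letters that every fixed word must
  -- have. The fixed words are its rearrangements within the classes of letters that no set
  -- separates.
  set π := w.foldl (fun l B => moveBack hr B l) ⟨l₀, hl₀⟩ with hπ
  have hnot : ∀ (l : LinExt r) {x y x' y' : α}, (¬ ∀ B ∈ w, x ∈ B ↔ y ∈ B) →
      (∀ B ∈ w, x ∈ B ↔ x' ∈ B) → (∀ B ∈ w, y ∈ B ↔ y' ∈ B) →
      (Before (w.foldl (fun l B => moveBack hr B l) l).1 x y ↔ Before π.1 x' y') :=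
    fun l x y x' y' h hx hy => before_moveBack_foldl_of_not_same hr w l _ h hx hy
  have hfix : ∀ l : LinExt r, w.foldl (fun l B => moveBack hr B l) l = l ↔
      ∀ x y, (¬ ∀ B ∈ w, x ∈ B ↔ y ∈ B) → (Before l.1 x y ↔ Before π.1 x y) := by
    intro l
    constructor
    · intro h x y hxy
      have := hnot l hxy (fun _ _ => Iff.rfl) (fun _ _ => Iff.rfl)
      rwa [h] at this
    · intro h
      have hw := (w.foldl (fun l B => moveBack hr B l) l).2
      refine Subtype.ext (eq_of_before hw.1 l.2.1
        (fun x => iff_of_true (hw.2.1 x) (l.2.2.1 x)) fun x y => ?_)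
      by_cases hxy : ∀ B ∈ w, x ∈ B ↔ y ∈ B
      · exact before_moveBack_foldl_of_same hr w l hxy
      · exact (hnot l hxy (fun _ _ => Iff.rfl) (fun _ _ => Iff.rfl)).trans (h x y hxy).symm
  have hππ : ∀ {x y x' y' : α}, (¬ ∀ B ∈ w, x ∈ B ↔ y ∈ B) → (∀ B ∈ w, x ∈ B ↔ x' ∈ B) →
      (∀ B ∈ w, y ∈ B ↔ y' ∈ B) → (Before π.1 x y ↔ Before π.1 x' y') :=
    fun h hx hy => hnot ⟨l₀, hl₀⟩ h hx hy
  symm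
  refine Nat.card_eq_of_bijective
    (fun σ => ⟨⟨π.1.map σ.1, isLinExt_map_discrete hr π.2 σ.1⟩, (hfix _).2 fun x y hxy => ?_⟩)
    ⟨fun σ τ h => ?_, fun l => ?_⟩
  · have h1 := before_map (l := π.1) σ.1 (x := σ.1.symm x) (y := σ.1.symm y)
    rw [σ.1.apply_symm_apply, σ.1.apply_symm_apply] at h1
    have h2 : ∀ x, ∀ B ∈ w, x ∈ B ↔ σ.1.symm x ∈ B := fun x B hB => by
      have := σ.2 (σ.1.symm x) B hB
      rwa [σ.1.apply_symm_apply] at this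
    exact h1.trans (hππ hxy (h2 x) (h2 y)).symm
  · have h1 : π.1.map σ.1 = π.1.map τ.1 := congrArg (fun l => l.1.1) h
    rw [List.map_inj_left] at h1
    exact Subtype.ext (Equiv.ext fun x => h1 x (π.2.2.1 x))
  · obtain ⟨σ, hσ⟩ := exists_perm_map_eq π.2.1 l.1.2.1 π.2.2.1 l.1.2.2.1
    let cls : α → Set (Set α) := fun x => {B | B ∈ w ∧ x ∈ B}
    have hcls : ∀ x y, cls x = cls y ↔ ∀ B ∈ w, x ∈ B ↔ y ∈ B := by
      intro x y
      rw [Set.ext_iff]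
      refine forall_congr' fun B => ?_
      simp only [cls, Set.mem_ofPred_eq]
      tauto
    -- The order of the classes in `π`. It is antisymmetric because the order of separated letters
    -- depends only on their classes; so a fixed word and `π` have the same word of classes.
    let R : Set (Set α) → Set (Set α) → Prop := fun K K' => K = K' ∨
      ∃ x y, cls x = K ∧ cls y = K' ∧ K ≠ K' ∧ Before π.1 x y
    have hR : ∀ m : List α, (∀ x y, (¬ ∀ B ∈ w, x ∈ B ↔ y ∈ B) →
        (Before m x y ↔ Before π.1 x y)) → (m.map cls).Pairwise R := by
      intro m hm
      rw [List.pairwise_map, pairwise_iff_before]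
      intro x y hxy
      by_cases h : cls x = cls y
      · exact Or.inl h
      · exact Or.inr ⟨x, y, rfl, rfl, h, (hm x y (by rwa [← hcls])).1 hxy⟩
    have hperm : (π.1.map cls).Perm (l.1.1.map cls) :=
      ((List.perm_ext_iff_of_nodup π.2.1 l.1.2.1).2 fun a =>
        iff_of_true (π.2.2.1 a) (l.1.2.2.1 a)).map cls
    have heq : π.1.map cls = l.1.1.map cls := by
      refine hperm.eq_of_pairwise (le := R) ?_ (hR _ fun _ _ _ => Iff.rfl)
        (hR _ ((hfix l.1).1 l.2))
      rintro K K' - - (h | ⟨x, y, rfl, rfl, hne, hxy⟩) (h' | ⟨y', x', hy', hx', -, hyx⟩)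
      · exact h
      · exact h
      · exact h'.symm
      · rw [Ne, hcls] at hne
        rw [hcls] at hx' hy'
        exact absurd ((hππ hne (fun B hB => (hx' B hB).symm) fun B hB => (hy' B hB).symm).1 hxy)
          (hyx.asymm π.2.1)
    rw [← hσ, List.map_map, List.map_inj_left] at heq
    refine ⟨⟨σ, fun x => ?_⟩, Subtype.ext (Subtype.ext hσ)⟩
    exact (hcls _ _).1 (heq x (π.2.2.1 x)).symm

end PopShuffle

end TreeShuffle


namespace TreeShuffle

section Tree

variable {T : RootedTree.{u}}

/-! ### Siblings, leaves and moves in the tree -/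

theorem covBy_unique {v v' w : T} (h : v ⋖ w) (h' : v' ⋖ w) : v = v' := by
  rw [← Order.pred_eq_of_covBy h, ← Order.pred_eq_of_covBy h']

theorem le_of_lt_of_covBy {v w x : T} (h : v ⋖ w) (hx : x < w) : x ≤ v := by
  rw [← Order.pred_eq_of_covBy h]
  exact Order.le_pred_of_lt hx

theorem depth_lt [Finite T] {v w : T} (h : v < w) : depth v < depth w :=
  Set.ncard_lt_ncard (Set.Iio_ssubset_Iio h) (Set.toFinite _)

theorem depth_child [Finite T] {v w : T} (h : v ⋖ w) : depth w = depth v + 1 := by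
  have : Set.Iio w = insert v (Set.Iio v) := by
    ext x
    simp only [Set.mem_Iio, Set.mem_insert_iff]
    constructor
    · intro hx
      exact (le_of_lt_of_covBy h hx).eq_or_lt
    · rintro (rfl | hx)
      · exact h.lt
      · exact hx.trans h.lt
  unfold depth
  rw [this, Set.ncard_insert_of_notMem (by simp) (Set.toFinite _)]

variable [Finite T] {d : ℕ}

/-- A child of a bottom node has depth `d`, and a leaf strictly above it would be deeper. -/
theorem isMax_child (hT : ∀ v : T, IsMax v → depth v = d) (v : BottomNode T d)
    (k : Child v.1) : IsMax k.1 := by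
  obtain ⟨e, hke, he⟩ := Finite.exists_le_maximal (p := fun _ : T => True) (a := k.1) trivial
  have hem : IsMax e := fun x hx => he.2 trivial hx
  have h1 := hT e hem
  have h2 := depth_child k.2
  have h3 := v.2.2
  rcases hke.eq_or_lt with rfl | hlt
  · exact hem
  · have := depth_lt hlt
    omega

theorem mem_relatedChildren_iff (hT : ∀ v : T, IsMax v → depth v = d) (v : BottomNode T d)
    (E : MoveSet T) (k : Child v.1) : k ∈ relatedChildren E v.1 ↔ k.1 ∈ E.1 := by
  constructor
  · rintro ⟨e, he, hke⟩
    rwa [(isMax_child hT v k).eq_of_le hke]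
  · exact fun h => ⟨k.1, h, le_rfl⟩

theorem MoveSet.eq_of_mem (E : MoveSet T) {v : T} {k k' : Child v} (hk : k.1 ∈ E.1)
    (hk' : k'.1 ∈ E.1) : k = k' :=
  Subtype.ext (E.2.2 v k.1 hk k'.1 hk' k.2 k'.2)

open scoped Classical in
/-- An element of a set, if there is one. -/
noncomputable def someElement {α : Type u} (B : Set α) : Option α :=
  if hk : B.Nonempty then some hk.choose else none

/-- A related child of a node, if there is one. -/
noncomputable def letter (v : T) (E : MoveSet T) : Option (Child v) :=
  someElement (relatedChildren E v)

theorem mem_letter_iff (hT : ∀ v : T, IsMax v → depth v = d) (v : BottomNode T d)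
    (E : MoveSet T) (k : Child v.1) : k ∈ letter v.1 E ↔ k.1 ∈ E.1 := by
  unfold letter someElement
  split_ifs with h
  · have h1 := (mem_relatedChildren_iff hT v E _).1 h.choose_spec
    rw [Option.mem_some_iff]
    exact ⟨fun h2 => h2 ▸ h1, fun h2 => E.eq_of_mem h1 h2⟩
  · simp only [Option.not_mem_none, false_iff]
    exact fun h1 => h ⟨k, (mem_relatedChildren_iff hT v E k).2 h1⟩

theorem localMove_bottom (P : LeafPosets T d) (E : MoveSet T) (v : Inner T)
    (h : depth v.1 + 1 = d) (l : LinExt (nodeOrder P v)) :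
    localMove P E v l = promote (nodeOrder P v) (letter v.1 E) l := by
  refine (dif_pos h).trans ?_
  by_cases hk : (relatedChildren E v.1).Nonempty
  · refine (dif_pos hk).trans ?_
    have : letter v.1 E = some hk.choose := dif_pos hk
    rw [this]
    rfl
  · refine (dif_neg hk).trans ?_
    have : letter v.1 E = none := dif_neg hk
    rw [this]
    rfl

theorem localMove_upper (P : LeafPosets T d) (E : MoveSet T) (v : Inner T)
    (h : depth v.1 + 1 ≠ d) (l : LinExt (nodeOrder P v)) :
    localMove P E v l = moveBack (by simp [nodeOrder, h]) (relatedChildren E v.1) l := by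
  exact dif_neg h

theorem card_fixed_localMove_bottom (P : LeafPosets T d) (W : List (MoveSet T)) (v : Inner T)
    (h : depth v.1 + 1 = d) : Nat.card {l : LinExt (nodeOrder P v) //
        W.foldl (fun l E => localMove P E v l) l = l} =
      promotionFix (nodeOrder P v) (W.map (letter v.1)) := by
  have e : (fun l E => localMove P E v l) =
      fun l E => promote (nodeOrder P v) (letter v.1 E) l :=
    funext fun l => funext fun E => localMove_bottom P E v h l
  unfold promotionFix
  rw [e]
  simp only [List.foldl_map]

theorem card_fixed_localMove_upper (P : LeafPosets T d) (W : List (MoveSet T)) (v : Inner T)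
    (h : depth v.1 + 1 ≠ d) : Nat.card {l : LinExt (nodeOrder P v) //
        W.foldl (fun l E => localMove P E v l) l = l} =
      Nat.card {σ : Equiv.Perm (Child v.1) //
        ∀ x, ∀ B ∈ W.map (fun E => relatedChildren E v.1), σ x ∈ B ↔ x ∈ B} := by
  have hr : nodeOrder P v = discreteOrder (Child v.1) := dif_neg h
  have e : (fun l E => localMove P E v l) =
      fun l E => moveBack hr (relatedChildren E v.1) l :=
    funext fun l => funext fun E => localMove_upper P E v h l
  rw [← card_fixed_moveBack hr, e]
  simp only [List.foldl_map]

theorem foldl_move_apply (P : LeafPosets T d) (W : List (MoveSet T)) (π : State P)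
    (v : Inner T) : W.foldl (fun π E => move P E π) π v =
      W.foldl (fun l E => localMove P E v l) (π v) := by
  induction W generalizing π with
  | nil => rfl
  | cons E W ih => rw [List.foldl_cons, ih]; rfl

/-- The number of states which are fixed by a word of moves. -/
noncomputable def moveFix (P : LeafPosets T d) (W : List (MoveSet T)) : ℕ :=
  Nat.card {π : State P // W.foldl (fun π E => move P E π) π = π}

variable (T d) in
/-- The inner nodes are the bottom nodes and the upper nodes. -/
noncomputable def innerEquiv : BottomNode T d ⊕ UpperNode T d ≃ Inner T :=
  Equiv.ofBijective (Sum.elim (fun v => ⟨v.1, v.2.1⟩) (fun v => ⟨v.1, v.2.1⟩)) (by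
    constructor
    · rintro (⟨v, hv⟩ | ⟨v, hv⟩) (⟨w, hw⟩ | ⟨w, hw⟩) h
      all_goals
        obtain rfl : v = w := congrArg Subtype.val h
        first
          | rfl
          | exact absurd hv.2 hw.2
          | exact absurd hw.2 hv.2
    · rintro ⟨v, hv⟩
      by_cases h : depth v + 1 = d
      · exact ⟨Sum.inl ⟨v, hv, h⟩, rfl⟩
      · exact ⟨Sum.inr ⟨v, hv, h⟩, rfl⟩)

/-- A state is fixed if and only if all of its components are. -/
theorem moveFix_eq (P : LeafPosets T d) (W : List (MoveSet T)) :
    moveFix P W = (∏ v : BottomNode T d, promotionFix (P v) (W.map (letter v.1))) *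
      ∏ v : UpperNode T d, Nat.card {σ : Equiv.Perm (Child v.1) //
        ∀ x, ∀ B ∈ W.map (fun E => relatedChildren E v.1), σ x ∈ B ↔ x ∈ B} := by
  have := Fintype.ofFinite (Inner T)
  have h1 : moveFix P W = ∏ v : Inner T, Nat.card {l : LinExt (nodeOrder P v) //
      W.foldl (fun l E => localMove P E v l) l = l} := by
    rw [← Nat.card_pi]
    refine Nat.card_congr ((Equiv.subtypeEquivRight fun π => ?_).trans
      (Equiv.subtypePiEquivPi (p := fun v l => W.foldl (fun l E => localMove P E v l) l = l)))
    exact ⟨fun h v => by rw [← foldl_move_apply, h],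
      fun h => funext fun v => (foldl_move_apply P W π v).trans (h v)⟩
  rw [h1, ← (innerEquiv T d).prod_comp, Fintype.prod_sum_type]
  congr 1
  · refine Finset.prod_congr rfl fun v _ => ?_
    have e : nodeOrder P (innerEquiv T d (Sum.inl v)) = P v := dif_pos v.2.2
    refine (card_fixed_localMove_bottom P W _ v.2.2).trans ?_
    exact congrArg (fun r => promotionFix r (W.map (letter v.1))) e
  · exact Finset.prod_congr rfl fun v _ => card_fixed_localMove_upper P W _ v.2.2

/-! ### Exchanging two siblings in a move -/

theorem covBy_swap_iff [DecidableEq T] {v : T} (a b : Child v) (u x : T) :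
    u ⋖ Equiv.swap a.1 b.1 x ↔ u ⋖ x := by
  have h : ∀ c : Child v, u ⋖ c.1 ↔ u = v := fun c =>
    ⟨fun h => covBy_unique h c.2, fun h => h ▸ c.2⟩
  rcases eq_or_ne x a.1 with rfl | hxa
  · rw [Equiv.swap_apply_left, h, h]
  · rcases eq_or_ne x b.1 with rfl | hxb
    · rw [Equiv.swap_apply_right, h, h]
    · rw [Equiv.swap_apply_of_ne_of_ne hxa hxb]

theorem isMax_swap_iff [DecidableEq T] (hT : ∀ v : T, IsMax v → depth v = d)
    (v : BottomNode T d) (a b : Child v.1) (x : T) :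
    IsMax (Equiv.swap a.1 b.1 x) ↔ IsMax x := by
  have h : ∀ c : Child v.1, IsMax c.1 := isMax_child hT v
  rcases eq_or_ne x a.1 with rfl | hxa
  · rw [Equiv.swap_apply_left]; simp [h]
  · rcases eq_or_ne x b.1 with rfl | hxb
    · rw [Equiv.swap_apply_right]; simp [h]
    · rw [Equiv.swap_apply_of_ne_of_ne hxa hxb]

open scoped Classical in
/-- Exchange two siblings in a set of leaves. -/
noncomputable def swapMove (hT : ∀ v : T, IsMax v → depth v = d) (v : BottomNode T d)
    (a b : Child v.1) (E : MoveSet T) : MoveSet T :=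
  ⟨E.1.map (Equiv.swap a.1 b.1).toEmbedding, by
    simp only [IsMoveSet, Finset.mem_map_equiv, Equiv.symm_swap]
    refine ⟨fun e he => (isMax_swap_iff hT v a b e).1 (E.2.1 _ he), fun u e he f hf hue huf => ?_⟩
    exact (Equiv.swap a.1 b.1).injective (E.2.2 u _ he _ hf ((covBy_swap_iff a b u e).2 hue)
      ((covBy_swap_iff a b u f).2 huf))⟩

variable (hT : ∀ v : T, IsMax v → depth v = d)

open scoped Classical in
theorem mem_swapMove {v : BottomNode T d} {a b : Child v.1} {E : MoveSet T} {x : T} :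
    x ∈ (swapMove hT v a b E).1 ↔ Equiv.swap a.1 b.1 x ∈ E.1 := by
  simp only [swapMove, Finset.mem_map_equiv, Equiv.symm_swap]

open scoped Classical in
theorem swap_val {v : T} (a b k : Child v) :
    Equiv.swap a.1 b.1 k.1 = (Equiv.swap a b k).1 := by
  rcases eq_or_ne k a with rfl | hka
  · rw [Equiv.swap_apply_left, Equiv.swap_apply_left]
  · rcases eq_or_ne k b with rfl | hkb
    · rw [Equiv.swap_apply_right, Equiv.swap_apply_right]
    · rw [Equiv.swap_apply_of_ne_of_ne hka hkb, Equiv.swap_apply_of_ne_of_ne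
        (fun h => hka (Subtype.ext h)) (fun h => hkb (Subtype.ext h))]

open scoped Classical in
theorem mem_swapMove_child {v : BottomNode T d} {a b : Child v.1} {E : MoveSet T}
    {k : Child v.1} : k.1 ∈ (swapMove hT v a b E).1 ↔ (Equiv.swap a b k).1 ∈ E.1 := by
  rw [mem_swapMove, swap_val]

theorem mem_swapMove_of_ne {v : BottomNode T d} {a b : Child v.1} {E : MoveSet T} {u : T}
    (hu : u ≠ v.1) (k : Child u) : k.1 ∈ (swapMove hT v a b E).1 ↔ k.1 ∈ E.1 := by
  classical
  have h : ∀ c : Child v.1, k.1 ≠ c.1 := fun c h => hu (covBy_unique k.2 (h ▸ c.2))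
  rw [mem_swapMove, Equiv.swap_apply_of_ne_of_ne (h a) (h b)]

theorem swapMove_self_of_notMem {v : BottomNode T d} {a b : Child v.1} {E : MoveSet T}
    (ha : a.1 ∉ E.1) (hb : b.1 ∉ E.1) : swapMove hT v a b E = E := by
  classical
  refine Subtype.ext (Finset.ext fun x => ?_)
  rw [mem_swapMove]
  rcases eq_or_ne x a.1 with rfl | hxa
  · rw [Equiv.swap_apply_left]; simp [ha, hb]
  · rcases eq_or_ne x b.1 with rfl | hxb
    · rw [Equiv.swap_apply_right]; simp [ha, hb]
    · rw [Equiv.swap_apply_of_ne_of_ne hxa hxb]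

theorem swapMove_swapMove {v : BottomNode T d} {a b : Child v.1} (E : MoveSet T) :
    swapMove hT v a b (swapMove hT v a b E) = E := by
  classical
  refine Subtype.ext (Finset.ext fun x => ?_)
  rw [mem_swapMove, mem_swapMove, Equiv.swap_apply_self]

/-- Siblings have the same proper ancestors, so exchanging them is invisible at all other nodes. -/
theorem relatedChildren_swapMove {v : BottomNode T d} (a b : Child v.1) (E : MoveSet T) {u : T}
    (hu : u ≠ v.1) : relatedChildren (swapMove hT v a b E) u = relatedChildren E u := by
  classical
  have key : ∀ E : MoveSet T, relatedChildren E u ⊆ relatedChildren (swapMove hT v a b E) u := by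
    rintro E k ⟨e, he, hke⟩
    have hk : ∀ c c' : Child v.1, k.1 ≤ c.1 → k.1 ≤ c'.1 := by
      intro c c' h
      have hne : k.1 ≠ c.1 := fun h => hu (covBy_unique k.2 (h ▸ c.2))
      exact (le_of_lt_of_covBy c.2 (lt_of_le_of_ne h hne)).trans c'.2.le
    refine ⟨Equiv.swap a.1 b.1 e, ?_, ?_⟩
    · rw [mem_swapMove, Equiv.swap_apply_self]; exact he
    · rcases eq_or_ne e a.1 with rfl | hea
      · rw [Equiv.swap_apply_left]; exact hk a b hke
      · rcases eq_or_ne e b.1 with rfl | heb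
        · rw [Equiv.swap_apply_right]; exact hk b a hke
        · rw [Equiv.swap_apply_of_ne_of_ne hea heb]; exact hke
  refine (key E).antisymm' ?_
  have := key (swapMove hT v a b E)
  rwa [swapMove_swapMove] at this

theorem letter_swapMove_of_ne {v : BottomNode T d} (a b : Child v.1) (E : MoveSet T) {u : T}
    (hu : u ≠ v.1) : letter u (swapMove hT v a b E) = letter u E := by
  unfold letter
  rw [relatedChildren_swapMove hT a b E hu]

open scoped Classical in
theorem letter_swapMove {v : BottomNode T d} (a b : Child v.1) (E : MoveSet T) :
    letter v.1 (swapMove hT v a b E) = (letter v.1 E).map (Equiv.swap a b) := by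
  refine Option.ext fun k => ?_
  rw [← Option.mem_def, ← Option.mem_def, mem_letter_iff hT, mem_swapMove_child, Option.mem_map]
  constructor
  · intro h
    exact ⟨Equiv.swap a b k, (mem_letter_iff hT v E _).2 h, Equiv.swap_apply_self _ _ _⟩
  · rintro ⟨k', hk', rfl⟩
    rw [Equiv.swap_apply_self]
    exact (mem_letter_iff hT v E _).1 hk'

end Tree

end TreeShuffle


namespace TreeShuffle

/-! ### Breaking a covering relation in the tree -/

section Breaking

variable {T : RootedTree.{u}} [Finite T] {d : ℕ} (hT : ∀ v : T, IsMax v → depth v = d)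

/-! ### The properties (A) and (B) -/

open scoped Classical in
theorem isMoveSet_insert (hT : ∀ v : T, IsMax v → depth v = d) 
    {v : BottomNode T d} {E : MoveSet T} (hE : Avoids E v.1)
    (k : Child v.1) : IsMoveSet (insert k.1 E.1) := by
  have key : ∀ u : T, ∀ f ∈ E.1, u ⋖ k.1 → ¬ u ⋖ f := fun u f hf huk huf => by
    obtain rfl := covBy_unique huk k.2
    exact hE ⟨f, huf⟩ hf
  refine ⟨fun e he => ?_, fun u e he f hf hue huf => ?_⟩
  · rcases Finset.mem_insert.1 he with rfl | he
    · exact isMax_child hT v k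
    · exact E.2.1 e he
  · rcases Finset.mem_insert.1 he with rfl | he <;> rcases Finset.mem_insert.1 hf with rfl | hf
    · rfl
    · exact absurd huf (key u f hf hue)
    · exact absurd hue (key u e he huf)
    · exact E.2.2 u e he f hf hue huf

open scoped Classical in
theorem exists_avoids {v : BottomNode T d} {F : MoveSet T} {k : Child v.1} (hk : k.1 ∈ F.1) :
    ∃ E : MoveSet T, Avoids E v.1 ∧ E.1 = F.1.erase k.1 := by
  refine ⟨⟨F.1.erase k.1, fun e he => F.2.1 e (Finset.mem_of_mem_erase he),
    fun u e he f hf => F.2.2 u e (Finset.mem_of_mem_erase he) f (Finset.mem_of_mem_erase hf)⟩,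
    fun k' hk' => ?_, rfl⟩
  have h := Finset.mem_erase.1 hk'
  exact h.1 (congrArg Subtype.val (F.eq_of_mem h.2 hk))

theorem coeffAt_of_eq {c : MoveSet T → ℤ} {F : Finset T} {E : MoveSet T} (h : E.1 = F) :
    coeffAt c F = c E := by
  subst h
  exact dif_pos E.2

open scoped Classical in
theorem swapMove_insert {v : BottomNode T d} {a b : Child v.1} {E F : MoveSet T}
    (hE : Avoids E v.1) (hF : F.1 = insert a.1 E.1) :
    (swapMove hT v a b F).1 = insert b.1 E.1 := by
  ext x
  rw [mem_swapMove, hF, Finset.mem_insert, Finset.mem_insert]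
  rcases eq_or_ne x b.1 with rfl | hxb
  · simp
  · rcases eq_or_ne x a.1 with rfl | hxa
    · simp [hE a, hE b, hxb, hxb.symm]
    · simp [Equiv.swap_apply_of_ne_of_ne hxa hxb, hxb, hxa]

/-- This form, invariance under an involution of the moves, avoids the sets `E ∪ {k}` and is the one
used from here on. -/
theorem propertyA_iff {v : BottomNode T d} {a b : Child v.1} {c : MoveSet T → ℤ} :
    PropertyA a b c ↔ ∀ F, c (swapMove hT v a b F) = c F := by
  classical
  constructor
  · intro h F
    have key : ∀ F : MoveSet T, a.1 ∈ F.1 → c (swapMove hT v a b F) = c F := by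
      intro F ha
      obtain ⟨E, hE, hEF⟩ := exists_avoids ha
      have hF : F.1 = insert a.1 E.1 := by rw [hEF, Finset.insert_erase ha]
      rw [← coeffAt_of_eq (c := c) (swapMove_insert hT hE hF), ← coeffAt_of_eq (c := c) hF, h E hE]
    by_cases ha : a.1 ∈ F.1
    · exact key F ha
    by_cases hb : b.1 ∈ F.1
    · have h1 := key (swapMove hT v a b F) (by
        rw [mem_swapMove, Equiv.swap_apply_left]; exact hb)
      rw [← h1, swapMove_swapMove]
    · rw [swapMove_self_of_notMem hT ha hb]
  · intro h E hE
    have h1 := h ⟨_, isMoveSet_insert hT hE a⟩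
    rw [coeffAt_of_eq (swapMove_insert hT hE rfl :
      (swapMove hT v a b ⟨_, isMoveSet_insert hT hE a⟩).1 = _), h1]
    exact coeffAt_of_eq rfl

theorem propertyB_iff (hT : ∀ v : T, IsMax v → depth v = d) {P : LeafPosets T d} {v : BottomNode T d} {a : Child v.1}
    {c : MoveSet T → ℤ} :
    PropertyB P v a c ↔ ∀ F k, (P v).le k a → k.1 ∈ F.1 → c F = 0 := by
  classical
  constructor
  · intro h F k hka hk
    obtain ⟨E, hE, hEF⟩ := exists_avoids hk
    have hF : F.1 = insert k.1 E.1 := by rw [hEF, Finset.insert_erase hk]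
    rw [← coeffAt_of_eq (c := c) hF, h k hka E hE]
  · intro h k hka E hE
    rw [coeffAt_of_eq (E := ⟨_, isMoveSet_insert hT hE k⟩) rfl]
    exact h _ k hka (Finset.mem_insert_self _ _)

/-! ### The additional eigenvalue -/

open scoped Classical in
/-- The factor between the additional eigenvalue and the old one if (A) holds. -/
noncomputable def breakSign (P : LeafPosets T d) (v : BottomNode T d) (a b : Child v.1)
    (F : MoveSet T) : ℤ :=
  if ∃ k : Child v.1, k.1 ∈ F.1 ∧ (P v).lt k a then -1
  else if a.1 ∈ F.1 ∨ b.1 ∈ F.1 then 0 else 1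

theorem extraEigenvalue_of_propertyA {P : LeafPosets T d} {v : BottomNode T d} {a b : Child v.1}
    {c : MoveSet T → ℤ} (hA : PropertyA a b c) (F : MoveSet T) :
    extraEigenvalue P v a b c F = breakSign P v a b F * c F := by
  unfold extraEigenvalue breakSign
  rw [if_pos hA]
  split_ifs <;> simp

/-- Wherever the defining cases prescribe zero, the swapped move contains some `k ⪯ a`, and (B)
makes its coefficient vanish. -/
theorem extraEigenvalue_of_propertyB {P : LeafPosets T d} {v : BottomNode T d} {a b : Child v.1}
    {c : MoveSet T → ℤ} (hab : (P v).le a b) (hA : ¬ PropertyA a b c) (hB : PropertyB P v a c)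
    (F : MoveSet T) : extraEigenvalue P v a b c F = c (swapMove hT v a b F) := by
  classical
  rw [propertyB_iff hT] at hB
  have hswap : ∀ k : Child v.1, k ≠ a → k ≠ b →
      (k.1 ∈ (swapMove hT v a b F).1 ↔ k.1 ∈ F.1) := fun k hka hkb => by
    rw [mem_swapMove_child, Equiv.swap_apply_of_ne_of_ne hka hkb]
  unfold extraEigenvalue
  rw [if_neg hA]
  split_ifs with h1 h2 h3
  · obtain ⟨k, hk, hlt⟩ := h1
    let _ := P v
    have hka : k ≠ a := hlt.ne
    have hkb : k ≠ b := fun h => by subst h; exact absurd hab (not_le_of_gt hlt)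
    exact (hB _ k hlt.le ((hswap k hka hkb).2 hk)).symm
  · refine (hB _ a ((P v).le_refl a) ?_).symm
    rw [mem_swapMove, Equiv.swap_apply_left]
    exact h2
  · obtain ⟨E, hE, hEF⟩ := exists_avoids h3
    have hF : F.1 = insert a.1 E.1 := by rw [hEF, Finset.insert_erase h3]
    rw [← hEF, coeffAt_of_eq (swapMove_insert hT hE hF)]
  · rw [swapMove_self_of_notMem hT h3 h2]

/-! ### The traces after breaking a covering relation -/

/-- The exchange of two siblings in a move, depending on a state. -/
noncomputable def stateMove (v : BottomNode T d) (a b : Child v.1) : Bool → MoveSet T → MoveSet T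
  | true, E => swapMove hT v a b E
  | false, E => E

open scoped Classical in
/-- Whether two siblings are swapped after a move. -/
noncomputable def moveState (P : LeafPosets T d) (v : BottomNode T d) (a b : Child v.1)
    (ε : Bool) (E : MoveSet T) : Bool :=
  xor ε (decide (∃ k : Child v.1, k.1 ∈ (stateMove hT v a b ε E).1 ∧ (P v).le k a))

theorem letter_stateMove (v : BottomNode T d) (a b : Child v.1) (ε : Bool) (E : MoveSet T) :
    swapLetter a b ε (letter v.1 E) = letter v.1 (stateMove hT v a b ε E) := by
  cases ε
  · rfl
  · refine Eq.trans ?_ (letter_swapMove hT a b E).symm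
    unfold swapLetter
    congr!

theorem swapState_letter (P : LeafPosets T d) (v : BottomNode T d) (a b : Child v.1) (ε : Bool)
    (E : MoveSet T) :
    swapState (P v) a b ε (letter v.1 E) = moveState hT P v a b ε E := by
  unfold swapState moveState
  rw [letter_stateMove hT]
  exact congrArg (xor ε) (decide_eq_decide.2
    (exists_congr fun k => and_congr_left fun _ => mem_letter_iff hT v _ k))

theorem map_runWord_eq {A B : Type*} {t : Bool → A → A} {n : Bool → A → Bool} {f : A → B}
    (h : ∀ ε x, f (t ε x) = f x) (ε : Bool) (W : List A) :
    (runWord t n ε W).1.map f = W.map f := by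
  induction W generalizing ε with
  | nil => rfl
  | cons x W ih => rw [runWord, List.map_cons, List.map_cons, ih, h]

theorem IsRemoval.breaks {P P' : LeafPosets T d} {v : BottomNode T d} {a b : Child v.1}
    (h : IsRemoval P P' v a b) (hab : @IsBreakable (Child v.1) (P v) a b) :
    Breaks (P v) (P' v) a b :=
  ⟨hab, h.2⟩

/-- Only the factor at `v` changes; the automaton alters moves by a swap that the other nodes do not
notice. -/
theorem moveFix_of_isRemoval {P P' : LeafPosets T d} {v : BottomNode T d} {a b : Child v.1}
    (hab : @IsBreakable (Child v.1) (P v) a b) (h : IsRemoval P P' v a b)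
    (W : List (MoveSet T)) : moveFix P' W = ∑ ε : Bool,
      if (runWord (stateMove hT v a b) (moveState hT P v a b) ε W).2 = ε then
        moveFix P (runWord (stateMove hT v a b) (moveState hT P v a b) ε W).1 else 0 := by
  classical
  have h1 := (h.breaks hab).promotionFix_eq (W.map (letter v.1))
  simp only [runWord_map (letter v.1) (letter_stateMove hT v a b) (swapState_letter hT P v a b)]
    at h1
  have h2 : ∀ (u : BottomNode T d) (ε : Bool), u ≠ v →
      promotionFix (P u) ((runWord (stateMove hT v a b) (moveState hT P v a b) ε W).1.map
        (letter u.1)) = promotionFix (P' u) (W.map (letter u.1)) := by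
    intro u ε hu
    rw [h.1 u hu, map_runWord_eq]
    rintro (_ | _) E
    · rfl
    · exact letter_swapMove_of_ne hT a b E (fun h => hu (Subtype.ext h))
  have h3 : ∀ (u : UpperNode T d) (ε : Bool),
      (runWord (stateMove hT v a b) (moveState hT P v a b) ε W).1.map
        (fun E => relatedChildren E u.1) = W.map fun E => relatedChildren E u.1 := by
    intro u ε
    refine map_runWord_eq (f := fun E => relatedChildren E u.1) ?_ ε W
    rintro (_ | _) E
    · rfl
    · exact relatedChildren_swapMove hT a b E (fun h => u.2.2 (h ▸ v.2.2))
  rw [moveFix_eq, ← Finset.mul_prod_erase _ _ (Finset.mem_univ v), h1, mul_assoc, Finset.sum_mul]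
  refine Finset.sum_congr rfl fun ε _ => ?_
  rw [ite_mul, zero_mul]
  refine if_congr Iff.rfl ?_ rfl
  rw [moveFix_eq, ← Finset.mul_prod_erase _ _ (Finset.mem_univ v), mul_assoc]
  congr 2
  · exact Finset.prod_congr rfl fun u hu => (h2 u ε (Finset.ne_of_mem_erase hu)).symm
  · exact Finset.prod_congr rfl fun u _ => by rw [h3]

/-- A letter that would change the state has weight zero, so runs which leave `ε` contribute nothing
to either side. -/
theorem runWord_closed {A : Type*} {t : Bool → A → A} {n : Bool → A → Bool} {c f : A → ℤ}
    {ε : Bool} (hf : ∀ x, c (t ε x) = f x) (hn : ∀ x, f x ≠ 0 → n ε x = ε) (W : List A) :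
    (if (runWord t n ε W).2 = ε then ((runWord t n ε W).1.map c).prod else 0) =
      (W.map f).prod := by
  induction W with
  | nil => simp [runWord]
  | cons x W ih =>
    simp only [runWord, List.map_cons, List.prod_cons, hf]
    by_cases h : f x = 0
    · simp [h]
    · rw [hn x h, ← ih]
      split_ifs <;> simp

/-- Each letter acts on the two states as the exchange, a constant map or the identity. Modulo
constants, functions of the state are multiplied by `-1`, `0` or `1`, and these scalars are
multiplicative. -/
theorem runWord_signs {A : Type*} {t : Bool → A → A} {n : Bool → A → Bool} {e : A → ℤ}
    (he : ∀ x, (e x = -1 ∧ n false x = true ∧ n true x = false) ∨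
      (e x = 0 ∧ n false x = n true x) ∨ (e x = 1 ∧ n false x = false ∧ n true x = true))
    (W : List A) : (if (runWord t n true W).2 = true then 1 else 0) -
      (if (runWord t n false W).2 = true then 1 else 0) = (W.map e).prod := by
  induction W with
  | nil => simp [runWord]
  | cons x W ih =>
    set g : Bool → ℤ := fun ε => if (runWord t n ε W).2 = true then 1 else 0 with hg
    rw [List.map_cons, List.prod_cons, ← ih]
    change g (n true x) - g (n false x) = e x * (g true - g false)
    rcases he x with ⟨h1, h2, h3⟩ | ⟨h1, h2⟩ | ⟨h1, h2, h3⟩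
    · rw [h1, h2, h3]; ring
    · rw [h1, h2]; ring
    · rw [h1, h2, h3]; ring

/-- An element below `a` is unaffected by the swap and flips both states. If `a` or `b` is in the
move, exactly one state flips, so the transition is constant. Otherwise nothing flips. -/
theorem breakSign_cases {P : LeafPosets T d} {v : BottomNode T d} {a b : Child v.1}
    (hab : (P v).lt a b) (F : MoveSet T) :
    (breakSign P v a b F = -1 ∧ moveState hT P v a b false F = true ∧
      moveState hT P v a b true F = false) ∨
    (breakSign P v a b F = 0 ∧ moveState hT P v a b false F = moveState hT P v a b true F) ∨
    (breakSign P v a b F = 1 ∧ moveState hT P v a b false F = false ∧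
      moveState hT P v a b true F = true) := by
  classical
  let _ := P v
  have hne : a ≠ b := ne_of_lt hab
  have hba : ¬ b ≤ a := not_le_of_gt hab
  set p : Prop := ∃ k : Child v.1, k.1 ∈ F.1 ∧ k ≤ a with hp
  set q : Prop := ∃ k : Child v.1, k.1 ∈ (swapMove hT v a b F).1 ∧ k ≤ a with hq
  have e0 : moveState hT P v a b false F = decide p := by
    simp only [moveState, Bool.false_bne]
    rfl
  have e1 : moveState hT P v a b true F = !decide q := by
    simp only [moveState, Bool.true_bne]
    rfl
  have hswap : ∀ k : Child v.1, k ≠ a → k ≠ b →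
      (k.1 ∈ (swapMove hT v a b F).1 ↔ k.1 ∈ F.1) := fun k hka hkb => by
    rw [mem_swapMove_child, Equiv.swap_apply_of_ne_of_ne hka hkb]
  have hsa : a.1 ∈ (swapMove hT v a b F).1 ↔ b.1 ∈ F.1 := by
    rw [mem_swapMove, Equiv.swap_apply_left]
  have hsb : b.1 ∈ (swapMove hT v a b F).1 ↔ a.1 ∈ F.1 := by
    rw [mem_swapMove, Equiv.swap_apply_right]
  rw [e0, e1]
  by_cases h1 : ∃ k : Child v.1, k.1 ∈ F.1 ∧ k < a
  · refine Or.inl ⟨if_pos h1, ?_⟩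
    obtain ⟨k, hk, hka⟩ := h1
    have hkb : k ≠ b := fun h => hba (h ▸ hka.le)
    have h2 : p := ⟨k, hk, hka.le⟩
    have h3 : q := ⟨k, (hswap k hka.ne hkb).2 hk, hka.le⟩
    simp [h2, h3]
  have hp' : p ↔ a.1 ∈ F.1 := by
    refine ⟨?_, fun h => ⟨a, h, le_rfl⟩⟩
    rintro ⟨k, hk, hka⟩
    rcases hka.eq_or_lt with rfl | hlt
    · exact hk
    · exact absurd ⟨k, hk, hlt⟩ h1
  have hq' : q ↔ b.1 ∈ F.1 := by
    refine ⟨?_, fun h => ⟨a, hsa.2 h, le_rfl⟩⟩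
    rintro ⟨k, hk, hka⟩
    rcases hka.eq_or_lt with rfl | hlt
    · exact hsa.1 hk
    · exact absurd ⟨k, (hswap k hlt.ne (fun h => hba (h ▸ hka))).1 hk, hlt⟩ h1
  by_cases h2 : a.1 ∈ F.1 ∨ b.1 ∈ F.1
  · refine Or.inr (Or.inl ⟨(if_neg h1).trans (if_pos h2), ?_⟩)
    have h3 : ¬ (a.1 ∈ F.1 ∧ b.1 ∈ F.1) := fun h => hne (F.eq_of_mem h.1 h.2)
    rcases h2 with h2 | h2
    · have hb : b.1 ∉ F.1 := fun h => h3 ⟨h2, h⟩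
      simp [hp', hq', h2, hb]
    · have ha : a.1 ∉ F.1 := fun h => h3 ⟨h, h2⟩
      simp [hp', hq', h2, ha]
  · refine Or.inr (Or.inr ⟨(if_neg h1).trans (if_neg h2), ?_⟩)
    rw [not_or] at h2
    simp [hp', hq', h2]

theorem sum_runWord_eq {P : LeafPosets T d} {v : BottomNode T d} {a b : Child v.1}
    (hab : (P v).lt a b) {c : MoveSet T → ℤ} (hc : PropertyA a b c ∨ PropertyB P v a c)
    (W : List (MoveSet T)) : (∑ ε : Bool,
      if (runWord (stateMove hT v a b) (moveState hT P v a b) ε W).2 = ε then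
        ((runWord (stateMove hT v a b) (moveState hT P v a b) ε W).1.map c).prod else 0) =
      (W.map c).prod + (W.map (extraEigenvalue P v a b c)).prod := by
  classical
  let _ := P v
  by_cases hA : PropertyA a b c
  -- Under (A) both runs have the same character, and the number of returning states is `1` plus the
  -- product of the signs.
  · have h1 : ∀ ε x, c (stateMove hT v a b ε x) = c x := by
      rintro (_ | _) x
      · rfl
      · exact (propertyA_iff hT).1 hA x
    have h2 := runWord_signs (t := stateMove hT v a b) (breakSign_cases hT hab) W
    have h3 : (W.map (extraEigenvalue P v a b c)).prod =
        (W.map (breakSign P v a b)).prod * (W.map c).prod := by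
      rw [← List.prod_map_mul]
      exact congrArg (fun f => (W.map f).prod)
        (funext fun F => extraEigenvalue_of_propertyA hA F)
    simp only [map_runWord_eq h1]
    rw [h3, ← h2, Fintype.sum_bool]
    cases (runWord (stateMove hT v a b) (moveState hT P v a b) true W).2 <;>
      cases (runWord (stateMove hT v a b) (moveState hT P v a b) false W).2 <;> simp
  · have hB := hc.resolve_left hA
    have hB' := (propertyB_iff hT).1 hB
    rw [Fintype.sum_bool, add_comm]
    congr 1
    -- Under (B) a flip costs a zero coefficient: state `false` contributes `c`, state `true`
    -- contributes `c` composed with the swap.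
    · refine runWord_closed (fun x => rfl) (fun x hx => ?_) W
      have : ¬ ∃ k : Child v.1, k.1 ∈ x.1 ∧ k ≤ a := fun ⟨k, hk, hka⟩ => hx (hB' x k hka hk)
      simp only [moveState, Bool.false_bne]
      exact decide_eq_false this
    · have he := extraEigenvalue_of_propertyB hT hab.le hA hB
      refine runWord_closed (fun x => (he x).symm) (fun x hx => ?_) W
      rw [he x] at hx
      have : ¬ ∃ k : Child v.1, k.1 ∈ (swapMove hT v a b x).1 ∧ k ≤ a :=
        fun ⟨k, hk, hka⟩ => hx (hB' _ k hka hk)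
      have h2 : decide (∃ k : Child v.1, k.1 ∈ (stateMove hT v a b true x).1 ∧ k ≤ a) = false :=
        decide_eq_false this
      simp only [moveState, Bool.true_bne]
      exact congrArg (!·) h2

/-! ### Later breakable pairs -/

theorem swap_swap_comm {α : Type*} [DecidableEq α] {a b x y : α} (hax : a ≠ x) (hay : a ≠ y)
    (hbx : b ≠ x) (hby : b ≠ y) (z : α) :
    Equiv.swap a b (Equiv.swap x y z) = Equiv.swap x y (Equiv.swap a b z) := by
  simp only [Equiv.swap_apply_def]
  grind

theorem swapMove_comm {v u : BottomNode T d} {a b : Child v.1} {x y : Child u.1}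
    (hax : a.1 ≠ x.1) (hay : a.1 ≠ y.1) (hbx : b.1 ≠ x.1) (hby : b.1 ≠ y.1) (F : MoveSet T) :
    swapMove hT v a b (swapMove hT u x y F) = swapMove hT u x y (swapMove hT v a b F) := by
  classical
  refine Subtype.ext (Finset.ext fun z => ?_)
  simp only [mem_swapMove]
  rw [swap_swap_comm hax hay hbx hby]

/-- A pair `(x, y)` of siblings inherits (A) or (B) from an eigenvalue to the additional
eigenvalue for `a ≺ b`. -/
theorem property_extraEigenvalue {P : LeafPosets T d} {v u : BottomNode T d} {a b : Child v.1}
    {x y : Child u.1} {c : MoveSet T → ℤ} (hab : (P v).le a b)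
    (hc : PropertyA a b c ∨ PropertyB P v a c) (hxy : PropertyA x y c ∨ PropertyB P u x c)
    (hax : a.1 ≠ x.1) (hay : a.1 ≠ y.1) (hbx : b.1 ≠ x.1) (hby : b.1 ≠ y.1)
    (hlt : ∀ F : MoveSet T, (∃ k : Child v.1, k.1 ∈ (swapMove hT u x y F).1 ∧ (P v).lt k a) ↔
      ∃ k : Child v.1, k.1 ∈ F.1 ∧ (P v).lt k a)
    (hle : ∀ (F : MoveSet T) (k : Child u.1), (P u).le k x → k.1 ∈ F.1 →
      ∃ k' : Child u.1, (P u).le k' x ∧ k'.1 ∈ (swapMove hT v a b F).1) :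
    PropertyA x y (extraEigenvalue P v a b c) ∨ PropertyB P u x (extraEigenvalue P v a b c) := by
  classical
  rw [propertyA_iff hT, propertyB_iff hT] at hxy ⊢
  by_cases hA : PropertyA a b c
  · simp only [extraEigenvalue_of_propertyA hA]
    refine hxy.imp (fun h F => ?_) (fun h F k hk hkF => ?_)
    · have ha : a.1 ∈ (swapMove hT u x y F).1 ↔ a.1 ∈ F.1 := by
        rw [mem_swapMove, Equiv.swap_apply_of_ne_of_ne hax hay]
      have hb : b.1 ∈ (swapMove hT u x y F).1 ↔ b.1 ∈ F.1 := by
        rw [mem_swapMove, Equiv.swap_apply_of_ne_of_ne hbx hby]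
      rw [h F]
      congr 1
      exact if_congr (hlt F) rfl (if_congr (or_congr ha hb) rfl rfl)
    · rw [h F k hk hkF, mul_zero]
  · have hB := hc.resolve_left hA
    simp only [extraEigenvalue_of_propertyB hT hab hA hB]
    refine hxy.imp (fun h F => ?_) (fun h F k hk hkF => ?_)
    · rw [swapMove_comm hT hax hay hbx hby, h]
    · obtain ⟨k', hk', hkF'⟩ := hle F k hk hkF
      exact h _ k' hk' hkF'

/-- A pair that can be broken after `a ≺ b` has been broken. -/
theorem Breaks.isBreakable_of_isBreakable {α : Type u} {r r' : PartialOrder α} {a b x y : α}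
    (h : Breaks r r' a b) (hxy : @IsBreakable α r' x y) :
    @IsBreakable α r x y ∧ (x ≠ a ∧ x ≠ b ∧ y ≠ a ∧ y ≠ b) ∧ (r.lt x a ↔ r.lt y a) := by
  have hlt : r'.lt x y := hxy.1
  have hle' : r'.le x y := @le_of_lt _ r'.toPreorder _ _ hlt
  have hne : x ≠ y := @ne_of_lt _ r'.toPreorder _ _ hlt
  have hle : r.le x y := ((h.removal x y).1 hle').1
  have hcl : ∀ z w, r'.le z w → ((r'.le z x ∨ r'.le y z) ↔ (r'.le w x ∨ r'.le y w)) := hxy.2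
  have anti : ∀ {z w}, r.le z w → r.le w z → z = w := fun h1 h2 => r.le_antisymm _ _ h1 h2
  have e1 : ∀ {z w}, r'.le z w → r.le z w := fun h1 => ((h.removal _ _).1 h1).1
  have hab : r.le a b := h.le
  have hab' : a ≠ b := h.ne
  have hnab : ¬ r'.le a b := fun h1 => ((h.removal _ _).1 h1).2 ⟨rfl, rfl⟩
  -- In each of the four coincidences, closedness of the summand of `x, y` in `r'` forces the
  -- dropped relation or an equality of distinct elements.
  have hxb : x ≠ b := by
    rintro rfl
    have hay : r.le a y := r.le_trans _ _ _ hab hle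
    have := (hcl a y ((h.removal a y).2 ⟨hay, fun h1 => hne h1.2.symm⟩)).2
      (Or.inr (r'.le_refl y))
    rcases this with h1 | h1
    · exact hnab h1
    · exact hne (anti hle (r.le_trans _ _ _ (e1 h1) hab))
  have hya : y ≠ a := by
    rintro rfl
    have hxb : r.le x b := r.le_trans _ _ _ hle hab
    have := (hcl x b ((h.removal x b).2 ⟨hxb, fun h1 => hne h1.1⟩)).1
      (Or.inl (r'.le_refl x))
    rcases this with h1 | h1
    · exact hne (anti hle (r.le_trans _ _ _ hab (e1 h1)))
    · exact hnab h1
  have hxa : x ≠ a := by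
    rintro rfl
    have hyb : y ≠ b := fun h1 => hnab (h1 ▸ hle')
    have hby : r.le b y := (h.le_right_iff hne.symm).1 hle
    have := (hcl b y ((h.removal b y).2 ⟨hby, fun h1 => hab' h1.1.symm⟩)).2
      (Or.inr (r'.le_refl y))
    rcases this with h1 | h1
    · exact hab' (anti hab (e1 h1))
    · exact hyb (anti (e1 h1) hby)
  have hyb : y ≠ b := by
    rintro rfl
    have hxa' : r.le x a := (h.le_left_iff hne).2 hle
    have := (hcl x a ((h.removal x a).2 ⟨hxa', fun h1 => hab' h1.2⟩)).1
      (Or.inl (r'.le_refl x))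
    rcases this with h1 | h1
    · exact hxa (anti hxa' (e1 h1))
    · exact hab' (anti hab (e1 h1))
  have hx : ∀ z, r'.le z x ↔ r.le z x := fun z =>
    ⟨e1, fun h1 => (h.removal z x).2 ⟨h1, fun h2 => hxb h2.2⟩⟩
  have hy : ∀ z, r'.le y z ↔ r.le y z := fun z =>
    ⟨e1, fun h1 => (h.removal y z).2 ⟨h1, fun h2 => hya h2.1⟩⟩
  have hbr : ∀ z w, r.le z w → ((r.le z x ∨ r.le y z) ↔ (r.le w x ∨ r.le y w)) := by
    intro z w hzw
    by_cases h1 : z = a ∧ w = b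
    · obtain ⟨rfl, rfl⟩ := h1
      exact or_congr (h.le_right_iff hxa) (h.le_left_iff hyb)
    · have := hcl z w ((h.removal z w).2 ⟨hzw, h1⟩)
      rwa [hx, hx, hy, hy] at this
  refine ⟨⟨@lt_of_le_of_ne _ r _ _ hle hne, hbr⟩, ⟨hxa, hxb, hya, hyb⟩, ?_, ?_⟩
  · intro h1
    have h2 : r.le x a := @le_of_lt _ r.toPreorder _ _ h1
    rcases (hbr x a h2).1 (Or.inl (r.le_refl x)) with h3 | h3
    · exact absurd (anti h2 h3) hxa
    · exact @lt_of_le_of_ne _ r _ _ h3 hya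
  · intro h1
    exact @lt_of_le_of_ne _ r _ _ (r.le_trans _ _ _ hle (@le_of_lt _ r.toPreorder _ _ h1)) hxa

/-! ### The invariants of the procedure -/

/-- The properties of the multisets which the procedure produces. -/
structure IsSpectrum (P : LeafPosets T d) (s : Multiset (MoveSet T → ℤ)) : Prop where
  moveFix_eq : ∀ W : List (MoveSet T), (moveFix P W : ℤ) = (s.map fun c => (W.map c).prod).sum
  coeff : ∀ c ∈ s, ∀ E, c E = -1 ∨ c E = 0 ∨ c E = 1
  property : ∀ c ∈ s, ∀ (v : BottomNode T d) (a b : Child v.1),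
    @IsBreakable (Child v.1) (P v) a b → PropertyA a b c ∨ PropertyB P v a c

/-- At the same node, `x` and `y` are disjoint from `a, b` and are both below `a` or both not. Hence
the swaps commute, exchanging `x, y` preserves the sign, and exchanging `a, b` preserves the
elements `⪯ x`. Different nodes do not interact. -/
theorem property_of_isRemoval (hT : ∀ v : T, IsMax v → depth v = d) 
    {P P' : LeafPosets T d} {v : BottomNode T d} {a b : Child v.1}
    (hab : @IsBreakable (Child v.1) (P v) a b) (h : IsRemoval P P' v a b)
    {c : MoveSet T → ℤ} (hc : ∀ (u : BottomNode T d) (x y : Child u.1),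
      @IsBreakable (Child u.1) (P u) x y → PropertyA x y c ∨ PropertyB P u x c)
    (u : BottomNode T d) (x y : Child u.1) (hxy : @IsBreakable (Child u.1) (P' u) x y) :
    (PropertyA x y c ∨ PropertyB P' u x c) ∧
      (PropertyA x y (extraEigenvalue P v a b c) ∨
        PropertyB P' u x (extraEigenvalue P v a b c)) := by
  classical
  have hle : (P v).le a b := (h.breaks hab).le
  by_cases hu : u = v
  · subst hu
    obtain ⟨h1, ⟨hxa, hxb, hya, hyb⟩, h2⟩ := (h.breaks hab).isBreakable_of_isBreakable hxy
    have hB : ∀ c, PropertyB P' u x c ↔ PropertyB P u x c := by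
      intro c
      rw [propertyB_iff hT, propertyB_iff hT]
      refine forall_congr' fun F => forall_congr' fun k => ?_
      rw [h.2 k x, and_iff_left fun h3 => hxb h3.2]
    have hne : ∀ {p q : Child u.1}, q ≠ p → p.1 ≠ q.1 := fun h3 h4 => h3 (Subtype.ext h4).symm
    rw [hB, hB]
    refine ⟨hc u x y h1, property_extraEigenvalue hT hle (hc u a b hab) (hc u x y h1)
      (hne hxa) (hne hya) (hne hxb) (hne hyb) (fun F => ?_) (fun F k hk hkF => ?_)⟩
    · have key : ∀ F : MoveSet T, (∃ k : Child u.1, k.1 ∈ F.1 ∧ (P u).lt k a) →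
          ∃ k : Child u.1, k.1 ∈ (swapMove hT u x y F).1 ∧ (P u).lt k a := by
        rintro F ⟨k, hk, hlt⟩
        refine ⟨Equiv.swap x y k, ?_, ?_⟩
        · rw [mem_swapMove_child, Equiv.swap_apply_self]
          exact hk
        · rcases eq_or_ne k x with rfl | hkx
          · rw [Equiv.swap_apply_left]; exact h2.1 hlt
          · rcases eq_or_ne k y with rfl | hky
            · rw [Equiv.swap_apply_right]; exact h2.2 hlt
            · rwa [Equiv.swap_apply_of_ne_of_ne hkx hky]
      refine ⟨fun h3 => ?_, key F⟩
      have := key _ h3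
      rwa [swapMove_swapMove] at this
    · refine ⟨Equiv.swap a b k, ?_, ?_⟩
      · rcases eq_or_ne k a with rfl | hka
        · rw [Equiv.swap_apply_left]
          exact ((h.breaks hab).le_right_iff hxa).1 hk
        · rcases eq_or_ne k b with rfl | hkb
          · rw [Equiv.swap_apply_right]
            exact (P u).le_trans _ _ _ hle hk
          · rwa [Equiv.swap_apply_of_ne_of_ne hka hkb]
      · rw [mem_swapMove_child, Equiv.swap_apply_self]
        exact hkF
  · have e : P' u = P u := h.1 u hu
    have hB : ∀ c, PropertyB P' u x c ↔ PropertyB P u x c := by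
      intro c
      rw [propertyB_iff hT, propertyB_iff hT, e]
    have h1 : @IsBreakable (Child u.1) (P u) x y := e ▸ hxy
    have hne : ∀ (p : Child v.1) (q : Child u.1), p.1 ≠ q.1 := fun p q h3 =>
      hu (Subtype.ext (covBy_unique q.2 (h3 ▸ p.2)))
    rw [hB, hB]
    have hne' : u.1 ≠ v.1 := fun h3 => hu (Subtype.ext h3)
    refine ⟨hc u x y h1, property_extraEigenvalue hT hle (hc v a b hab) (hc u x y h1)
      (hne _ _) (hne _ _) (hne _ _) (hne _ _) (fun F => ?_) (fun F k hk hkF => ?_)⟩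
    · exact exists_congr fun k => and_congr_left fun _ => mem_swapMove_of_ne hT hne'.symm k
    · exact ⟨k, hk, (mem_swapMove_of_ne hT hne' k).2 hkF⟩

theorem IsSpectrum.step (hT : ∀ v : T, IsMax v → depth v = d) 
    {P P' : LeafPosets T d} {s : Multiset (MoveSet T → ℤ)}
    (hs : IsSpectrum P s) {v : BottomNode T d} {a b : Child v.1}
    (hab : @IsBreakable (Child v.1) (P v) a b) (h : IsRemoval P P' v a b) :
    IsSpectrum P' (s + s.map (extraEigenvalue P v a b)) where
  moveFix_eq W := by
    rw [moveFix_of_isRemoval hT hab h W, Multiset.map_add, Multiset.sum_add, Multiset.map_map,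
      ← Multiset.sum_map_add]
    have h1 : (s.map fun c => (W.map c).prod + (W.map (extraEigenvalue P v a b c)).prod) =
        s.map fun c => ∑ ε : Bool,
          if (runWord (stateMove hT v a b) (moveState hT P v a b) ε W).2 = ε then
            ((runWord (stateMove hT v a b) (moveState hT P v a b) ε W).1.map c).prod else 0 :=
      Multiset.map_congr rfl fun c hc =>
        (sum_runWord_eq hT (h.breaks hab).lt (hs.property c hc v a b hab) W).symm
    refine Eq.trans ?_ (congrArg Multiset.sum h1.symm)
    rw [Multiset.sum_map_sum]
    push_cast
    refine Finset.sum_congr rfl fun ε _ => ?_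
    split_ifs
    · exact hs.moveFix_eq _
    · simp
  coeff c hc E := by
    rcases Multiset.mem_add.1 hc with hc | hc
    · exact hs.coeff c hc E
    · obtain ⟨c₀, hc₀, rfl⟩ := Multiset.mem_map.1 hc
      by_cases hA : PropertyA a b c₀
      · rw [extraEigenvalue_of_propertyA hA]
        unfold breakSign
        have := hs.coeff c₀ hc₀ E
        split_ifs <;> omega
      · rw [extraEigenvalue_of_propertyB hT (h.breaks hab).le hA
          ((hs.property c₀ hc₀ v a b hab).resolve_left hA)]
        exact hs.coeff c₀ hc₀ _
  property c hc u x y hxy := by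
    rcases Multiset.mem_add.1 hc with hc | hc
    · exact (property_of_isRemoval hT hab h (hs.property c hc) u x y hxy).1
    · obtain ⟨c₀, hc₀, rfl⟩ := Multiset.mem_map.1 hc
      exact (property_of_isRemoval hT hab h (hs.property c₀ hc₀) u x y hxy).2

end Breaking

end TreeShuffle


namespace TreeShuffle

/-! ### The spectrum in the case of forests -/

theorem prod_map_ite {A : Type*} (p : A → Prop) [DecidablePred p] (W : List A)
    [Decidable (∀ x ∈ W, p x)] :
    (W.map fun x => if p x then (1 : ℤ) else 0).prod = if ∀ x ∈ W, p x then 1 else 0 := by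
  split_ifs with h
  · refine List.prod_eq_one fun y hy => ?_
    obtain ⟨x, hx, rfl⟩ := List.mem_map.1 hy
    exact if_pos (h x hx)
  · push Not at h
    obtain ⟨x, hx, hpx⟩ := h
    exact List.prod_eq_zero (List.mem_map.2 ⟨x, hx, if_neg hpx⟩)

theorem prod_univ_ite {ι : Type*} [Fintype ι] (p : ι → Prop) [DecidablePred p]
    [Decidable (∀ i, p i)] : (∏ i, if p i then (1 : ℤ) else 0) = if ∀ i, p i then 1 else 0 := by
  split_ifs with h
  · exact Finset.prod_eq_one fun i _ => if_pos (h i)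
  · push Not at h
    obtain ⟨i, hi⟩ := h
    exact Finset.prod_eq_zero (Finset.mem_univ i) (if_neg hi)

theorem sum_map_sum_nsmul {ι A : Type*} [Fintype ι] (m : ι → ℕ) (x : ι → A) (f : A → ℤ) :
    ((∑ i, m i • ({x i} : Multiset A)).map f).sum = ∑ i, (m i : ℤ) * f (x i) := by
  have := map_sum (Multiset.sumAddMonoidHom.comp (Multiset.mapAddMonoidHom f))
    (fun i => m i • ({x i} : Multiset A)) Finset.univ
  exact this.trans (Finset.sum_congr rfl fun i _ => by
    simp [Multiset.map_nsmul, Multiset.sum_nsmul])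

theorem sum_pi_prod {ι κ : Type*} [Fintype ι] [Fintype κ] {A : ι → Type*} {B : κ → Type*}
    [∀ i, Fintype (A i)] [∀ k, Fintype (B k)] [inst : Fintype ((∀ i, A i) × ∀ k, B k)]
    (f : ∀ i, A i → ℤ) (g : ∀ k, B k → ℤ) :
    ∑ x : (∀ i, A i) × ∀ k, B k, (∏ i, f i (x.1 i)) * ∏ k, g k (x.2 k) =
      (∏ i, ∑ a, f i a) * ∏ k, ∑ b, g k b := by
  classical
  rw [Finset.prod_univ_sum, Finset.prod_univ_sum, Fintype.piFinset_univ, Fintype.piFinset_univ,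
    Finset.sum_mul_sum]
  obtain rfl : inst = instFintypeProd _ _ := Subsingleton.elim _ _
  exact Fintype.sum_prod_type _

theorem promotionFix_reduceOption {α : Type u} (r : PartialOrder α) (w : List (Option α)) :
    promotionFix r (w.reduceOption.map some) = promotionFix r w := by
  have h : ∀ l : LinExt r, (w.reduceOption.map some).foldl (fun l o => promote r o l) l =
      w.foldl (fun l o => promote r o l) l := by
    induction w with
    | nil => exact fun l => rfl
    | cons o w ih =>
      intro l
      cases o with
      | none => exact ih l
      | some k =>
        rw [List.reduceOption_cons_of_some]
        exact ih _
  unfold promotionFix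
  simp only [h]

open scoped Classical in
theorem promotionFix_eq_sum_option {α : Type u} [r : PartialOrder α] [Finite α]
    [Fintype (UpperSet α)] (hF : IsRootedForest α) (w : List (Option α)) :
    (promotionFix r w : ℤ) = ∑ S : UpperSet α, upsetDerangement S *
      (w.map fun o => if ∀ k ∈ o, k ∈ S then 1 else 0).prod := by
  rw [← promotionFix_reduceOption, promotionFix_eq_sum hF]
  refine Finset.sum_congr rfl fun S _ => ?_
  congr 1
  induction w with
  | nil => rfl
  | cons o w ih =>
    cases o with
    | none => rw [List.reduceOption_cons_of_none, ih]; simp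
    | some k => rw [List.reduceOption_cons_of_some, List.map_cons, List.prod_cons, ih]; simp

open scoped Classical in
-- A permutation preserves all the sets if and only if it preserves the map `f` recording which of
-- them contain a letter. The orbit partitions that occur are those whose blocks are not split by
-- any set.
theorem card_perm_eq_sum {α : Type u} [Fintype α] [DecidableEq α]
    [Fintype (Finpartition (Finset.univ : Finset α))] (w : List (Set α)) :
    (Nat.card {σ : Equiv.Perm α // ∀ x, ∀ B ∈ w, σ x ∈ B ↔ x ∈ B} : ℤ) =
      ∑ p : Finpartition (Finset.univ : Finset α),
        (∏ B ∈ p.parts, ((B.card - 1).factorial : ℤ)) *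
          (w.map fun R => if ∀ B ∈ p.parts, (B : Set α) ⊆ R ∨ (B : Set α) ⊆ Rᶜ
            then 1 else 0).prod := by
  set f : α → Set (Set α) := fun x => {B | B ∈ w ∧ x ∈ B} with hf
  have hfe : ∀ x y, f x = f y ↔ ∀ B ∈ w, x ∈ B ↔ y ∈ B := by
    intro x y
    rw [Set.ext_iff]
    refine forall_congr' fun B => ?_
    simp only [hf, Set.mem_ofPred_eq]
    tauto
  have h1 := sum_finpartition_prod_factorial f
  have h2 : Nat.card {σ : Equiv.Perm α // ∀ x, f (σ x) = f x} =
      Nat.card {σ : Equiv.Perm α // ∀ x, ∀ B ∈ w, σ x ∈ B ↔ x ∈ B} :=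
    Nat.card_congr (Equiv.subtypeEquivRight fun σ => forall_congr' fun x => hfe _ _)
  rw [← h2, ← h1]
  push_cast
  refine Finset.sum_congr rfl fun p _ => ?_
  rw [prod_map_ite, mul_ite, mul_one, mul_zero]
  refine if_congr ⟨fun h R hR B hB => ?_, fun h x y hxy => (hfe x y).2 fun R hR => ?_⟩ rfl rfl
  · by_contra! hcon
    obtain ⟨⟨x, hx, hxR⟩, ⟨y, hy, hyR⟩⟩ :
        (∃ x ∈ (B : Set α), x ∉ R) ∧ ∃ y ∈ (B : Set α), y ∉ Rᶜ :=
      ⟨Set.not_subset.1 hcon.1, Set.not_subset.1 hcon.2⟩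
    have hp : p.part x = p.part y := by
      rw [p.part_eq_of_mem hB hx, p.part_eq_of_mem hB hy]
    exact hyR ((not_congr ((hfe x y).1 (h x y hp) R hR)).1 hxR)
  · have hx : x ∈ p.part x := p.mem_part (Finset.mem_univ x)
    have hy : y ∈ p.part x := hxy ▸ p.mem_part (Finset.mem_univ y)
    rcases h R hR (p.part x) (p.part_mem.2 (Finset.mem_univ x)) with h3 | h3
    · exact ⟨fun _ => h3 hy, fun _ => h3 hx⟩
    · exact ⟨fun h4 => absurd h4 (h3 hx), fun h4 => absurd h4 (h3 hy)⟩

/-! ### The invariants for forests, and the characteristic polynomial -/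

section Forest

variable {T : RootedTree.{u}} [Finite T] {d : ℕ}

open scoped Classical in
-- As a product over the nodes the character matches the factorisation of `moveFix`.
theorem forestEigenvalue_eq (hT : ∀ v : T, IsMax v → depth v = d) (P : LeafPosets T d) (i : ForestIndex P) (E : MoveSet T) :
    forestEigenvalue P i E =
      (∏ v : BottomNode T d, if ∀ k ∈ letter v.1 E, k ∈ i.1 v then 1 else 0) *
      ∏ v : UpperNode T d, if ∀ B ∈ (i.2 v).parts,
        (B : Set (Child v.1)) ⊆ relatedChildren E v.1 ∨
          (B : Set (Child v.1)) ⊆ (relatedChildren E v.1)ᶜ then 1 else 0 := by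
  rw [prod_univ_ite, prod_univ_ite, ite_zero_mul_ite_zero, one_mul]
  unfold forestEigenvalue
  refine if_congr (and_congr_left fun _ => forall_congr' fun v => forall_congr' fun k => ?_) rfl rfl
  rw [mem_letter_iff hT]

theorem prod_map_finset_prod {A ι : Type*} [Fintype ι] (f : ι → A → ℤ) (W : List A) :
    (W.map fun x => ∏ i, f i x).prod = ∏ i, (W.map (f i)).prod := by
  induction W with
  | nil => simp
  | cons x W ih => simp [ih, Finset.prod_mul_distrib]

open scoped Classical in
theorem moveFix_eq_sum_forest 
    (hT : ∀ v : T, IsMax v → depth v = d) (P : LeafPosets T d)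
    (hP : ∀ v, @IsRootedForest (Child v.1) (P v)) (W : List (MoveSet T)) :
    (moveFix P W : ℤ) = ∑ i : ForestIndex P,
      forestMultiplicity P i * (W.map (forestEigenvalue P i)).prod := by
  have hU : ∀ v : BottomNode T d, Finite (@UpperSet (Child v.1) (P v).toLE) := fun v =>
    let _ := P v; inferInstance
  let _ : ∀ v : BottomNode T d, Fintype (@UpperSet (Child v.1) (P v).toLE) := fun v =>
    Fintype.ofFinite _
  rw [moveFix_eq]
  push_cast
  have h1 : ∀ v : BottomNode T d, (promotionFix (P v) (W.map (letter v.1)) : ℤ) =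
      ∑ S : @UpperSet (Child v.1) (P v).toLE, @upsetDerangement (Child v.1) (P v) _ S *
        (W.map fun E => if ∀ k ∈ letter v.1 E, k ∈ S then 1 else 0).prod := by
    intro v
    let _ := P v
    rw [promotionFix_eq_sum_option (hP v)]
    simp only [List.map_map]
    refine Finset.sum_congr (by congr!) fun S _ => ?_
    refine congrArg (fun f => _ * (W.map f).prod) (funext fun E => ?_)
    by_cases h : ∀ k ∈ letter v.1 E, k ∈ S
    · exact (if_pos h).trans (if_pos h).symm
    · exact (if_neg h).trans (if_neg h).symm
  have h2 : ∀ v : UpperNode T d, (Nat.card {σ : Equiv.Perm (Child v.1) //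
      ∀ x, ∀ B ∈ W.map (fun E => relatedChildren E v.1), σ x ∈ B ↔ x ∈ B} : ℤ) =
      ∑ p : Finpartition (Finset.univ : Finset (Child v.1)),
        (∏ B ∈ p.parts, ((B.card - 1).factorial : ℤ)) *
          (W.map fun E => if ∀ B ∈ p.parts, (B : Set (Child v.1)) ⊆ relatedChildren E v.1 ∨
            (B : Set (Child v.1)) ⊆ (relatedChildren E v.1)ᶜ then 1 else 0).prod := by
    intro v
    rw [card_perm_eq_sum]
    simp only [List.map_map]
    rfl
  simp only [h1, h2]
  rw [← sum_pi_prod]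
  refine Finset.sum_congr rfl fun i _ => ?_
  have h3 : (W.map (forestEigenvalue P i)) = W.map _ :=
    congrArg (W.map ·) (funext fun E => forestEigenvalue_eq hT P i E)
  rw [h3, List.prod_map_mul, prod_map_finset_prod, prod_map_finset_prod, forestMultiplicity,
    Finset.prod_mul_distrib, Finset.prod_mul_distrib]
  ring

/-- If the upset contains `a` it contains `b` too, and exchanging them does not affect containment:
(A). If not, it contains nothing below `a`: (B). -/
theorem property_forestEigenvalue (hT : ∀ v : T, IsMax v → depth v = d)
    (P : LeafPosets T d) (i : ForestIndex P) (v : BottomNode T d)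
    (a b : Child v.1) (hab : (P v).le a b) : PropertyA a b (forestEigenvalue P i) ∨
      PropertyB P v a (forestEigenvalue P i) := by
  classical
  rw [propertyA_iff hT, propertyB_iff hT]
  by_cases ha : a ∈ i.1 v
  · left
    intro F
    have hb : b ∈ i.1 v := (i.1 v).upper' hab ha
    unfold forestEigenvalue
    refine if_congr (and_congr (forall_congr' fun u => ?_) (forall_congr' fun u => ?_)) rfl rfl
    · by_cases hu : u = v
      · subst hu
        have key : ∀ F : MoveSet T, (∀ k : Child u.1, k.1 ∈ F.1 → k ∈ i.1 u) →
            ∀ k : Child u.1, k.1 ∈ (swapMove hT u a b F).1 → k ∈ i.1 u := by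
          intro F h k hk
          rcases eq_or_ne k a with rfl | hka
          · exact ha
          rcases eq_or_ne k b with rfl | hkb
          · exact hb
          rw [mem_swapMove_child, Equiv.swap_apply_of_ne_of_ne hka hkb] at hk
          exact h k hk
        refine ⟨fun h => ?_, key F⟩
        have := key _ h
        rwa [swapMove_swapMove] at this
      · exact forall_congr' fun k => imp_congr_left
          (mem_swapMove_of_ne hT (fun h => hu (Subtype.ext h)) k)
    · rw [relatedChildren_swapMove hT a b F fun h : u.1 = v.1 => u.2.2 (h ▸ v.2.2)]
  · right
    intro F k hka hk
    unfold forestEigenvalue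
    exact if_neg fun h => ha ((i.1 v).upper' hka (h.1 v k hk))

theorem isSpectrum_forest (hT : ∀ v : T, IsMax v → depth v = d)
    (P : LeafPosets T d) (hP : ∀ v, @IsRootedForest (Child v.1) (P v))
    (m : ForestIndex P → ℕ) (hm : ∀ i, (m i : ℤ) = forestMultiplicity P i) :
    IsSpectrum P (∑ i : ForestIndex P, m i • {forestEigenvalue P i}) := by
  have hmem : ∀ c ∈ ∑ i : ForestIndex P, m i • ({forestEigenvalue P i} : Multiset _),
      ∃ i, c = forestEigenvalue P i := by
    intro c hc
    obtain ⟨i, -, hi⟩ := Multiset.mem_sum.1 hc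
    exact ⟨i, Multiset.mem_singleton.1 (Multiset.mem_of_mem_nsmul hi)⟩
  refine ⟨fun W => ?_, fun c hc E => ?_, fun c hc v a b hab => ?_⟩
  · rw [moveFix_eq_sum_forest hT P hP, sum_map_sum_nsmul]
    simp only [hm]
  · obtain ⟨i, rfl⟩ := hmem c hc
    unfold forestEigenvalue
    split_ifs <;> simp
  · obtain ⟨i, rfl⟩ := hmem c hc
    let _ := P v
    exact property_forestEigenvalue hT P i v a b hab.1.le

theorem ComputedSpectrum.isSpectrum (hT : ∀ v : T, IsMax v → depth v = d)
    {P : LeafPosets T d} {s : Multiset (MoveSet T → ℤ)}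
    (h : ComputedSpectrum P s) : IsSpectrum P s := by
  induction h with
  | forest P hP m hm => exact isSpectrum_forest hT P hP m hm
  | step P P' s _ v a b hab hP' ih => exact ih.step hT hab hP'

theorem IsSpectrum.charpoly_eq {P : LeafPosets T d} {s : Multiset (MoveSet T → ℤ)}
    (h : IsSpectrum P s) {R : Type w} [CommRing R] (x : MoveSet T → R) :
    (transitionMatrix P x).charpoly =
      (s.map fun c => Polynomial.X - Polynomial.C (linearForm c x)).prod := by
  classical
  have h1 : transitionMatrix P x = ∑ E, x E • mapMatrix R (move P E) := by
    ext π π'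
    rw [Matrix.sum_apply]
    simp only [transitionMatrix, Matrix.of_apply, Matrix.smul_apply, mapMatrix, smul_eq_mul,
      mul_ite, mul_one, mul_zero, Finset.sum_filter]
  have h2 := charpoly_eq_of_card_fixedPoints (fun E => move P E) s (fun W => h.moveFix_eq W) x
  rw [h1]
  convert h2 using 2
  rfl

/-- For forests the procedure applies. -/
theorem exists_computedSpectrum_forest (P : LeafPosets T d)
    (hP : ∀ v, @IsRootedForest (Child v.1) (P v)) : ∃ s, ComputedSpectrum P s := by
  refine ⟨_, ComputedSpectrum.forest P hP (fun i => (forestMultiplicity P i).toNat) fun i => ?_⟩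
  refine Int.toNat_of_nonneg (mul_nonneg (Finset.prod_nonneg fun v _ => ?_)
    (Finset.prod_nonneg fun v _ => Finset.prod_nonneg fun B _ => Int.natCast_nonneg _))
  let _ := P v
  exact upsetDerangement_nonneg (hP v) _

end Forest

end TreeShuffle


namespace TreeShuffle

/-! ### Rungs -/

/-- The elements `y` and `z` form a rung of a ladder in a direct summand. -/
structure IsRung {α : Type u} [PartialOrder α] (y z : α) : Prop where
  lt_left : ∀ w, w < y ↔ w < z
  lt_right : ∀ w, y < w ↔ z < w
  closed : ∀ w w', w ≤ w' →
    ((w = y ∨ w = z ∨ w < y ∨ y < w) ↔ (w' = y ∨ w' = z ∨ w' < y ∨ y < w'))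

/-- Any two covers of an element form a rung. -/
def CoversAreRungs (α : Type u) [PartialOrder α] : Prop :=
  ∀ x y z : α, x ⋖ y → x ⋖ z → y ≠ z → IsRung y z

theorem CoversAreRungs.of_orderIso {α β : Type u} [PartialOrder α] [PartialOrder β] (e : α ≃o β)
    (h : CoversAreRungs β) : CoversAreRungs α := by
  intro x y z hy hz hne
  have := h (e x) (e y) (e z) ((apply_covBy_apply_iff e).2 hy) ((apply_covBy_apply_iff e).2 hz)
    (e.injective.ne hne)
  refine ⟨fun w => ?_, fun w => ?_, fun w w' hw => ?_⟩
  · simpa using this.lt_left (e w)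
  · simpa using this.lt_right (e w)
  · simpa using this.closed (e w) (e w') (e.le_iff_le.2 hw)

theorem IsLadder.lt_or_gt_of_incomparable {α : Type u} [PartialOrder α] (h : IsLadder α)
    {y z : α} (hyz : ¬ y ≤ z) (hzy : ¬ z ≤ y) (w : α) :
    w = y ∨ w = z ∨ (w < y ∧ w < z) ∨ (y < w ∧ z < w) := by
  obtain ⟨n, Q, _, hQ, ⟨e⟩⟩ := h
  suffices H : ∀ y z w : Σₗ i, Q i, ¬ y ≤ z → ¬ z ≤ y →
      w = y ∨ w = z ∨ (w < y ∧ w < z) ∨ (y < w ∧ z < w) by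
    simpa using H (e y) (e z) (e w) (by simpa using hyz) (by simpa using hzy)
  rintro ⟨i, p⟩ ⟨i', p'⟩ ⟨k, q⟩ h1 h2
  have h3 : ∀ {i j : Fin n} (p : Q i) (q : Q j), i < j →
      @LT.lt (Σₗ i, Q i) _ ⟨i, p⟩ ⟨j, q⟩ := fun p q hij => Sigma.Lex.lt_def.2 (Or.inl hij)
  obtain rfl : i = i' := by
    rcases lt_trichotomy i i' with h | h | h
    · exact absurd (h3 p p' h).le h1
    · exact h
    · exact absurd (h3 p' p h).le h2
  rcases lt_trichotomy k i with h | rfl | h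
  · exact Or.inr (Or.inr (Or.inl ⟨h3 q p h, h3 q p' h⟩))
  · have hpp : p ≠ p' := by
      rintro rfl
      exact h1 le_rfl
    have : q = p ∨ q = p' := by
      by_contra! hq
      have hfin : Finite (Q k) := by
        refine Nat.finite_of_card_ne_zero ?_
        rcases (hQ k).2 with h | h <;> omega
      have hcard : 2 < Nat.card (Q k) := by
        have := Fintype.ofFinite (Q k)
        rw [Nat.card_eq_fintype_card]
        exact Fintype.two_lt_card_iff.2 ⟨p, p', q, hpp, hq.1.symm, hq.2.symm⟩
      rcases (hQ k).2 with h | h <;> omega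
    rcases this with rfl | rfl
    · exact Or.inl rfl
    · exact Or.inr (Or.inl rfl)
  · exact Or.inr (Or.inr (Or.inr ⟨h3 p q h, h3 p' q h⟩))

/-- Two covers of one element are incomparable. They cannot both lie in the forest, nor one in each
part, so they form a two-element layer of the ladder. -/
theorem lt_or_gt_of_covBy_sumLex {F L : Type u} [PartialOrder F] [PartialOrder L]
    (hF : IsRootedForest F) (hL : IsLadder L) {x y z : F ⊕ₗ L} (hy : x ⋖ y) (hz : x ⋖ z)
    (hne : y ≠ z) (w : F ⊕ₗ L) : w = y ∨ w = z ∨ (w < y ∧ w < z) ∨ (y < w ∧ z < w) := by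
  have hyz : ¬ y ≤ z := fun h => hz.2 hy.lt (lt_of_le_of_ne h hne)
  have hzy : ¬ z ≤ y := fun h => hy.2 hz.lt (lt_of_le_of_ne h hne.symm)
  have key : ∀ {p q : F}, toLex (Sum.inl p : F ⊕ L) ⋖ toLex (Sum.inl q) → p ⋖ q :=
    fun h => ⟨Sum.Lex.inl_lt_inl_iff.1 h.1, fun c h1 h2 =>
      h.2 (Sum.Lex.inl_lt_inl_iff.2 h1) (Sum.Lex.inl_lt_inl_iff.2 h2)⟩
  rcases y with y | y <;> rcases z with z | z
  · rcases x with x | x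
    · exact absurd (congrArg (fun t => toLex (Sum.inl t : F ⊕ L)) (hF x y z (key hy) (key hz))) hne
    · exact absurd hy.lt Sum.Lex.not_inr_lt_inl
  · exact absurd (Sum.Lex.inl_le_inr y z) hyz
  · exact absurd (Sum.Lex.inl_le_inr z y) hzy
  · rcases w with w | w
    · exact Or.inr (Or.inr (Or.inl ⟨Sum.Lex.inl_lt_inr w y, Sum.Lex.inl_lt_inr w z⟩))
    · have h1 : ¬ y ≤ z := fun h => hyz (Sum.Lex.inr_le_inr_iff.2 h)
      have h2 : ¬ z ≤ y := fun h => hzy (Sum.Lex.inr_le_inr_iff.2 h)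
      rcases hL.lt_or_gt_of_incomparable h1 h2 w with rfl | rfl | h | h
      · exact Or.inl rfl
      · exact Or.inr (Or.inl rfl)
      · exact Or.inr (Or.inr (Or.inl
          ⟨Sum.Lex.inr_lt_inr_iff.2 h.1, Sum.Lex.inr_lt_inr_iff.2 h.2⟩))
      · exact Or.inr (Or.inr (Or.inr
          ⟨Sum.Lex.inr_lt_inr_iff.2 h.1, Sum.Lex.inr_lt_inr_iff.2 h.2⟩))

/-- This consequence is all that the existence proof needs; it can be stated without a decomposition
and survives the addition of relations. -/
theorem IsForestLadderSum.coversAreRungs {α : Type u} [PartialOrder α]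
    (h : IsForestLadderSum α) : CoversAreRungs α := by
  obtain ⟨k, F, L, _, _, hFL, ⟨e⟩⟩ := h
  refine CoversAreRungs.of_orderIso e ?_
  have hlt : ∀ {j : Fin k} (p q : F j ⊕ₗ L j),
      (⟨j, p⟩ : Σ j, F j ⊕ₗ L j) < ⟨j, q⟩ ↔ p < q := fun p q => Sigma.mk_lt_mk_iff
  have hfst : ∀ {p q : Σ j, F j ⊕ₗ L j}, p ≤ q → p.1 = q.1 := by
    rintro _ _ ⟨j, p, q, -⟩
    rfl
  rintro ⟨j, x⟩ ⟨j₁, y⟩ ⟨j₂, z⟩ hy hz hne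
  obtain rfl : j = j₁ := hfst hy.le
  obtain rfl : j = j₂ := hfst hz.le
  have hcov : ∀ {p q : F j ⊕ₗ L j}, (⟨j, p⟩ : Σ j, F j ⊕ₗ L j) ⋖ ⟨j, q⟩ → p ⋖ q := fun h =>
    ⟨(hlt _ _).1 h.1, fun c h1 h2 => h.2 ((hlt _ _).2 h1) ((hlt _ _).2 h2)⟩
  have hne' : y ≠ z := fun h => hne (by rw [h])
  have key := lt_or_gt_of_covBy_sumLex (hFL j).1 (hFL j).2 (hcov hy) (hcov hz) hne'
  have hyz : ¬ y < z := (hcov hz).2 (hcov hy).lt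
  have hzy : ¬ z < y := (hcov hy).2 (hcov hz).lt
  have hmem : ∀ w : Σ j, F j ⊕ₗ L j,
      (w = ⟨j, y⟩ ∨ w = ⟨j, z⟩ ∨ w < ⟨j, y⟩ ∨ ⟨j, y⟩ < w) ↔ w.1 = j := by
    intro w
    constructor
    · rintro (rfl | rfl | h | h)
      · rfl
      · rfl
      · exact hfst h.le
      · exact (hfst h.le).symm
    · obtain ⟨i, w⟩ := w
      rintro rfl
      rcases key w with rfl | rfl | h | h
      · exact Or.inl rfl
      · exact Or.inr (Or.inl rfl)
      · exact Or.inr (Or.inr (Or.inl ((hlt _ _).2 h.1)))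
      · exact Or.inr (Or.inr (Or.inr ((hlt _ _).2 h.1)))
  refine ⟨fun w => ?_, fun w => ?_, fun w w' hw => by rw [hmem, hmem, hfst hw]⟩
  · by_cases hw : w.1 = j
    · obtain ⟨i, w⟩ := w
      obtain rfl : i = j := hw
      rw [hlt, hlt]
      rcases key w with rfl | rfl | h | h
      · simp [hyz]
      · simp [hzy]
      · simp [h]
      · simp [h.1.not_gt, h.2.not_gt]
    · exact ⟨fun h => absurd (hfst h.le) hw, fun h => absurd (hfst h.le) hw⟩
  · by_cases hw : w.1 = j
    · obtain ⟨i, w⟩ := w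
      obtain rfl : i = j := hw
      rw [hlt, hlt]
      rcases key w with rfl | rfl | h | h
      · simp [hzy]
      · simp [hyz]
      · simp [h.1.not_gt, h.2.not_gt]
      · simp [h]
    · exact ⟨fun h => absurd (hfst h.le).symm hw, fun h => absurd (hfst h.le).symm hw⟩

/-! ### Adding a relation within a rung -/

section AddRelation

variable {α : Type u} [r : PartialOrder α] {y z : α}

/-- The partial order with the additional relation `y ≺ z` within a rung. -/
abbrev addRelation (h : IsRung y z) (hyz : ¬ y ≤ z) (hzy : ¬ z ≤ y) : PartialOrder α where
  le w w' := w ≤ w' ∨ (w = y ∧ w' = z)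
  lt w w' := (w ≤ w' ∨ (w = y ∧ w' = z)) ∧ ¬ (w' ≤ w ∨ (w' = y ∧ w = z))
  lt_iff_le_not_ge _ _ := Iff.rfl
  le_refl w := Or.inl le_rfl
  le_trans := by
    rintro p q s (h1 | ⟨rfl, rfl⟩) (h2 | ⟨h3, rfl⟩)
    · exact Or.inl (h1.trans h2)
    · subst h3
      rcases h1.eq_or_lt with rfl | h1
      · exact Or.inr ⟨rfl, rfl⟩
      · exact Or.inl ((h.lt_left p).1 h1).le
    · rcases h2.eq_or_lt with rfl | h2
      · exact Or.inr ⟨rfl, rfl⟩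
      · exact Or.inl ((h.lt_right s).2 h2).le
    · exact absurd h3.ge hyz
  le_antisymm := by
    rintro p q (h1 | ⟨rfl, rfl⟩) (h2 | ⟨h3, h4⟩)
    · exact le_antisymm h1 h2
    · subst h3 h4
      exact absurd h1 hzy
    · exact absurd h2 hzy
    · exact h3.symm

variable (h : IsRung y z) (hyz : ¬ y ≤ z) (hzy : ¬ z ≤ y)

theorem addRelation_lt_iff {p q : α} :
    (addRelation h hyz hzy).lt p q ↔ p < q ∨ (p = y ∧ q = z) := by
  have h1 : (addRelation h hyz hzy).lt p q ↔
      (p ≤ q ∨ (p = y ∧ q = z)) ∧ ¬ (q ≤ p ∨ (q = y ∧ p = z)) :=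
    (addRelation h hyz hzy).lt_iff_le_not_ge p q
  rw [h1, lt_iff_le_not_ge]
  constructor
  · rintro ⟨h2 | h2, h3⟩
    · exact Or.inl ⟨h2, fun h4 => h3 (Or.inl h4)⟩
    · exact Or.inr h2
  · rintro (⟨h2, h3⟩ | ⟨rfl, rfl⟩)
    · refine ⟨Or.inl h2, ?_⟩
      rintro (h4 | ⟨rfl, rfl⟩)
      · exact h3 h4
      · exact hzy h2
    · refine ⟨Or.inr ⟨rfl, rfl⟩, ?_⟩
      rintro (h4 | ⟨h4, -⟩)
      · exact hzy h4
      · exact hzy h4.le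

theorem isBreakable_addRelation : @IsBreakable α (addRelation h hyz hzy) y z := by
  refine ⟨(addRelation_lt_iff h hyz hzy).2 (Or.inr ⟨rfl, rfl⟩), fun p q hpq => ?_⟩
  have hU : ∀ w, ((w ≤ y ∨ (w = y ∧ y = z)) ∨ (z ≤ w ∨ (z = y ∧ w = z))) ↔
      (w = y ∨ w = z ∨ w < y ∨ y < w) := by
    intro w
    have hne : y ≠ z := fun h => hyz h.le
    simp only [hne, hne.symm, and_false, false_and, or_false, h.lt_right, le_iff_lt_or_eq,
      eq_comm (a := z) (b := w)]
    tauto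
  change ((p ≤ y ∨ (p = y ∧ y = z)) ∨ (z ≤ p ∨ (z = y ∧ p = z))) ↔
    ((q ≤ y ∨ (q = y ∧ y = z)) ∨ (z ≤ q ∨ (z = y ∧ q = z)))
  rcases hpq with hpq | ⟨rfl, rfl⟩
  · rw [hU, hU]
    exact h.closed p q hpq
  · simp

/-- Two covers `y', z'` of an element in the new order turn out to be covers in the old order and
different from `y` and `z`. So they were a rung before, and their relations have not changed. -/
theorem coversAreRungs_addRelation (hα : CoversAreRungs α) :
    @CoversAreRungs α (addRelation h hyz hzy) := by
  intro x' y' z' hy hz hne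
  have hlt : ∀ {p q : α}, (addRelation h hyz hzy).lt p q ↔ p < q ∨ (p = y ∧ q = z) :=
    addRelation_lt_iff h hyz hzy
  have hy1 := hlt.1 hy.1
  have hz1 := hlt.1 hz.1
  have hy2 : ∀ c, (x' < c ∨ (x' = y ∧ c = z)) → ¬ (c < y' ∨ (c = y ∧ y' = z)) :=
    fun c h1 h2 => hy.2 (hlt.2 h1) (hlt.2 h2)
  have hz2 : ∀ c, (x' < c ∨ (x' = y ∧ c = z)) → ¬ (c < z' ∨ (c = y ∧ z' = z)) :=
    fun c h1 h2 => hz.2 (hlt.2 h1) (hlt.2 h2)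
  -- In the new order `z` is the only cover of `y`.
  have hx : x' ≠ y := by
    rintro rfl
    have key : ∀ t, (x' < t ∨ (x' = x' ∧ t = z)) →
        (∀ c, (x' < c ∨ (x' = x' ∧ c = z)) → ¬ (c < t ∨ (c = x' ∧ t = z))) → t = z := by
      rintro t (h1 | h1) h2
      · exact absurd (Or.inl ((h.lt_right t).1 h1)) (h2 z (Or.inr ⟨rfl, rfl⟩))
      · exact h1.2
    exact hne ((key y' hy1 hy2).trans (key z' hz1 hz2).symm)
  have hy3 : x' < y' := hy1.resolve_right fun h1 => hx h1.1
  have hz3 : x' < z' := hz1.resolve_right fun h1 => hx h1.1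
  have hR : IsRung y' z' := hα x' y' z' ⟨hy3, fun c h1 h2 => hy2 c (Or.inl h1) (Or.inl h2)⟩
    ⟨hz3, fun c h1 h2 => hz2 c (Or.inl h1) (Or.inl h2)⟩ hne
  have hyz' : y' ≠ z := by
    rintro rfl
    exact hy2 y (Or.inl ((h.lt_left x').2 hy3)) (Or.inr ⟨rfl, rfl⟩)
  have hzz' : z' ≠ z := by
    rintro rfl
    exact hz2 y (Or.inl ((h.lt_left x').2 hz3)) (Or.inr ⟨rfl, rfl⟩)
  -- A further cover `t` of an element below `y` would lie in the summand of the rung, hence be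
  -- comparable to `y`, contradicting that both are covers.
  have key : ∀ t, x' < y → x' < t → (∀ c, x' < c → ¬ c < y) → (∀ c, x' < c → ¬ c < t) →
      t ≠ y → t ≠ z → False := by
    intro t h1 h2 h3 h4 h5 h6
    rcases (h.closed x' t h2.le).1 (Or.inr (Or.inr (Or.inl h1))) with h7 | h7 | h7 | h7
    · exact h5 h7
    · exact h6 h7
    · exact h3 t h2 h7
    · exact h4 y h1 h7
  have hyy' : y' ≠ y := by
    rintro rfl
    exact key z' hy3 hz3 (fun c h1 h2 => hy2 c (Or.inl h1) (Or.inl h2))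
      (fun c h1 h2 => hz2 c (Or.inl h1) (Or.inl h2)) hne.symm hzz'
  have hzy' : z' ≠ y := by
    rintro rfl
    exact key y' hz3 hy3 (fun c h1 h2 => hz2 c (Or.inl h1) (Or.inl h2))
      (fun c h1 h2 => hy2 c (Or.inl h1) (Or.inl h2)) hne hyz'
  have l1 : ∀ w, (addRelation h hyz hzy).lt w y' ↔ w < y' := fun w => by
    rw [hlt, or_iff_left fun h1 => hyz' h1.2]
  have l2 : ∀ w, (addRelation h hyz hzy).lt w z' ↔ w < z' := fun w => by
    rw [hlt, or_iff_left fun h1 => hzz' h1.2]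
  have l3 : ∀ w, (addRelation h hyz hzy).lt y' w ↔ y' < w := fun w => by
    rw [hlt, or_iff_left fun h1 => hyy' h1.1]
  have l4 : ∀ w, (addRelation h hyz hzy).lt z' w ↔ z' < w := fun w => by
    rw [hlt, or_iff_left fun h1 => hzy' h1.1]
  refine @IsRung.mk α (addRelation h hyz hzy) y' z' (fun w => ?_) (fun w => ?_)
    (fun p q hpq => ?_)
  · exact (l1 w).trans ((hR.lt_left w).trans (l2 w).symm)
  · exact (l3 w).trans ((hR.lt_right w).trans (l4 w).symm)
  · have l5 : ∀ w, (w = y' ∨ w = z' ∨ (addRelation h hyz hzy).lt w y' ∨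
        (addRelation h hyz hzy).lt y' w) ↔ (w = y' ∨ w = z' ∨ w < y' ∨ y' < w) :=
      fun w => by rw [l1, l3]
    refine (l5 p).trans (Iff.trans ?_ (l5 q).symm)
    rcases hpq with hpq | ⟨rfl, rfl⟩
    · exact hR.closed p q hpq
    · simp only [hyy'.symm, hzy'.symm, hyz'.symm, hzz'.symm, false_or]
      rw [h.lt_right, h.lt_left]

end AddRelation

/-! ### Reaching the given leaf posets from forests -/

section Existence

variable {T : RootedTree.{u}} [Finite T] {d : ℕ}

/-- The number of pairs of siblings which are not related in the leaf posets. -/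
noncomputable def unrelatedPairs (P : LeafPosets T d) : ℕ :=
  ∑ v : BottomNode T d, Nat.card {p : Child v.1 × Child v.1 // ¬ (P v).le p.1 p.2}

/-- If some element has two covers, they form a rung, and a relation is added within it. This leaves
fewer unrelated pairs, and breaking the new relation recovers the given poset. -/
theorem exists_computedSpectrum (P : LeafPosets T d)
    (hP : ∀ v, @CoversAreRungs (Child v.1) (P v)) : ∃ s, ComputedSpectrum P s := by
  classical
  induction hn : unrelatedPairs P using Nat.strong_induction_on generalizing P with
  | _ n ih =>
    by_cases hF : ∀ v, @IsRootedForest (Child v.1) (P v)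
    · exact exists_computedSpectrum_forest P hF
    simp only [not_forall] at hF
    obtain ⟨v, hv⟩ := hF
    let _ := P v
    simp only [IsRootedForest, not_forall] at hv
    obtain ⟨x, y, z, hy, hz, hne⟩ := hv
    have hR : IsRung y z := hP v x y z hy hz hne
    have hyz : ¬ y ≤ z := fun h => hz.2 hy.lt (lt_of_le_of_ne h hne)
    have hzy : ¬ z ≤ y := fun h => hy.2 hz.lt (lt_of_le_of_ne h (Ne.symm hne))
    set P' : LeafPosets T d := Function.update P v (addRelation hR hyz hzy) with hP'
    have e1 : P' v = addRelation (r := P v) hR hyz hzy := Function.update_self _ _ _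
    have e2 : ∀ u, u ≠ v → P' u = P u := fun u hu => Function.update_of_ne hu _ _
    have hle : ∀ p q : Child v.1, (P' v).le p q ↔ (P v).le p q ∨ (p = y ∧ q = z) := by
      intro p q
      rw [e1]
      rfl
    have hlt : unrelatedPairs P' < n := by
      rw [← hn]
      refine Finset.sum_lt_sum (fun u _ => ?_) ⟨v, Finset.mem_univ v, ?_⟩
      · by_cases hu : u = v
        · subst hu
          exact Nat.card_le_card_of_injective
            (fun p => ⟨p.1, fun h => p.2 ((hle _ _).2 (Or.inl h))⟩)
            (fun p q h => Subtype.ext (congrArg (fun t => t.1) h))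
        · rw [e2 u hu]
      · refine Set.ncard_lt_ncard (s := {p : Child v.1 × Child v.1 | ¬ (P' v).le p.1 p.2})
          (t := {p | ¬ (P v).le p.1 p.2}) ⟨fun p hp h => hp ((hle _ _).2 (Or.inl h)), fun h => ?_⟩
          (Set.toFinite _)
        exact h (a := (y, z)) hyz ((hle _ _).2 (Or.inr ⟨rfl, rfl⟩))
    obtain ⟨s, hs⟩ := ih _ hlt P' (fun u => by
      by_cases hu : u = v
      · subst hu
        rw [e1]
        exact coversAreRungs_addRelation (r := P u) hR hyz hzy (hP u)
      · rw [e2 u hu]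
        exact hP u) rfl
    refine ⟨_, ComputedSpectrum.step P' P s hs v y z ?_ ⟨fun u hu => (e2 u hu).symm,
      fun p q => ?_⟩⟩
    · rw [e1]
      exact isBreakable_addRelation (r := P v) hR hyz hzy
    · rw [hle]
      constructor
      · intro h
        refine ⟨Or.inl h, ?_⟩
        rintro ⟨rfl, rfl⟩
        exact hyz h
      · rintro ⟨h | h, h'⟩
        · exact h
        · exact absurd h h'

end Existence

end TreeShuffle

open TreeShuffle Polynomial in
theorem theorem4p1 (T : RootedTree.{u}) [Finite T] (d : ℕ) (hd : 0 < d)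
    (hT : ∀ v : T, IsMax v → depth v = d) (P : LeafPosets T d)
    (hP : ∀ v, @IsForestLadderSum (Child v.1) (P v)) :
    (∃ s : Multiset (MoveSet T → ℤ), ComputedSpectrum P s) ∧
    ∀ s : Multiset (MoveSet T → ℤ), ComputedSpectrum P s →
      (∀ (R : Type w) [CommRing R] (x : MoveSet T → R),
        (transitionMatrix P x).charpoly = (s.map fun c => X - C (linearForm c x)).prod) ∧
      (∀ c ∈ s, ∀ E, c E = -1 ∨ c E = 0 ∨ c E = 1) ∧
      (∀ c ∈ s, ∀ (v : BottomNode T d) (a b : Child v.1), @IsBreakable (Child v.1) (P v) a b →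
        PropertyA a b c ∨ PropertyB P v a c) := by
  refine ⟨exists_computedSpectrum P fun v => ?_, fun s hs => ?_⟩
  · let _ := P v
    exact (hP v).coversAreRungs
  · have h := hs.isSpectrum hT
    exact ⟨fun R _ x => h.charpoly_eq x, h.coeff, h.property⟩
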